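/- **Setting.** Let $L>0$, $\Omega=[-L,L]^2$, $\Omega^\delta=(-L-\delta,L+\delta)^2$, $s\in(0,1)$, and $c_{2,\sigma}=\dfrac{2^{2\sigma}|\sigma|\,\Gamma(1+\sigma)}{\pi\,\Gamma(1-\sigma)}$. The fractional Dirichlet problem is $$(-\Delta)^su(x)=c_{2,s}\,\mathrm{P.V.}\!\int_{\mathbb R^2}\frac{u(x)-u(y)}{|x-y|^{2+2s}}\,dy=f(x)\ \ (x\in\Omega),\qquad u=g\ \text{ in }\mathbb R^2\setminus\Omega,$$ where $g=0$ in $\Omega$, $g\in L^\infty(\mathbb R^2)$ and $\operatorname{supp} g$ is bounded. **Scheme.** Let $N\ge1$, $h=2L/N$, $(x_i,y_j)=(-L+ih,-L+jh)$ and $u_{i,j}=u(x_i,y_j)$. For a grid function $v$ put $$(-\Delta)_{h,1}v_{i,j}=-\tfrac{1}{h^2}\big(v_{i-1,j}+v_{i+1,j}+v_{i,j-1}+v_{i,j+1}-4v_{i,j}\big),$$ $$(-\Delta)_{h,2}v_{i,j}=-\tfrac1{2h^2}\big(v_{i-1,j-1}+v_{i+1,j-1}+v_{i-1,j+1}+v_{i+1,j+1}-4v_{i,j}\big),$$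 and $A_{h,\theta}=\theta(-\Delta)_{h,1}+(1-\theta)(-\Delta)_{h,2}$. Let $\bar\phi(\xi,\eta)=(1-|\xi|/h)(1-|\eta|/h)$ on $(-h,h)^2$ and $\bar\phi=0$ elsewhere, and $\phi_{p,q}=\bar\phi(\cdot-(x_p,y_q))\,\chi_\Omega$. Put $$\bar\omega_{p,q}=c_{2,s-1}\int_{[-h,h]^2}|(ph,qh)+z|^{-2s}\,\bar\phi(z)\,dz,\qquad \bar\omega^M_{0,0}=\bar\omega_{0,0}+c_{0,0},\quad \bar\omega^M_{p,q}=\bar\omega_{p,q}\ \text{ for }(p,q)\ne(0,0),$$ with the correction $c_{0,0}=\kappa h^{2-2s}$, $\kappa\ge0$, and let $w^M_{p,q}=A_{h,\theta}\bar\omega^M_{p,q}$. With $\mathcal B=\{(p,q):0\le p,q\le N,\ pq(p-N)(q-N)=0\}$ put $$R_{i,j}=c_{2,s-1}\int_{\mathbb R^2}|(x_i,y_j)-z|^{-2s}\Big(g(z)+\sum_{(p,q)\in\mathcal B}u_{p,q}\phi_{p,q}(z)\Big)dz,$$ and $R^M_{i,j}=R_{i,j}+c_{0,0}u_{i,j}$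 if $(i,j)\in\mathcal B$, $R^M_{i,j}=R_{i,j}$ otherwise (so $R^M=R$ if $c_{0,0}=0$ or if $u=0$ on $\partial\Omega$). For indices $i,j,p,q\in\{1,\dots,N-1\}$ let $\mathbf B_2=(w^M_{p-i,q-j})_{(i,j),(p,q)}$, $\mathbf U=(u_{i,j})$, $\mathbf F=(f(x_i,y_j))$, $\mathbf G=(A_{h,\theta}R^M_{i,j})$. Use the norms $\|v\|_\infty=\max|v_{i,j}|$ and $\|v\|_2=\big(h^2\sum v_{i,j}^2\big)^{1/2}$. Call $(\theta,\kappa)$ *suitable for $s$* if $\theta\in[0,1]$, $\kappa\ge0$ and, for every $h>0$, $w^M_{0,0}>0$ and $w^M_{p,q}<0$ for all $(p,q)\in\mathbb Z^2\setminus\{(0,0)\}$. **Theorem.** Let $s\in(\frac1{250},\frac12)\cup(\frac12,1)$. Then a pair $(\theta,\kappa)$ that is suitable for $s$ exists. Moreover, let $(\theta,\kappa)$ be any suitable pair, let $L,\delta>0$ and $\alpha\in(\max(0,2s-1),1]$, and let $u$ be a solution of the fractional Dirichlet problem with $u\in C^{1,\alpha}(\overline{\Omega^\delta})$. Then there is a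 constant $C>0$, independent of $h$, such that for all $N\ge1$ with $4h<\delta$ the linear system $$\mathbf B_2\mathbf U_h+\mathbf G=\mathbf F$$ has exactly one solution $\mathbf U_h$, and $$\|\mathbf U-\mathbf U_h\|_\infty<C\,h^{1+\alpha-2s},\qquad \|\mathbf U-\mathbf U_h\|_2<C\,h^{1+\alpha-2s}.$$ -/

import Mathlib

open MeasureTheory Filter Topology

noncomputable section

namespace FracDirichlet

/-- The Euclidean norm on the plane (the norm that Lean puts on `ℝ × ℝ` is the sup norm). -/
def euclidNorm (z : ℝ × ℝ) : ℝ := Real.sqrt (z.1 ^ 2 + z.2 ^ 2)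

/-- The closed square `[-r, r] × [-r, r]`. -/
def square (r : ℝ) : Set (ℝ × ℝ) := Set.Icc (-r) r ×ˢ Set.Icc (-r) r

/-- The constant `c_{2,s} = 2^{2s} |s| Γ(1+s) / (π Γ(1-s))`, for `s` in `(0, 1)` and in `(-1, 0)`. -/
def fracConst (s : ℝ) : ℝ :=
  (2 : ℝ) ^ (2 * s) * |s| * Real.Gamma (1 + s) / (Real.pi * Real.Gamma (1 - s))

/-- The principal value
`c_{2,s} P.V. ∫ (u(x) - u(y)) / |x - y|^{2+2s} dy` exists and equals `l`,
that is, the integral fractional Laplacian `(-Δ)^s u (x)` exists and equals `l`. -/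
def HasFracLaplacianAt (s : ℝ) (u : ℝ × ℝ → ℝ) (x : ℝ × ℝ) (l : ℝ) : Prop :=
  Tendsto
    (fun ε : ℝ => fracConst s *
      ∫ y in {y : ℝ × ℝ | ε < euclidNorm (x - y)},
        (u x - u y) / euclidNorm (x - y) ^ (2 + 2 * s))
    (𝓝[>] 0) (𝓝 l)

/-- `u ∈ C^{1,α}` on the set `K` (used for a closed square): `u` is continuously differentiable
on `K` and its derivative is Hölder continuous of exponent `α` on `K`. -/
def IsC1Holder (α : ℝ) (u : ℝ × ℝ → ℝ) (K : Set (ℝ × ℝ)) : Prop :=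
  ContDiffOn ℝ 1 u K ∧
    ∃ M : ℝ, ∀ x ∈ K, ∀ y ∈ K,
      ‖fderivWithin ℝ u K x - fderivWithin ℝ u K y‖ ≤ M * euclidNorm (x - y) ^ α

/-- `u` solves `(-Δ)^s u = f` in `Ω = [-L, L]²`, `u = g` in the complement of `Ω`, with data
`g = 0` in `Ω`, `g ∈ L^∞(ℝ²)` of bounded support. -/
structure IsDirichletSolution (s L : ℝ) (f g u : ℝ × ℝ → ℝ) : Prop where
  g_eq_zero : ∀ x ∈ square L, g x = 0
  g_memLp : MemLp g ⊤ (volume : Measure (ℝ × ℝ))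
  g_support : Bornology.IsBounded (Function.support g)
  equation : ∀ x ∈ square L, HasFracLaplacianAt s u x (f x)
  exterior : ∀ x, x ∉ square L → u x = g x

/-- The mesh size `h = 2L / N`. -/
def meshSize (L : ℝ) (N : ℕ) : ℝ := 2 * L / N

/-- The grid point `(x_i, y_j) = (-L + i h, -L + j h)`. -/
def node (L h : ℝ) (i j : ℤ) : ℝ × ℝ := (-L + i * h, -L + j * h)

/-- The bilinear hat function of width `h` centred at the origin. -/
def hat (h : ℝ) (z : ℝ × ℝ) : ℝ :=
  if |z.1| < h ∧ |z.2| < h then (1 - |z.1| / h) * (1 - |z.2| / h) else 0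

/-- The basis function `φ_{p,q}` of the node `(x_p, y_q)`, cut off outside `Ω = [-L, L]²`. -/
def basisFun (L h : ℝ) (p q : ℤ) : ℝ × ℝ → ℝ :=
  (square L).indicator (fun z => hat h (z - node L h p q))

/-- `θ (-Δ)_{h,1} + (1 - θ) (-Δ)_{h,2}`, a convex combination of the two five-point
discretizations of `-Δ`, applied to a grid function. -/
def discLap (θ h : ℝ) (v : ℤ → ℤ → ℝ) (i j : ℤ) : ℝ :=
  θ * (-(v (i - 1) j + v (i + 1) j + v i (j + 1) + v i (j - 1) - 4 * v i j) / h ^ 2) +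
  (1 - θ) * (-(v (i - 1) (j - 1) + v (i + 1) (j - 1) + v (i - 1) (j + 1) + v (i + 1) (j + 1)
      - 4 * v i j) / (2 * h ^ 2))

/-- The weights `ω̄_{p,q}` of the discretization of `(-Δ)^{s-1}`. -/
def omegaBar (s h : ℝ) (p q : ℤ) : ℝ :=
  fracConst (s - 1) *
    ∫ z in square h, euclidNorm (((p : ℝ) * h, (q : ℝ) * h) + z) ^ (-2 * s) * hat h z

/-- The corrected weights `ω̄^M_{p,q}`: the constant `c` is added to `ω̄_{0,0}` only. -/
def omegaBarM (s c h : ℝ) (p q : ℤ) : ℝ :=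
  omegaBar s h p q + if p = 0 ∧ q = 0 then c else 0

/-- The weights `w^M_{p,q}` of the corrected discretization of `(-Δ)^s`. -/
def weightM (s θ c h : ℝ) (p q : ℤ) : ℝ := discLap θ h (omegaBarM s c h) p q

/-- The correction constant `c_{0,0} = κ h^{2-2s}`; this power of `h` is the one by which
`ω̄_{0,0}` scales. -/
def corr (s κ h : ℝ) : ℝ := κ * h ^ (2 - 2 * s)

/-- `θ ∈ [0,1]` and `c_{0,0} = κ h^{2-2s} ≥ 0` are suitable: the central weight is positive and
all the other weights are negative, on every mesh. -/
def Suitable (s θ κ : ℝ) : Prop :=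
  θ ∈ Set.Icc (0 : ℝ) 1 ∧ 0 ≤ κ ∧
    ∀ h : ℝ, 0 < h → ∀ p q : ℤ,
      (p = 0 ∧ q = 0 → 0 < weightM s θ (corr s κ h) h p q) ∧
      (¬(p = 0 ∧ q = 0) → weightM s θ (corr s κ h) h p q < 0)

/-- The indices `(p, q)`, `0 ≤ p, q ≤ N`, of the nodes on the boundary of `Ω`. -/
def boundaryIdx (N : ℕ) : Finset (ℤ × ℤ) :=
  (Finset.Icc (0 : ℤ) N ×ˢ Finset.Icc (0 : ℤ) N).filter
    (fun r => r.1 * r.2 * (r.1 - N) * (r.2 - N) = 0)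

/-- The contribution `R_{i,j}` of the exterior data and of the boundary nodes to the
(uncorrected) discretization of `(-Δ)^{s-1} u` at the node `(x_i, y_j)`. -/
def dataTerm (s L : ℝ) (N : ℕ) (g u : ℝ × ℝ → ℝ) (i j : ℤ) : ℝ :=
  fracConst (s - 1) *
      (∫ y, euclidNorm (node L (meshSize L N) i j - y) ^ (-2 * s) * g y) +
  fracConst (s - 1) *
    ∑ r ∈ boundaryIdx N,
      ∫ y, euclidNorm (node L (meshSize L N) i j - y) ^ (-2 * s) *
        (u (node L (meshSize L N) r.1 r.2) * basisFun L (meshSize L N) r.1 r.2 y)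

/-- `R_{i,j}` for the corrected discretization `(-Δ)_h^{s-1} u_{i,j} + c u_{i,j}` of
`(-Δ)^{s-1} u`: at a boundary node the added term `c u_{i,j}` is part of the data. It equals
`R_{i,j}` if `c = 0` or if `u` vanishes on the boundary of `Ω`. -/
def dataTermM (s c L : ℝ) (N : ℕ) (g u : ℝ × ℝ → ℝ) (i j : ℤ) : ℝ :=
  dataTerm s L N g u i j +
    if (i, j) ∈ boundaryIdx N then c * u (node L (meshSize L N) i j) else 0

/-- Indices of the interior nodes: `a : Fin (N - 1)` stands for the number `a + 1`, so the
numbers are `1, …, N - 1`. -/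
abbrev InnerIdx (N : ℕ) : Type := Fin (N - 1) × Fin (N - 1)

/-- The number in `{1, …, N - 1}` for which `a` stands. -/
def num {N : ℕ} (a : Fin (N - 1)) : ℤ := (a : ℤ) + 1

/-- The block Toeplitz matrix `B_2` with entries `t_{p-i,q-j} = w^M_{p-i,q-j}`. -/
def schemeMatrix (s θ c h : ℝ) (N : ℕ) : Matrix (InnerIdx N) (InnerIdx N) ℝ :=
  fun a b => weightM s θ c h (num b.1 - num a.1) (num b.2 - num a.2)

/-- The values of a function at the interior nodes. -/
def nodalValues (L : ℝ) (N : ℕ) (v : ℝ × ℝ → ℝ) : InnerIdx N → ℝ :=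
  fun a => v (node L (meshSize L N) (num a.1) (num a.2))

/-- The vector `G`. -/
def schemeData (s θ c L : ℝ) (N : ℕ) (g u : ℝ × ℝ → ℝ) : InnerIdx N → ℝ :=
  fun a => discLap θ (meshSize L N) (dataTermM s c L N g u) (num a.1) (num a.2)

/-- The linear system `B_2 U_h + G = F`, with `c_{0,0} = κ h^{2-2s}`. -/
def IsSchemeSolution (s θ κ L : ℝ) (N : ℕ) (f g u : ℝ × ℝ → ℝ) (Uh : InnerIdx N → ℝ) : Prop :=
  (schemeMatrix s θ (corr s κ (meshSize L N)) (meshSize L N) N).mulVec Uh +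
      schemeData s θ (corr s κ (meshSize L N)) L N g u =
    nodalValues L N f

/-- The discrete `l^∞` norm of a grid function. -/
def normInf {N : ℕ} (v : InnerIdx N → ℝ) : ℝ := ⨆ a, |v a|

/-- The discrete `l²` norm of a grid function with mesh size `h` in two dimensions. -/
def normTwo (h : ℝ) {N : ℕ} (v : InnerIdx N → ℝ) : ℝ := Real.sqrt (h ^ 2 * ∑ a, v a ^ 2)

end FracDirichlet

end

open FracDirichlet

noncomputable section

namespace FracDirichlet

/-! The continuous and the discrete operator share one structure: minus a Laplacian, applied to a
Riesz potential. Since -Δ|z|^(-2s) = -4s²|z|^(-2s-2) and c_{2,s} = 4s² c_{2,s-1} (`fracConst_eq`),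
(-Δ)^s is -Δ after convolution with c_{2,s-1}|z|^(-2s). The scheme, applied to the exact solution,
is the discrete Laplacian of the potential of the bilinear interpolant plus a correction term
(`scheme_apply`). The error bound is then consistency plus stability.

Consistency (`exists_consistency`). Both (-Δ)^s u and the discrete Laplacian of the potential of u
are integrals of second differences of u, and their kernels differ by a rescaled `lapDefect`. Near
the origin this defect is no worse than |z|^(-2s-2) plus an integrable function; at infinity it is
O(|z|^(-2s-4)). Second differences of u are O(|z|^(1+α)), so for 2s-1 < α ≤ 1 the product is
integrable, and scaling gives h^(1+α-2s). The interpolation error h^(1+α) loses a factor h^(-2s),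
the L¹ norm of the discrete Laplacian of the kernel; the correction costs h^(2-2s) h^(1+α) / h². All
three have the same order.

Stability (`exists_le_sum_schemeMatrix`). The weights of a suitable pair are negative off the
centre, and over ℤ² they sum to zero (`tendsto_sum_weightM`), because second differences of the
kernel have integral zero (`integral_secDiff_ker`). A row sum is therefore at least the mass of any
weights that the row omits. Distant weights are at least a constant times |r|^(-2s-2) h^(-2s) in
size, so a block of order N² omitted weights contributes a multiple of (Nh)^(-2s) = (2L)^(-2s),
independent of the mesh. The discrete maximum principle turns this into a bounded inverse in the sup
norm; the l² bound follows because the domain is bounded.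

Existence of a suitable pair (`exists_suitable`). Take θ = 7/11 and κ large. By homogeneity only the
unit mesh matters, and κ settles the nine central weights; the others need `lapAvg s p q < 0`. Here
|1-ζ|^(-2s) = |(1-ζ)^(-s)|² is expanded in a binomial series and integrated against weights with the
symmetries of a square, which kill most monomials. For n = p²+q² ≥ 25 the whole stencil is expanded
at once, and a term -44s²/n dominates. Up to symmetry ten nodes remain; there the averages are
bounded by explicit cubic polynomials in s. The nodes (1,0) and (1,1), too close for the series, are
reached by the two-scale equation `kerAvg_refine`. A lower bound on s enters because to first order
in s the kernel is 1 - 2s log|z|, and log|z| is harmonic: the favourable term is of order s², the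
anisotropy error of order s. -/

/-! ### Binomial series and the expansion of |1-ζ|^(-2s) -/

/-- The coefficients `s (s + 1) ⋯ (s + m - 1) / m!` of the power series of `(1 - x) ^ (-s)`. -/
def binCoef (s : ℝ) (m : ℕ) : ℝ := ∏ k ∈ Finset.range m, (s + k) / (k + 1)

@[simp] theorem binCoef_zero (s : ℝ) : binCoef s 0 = 1 := by simp [binCoef]

theorem binCoef_succ (s : ℝ) (m : ℕ) :
    binCoef s (m + 1) = binCoef s m * ((s + m) / (m + 1)) := by
  rw [binCoef, Finset.prod_range_succ, ← binCoef]

@[simp] theorem binCoef_one (s : ℝ) : binCoef s 1 = s := by simp [binCoef]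

theorem binCoef_nonneg {s : ℝ} (hs : 0 ≤ s) (m : ℕ) : 0 ≤ binCoef s m :=
  Finset.prod_nonneg fun k _ => by positivity

theorem binCoef_antitone {s : ℝ} (hs : 0 ≤ s) (hs1 : s ≤ 1) : Antitone (binCoef s) := by
  refine antitone_nat_of_succ_le fun m => ?_
  rw [binCoef_succ]
  refine mul_le_of_le_one_right (binCoef_nonneg hs m) ?_
  rw [div_le_one (by positivity)]
  linarith

/-- `binCoef s m / s` is a polynomial in s with nonnegative coefficients, hence convex on [0,1], and
the right side is its chord between the values 1/m at s = 0 and 1 at s = 1. Such bounds make every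
later estimate a low-degree polynomial inequality in s. -/
theorem binCoef_le {s : ℝ} (hs : 0 ≤ s) (hs1 : s ≤ 1) {m : ℕ} (hm : 1 ≤ m) :
    binCoef s m ≤ s * (1 / m + s * (1 - 1 / m)) := by
  induction m, hm using Nat.le_induction with
  | base => simp
  | succ m hm ih =>
    have hm' : (1 : ℝ) ≤ m := by exact_mod_cast hm
    rw [binCoef_succ]
    refine (mul_le_mul_of_nonneg_right ih (by positivity)).trans ?_
    rw [mul_assoc]
    refine mul_le_mul_of_nonneg_left ?_ hs
    push_cast
    rw [← sub_nonneg]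
    have : 1 / ((m : ℝ) + 1) + s * (1 - 1 / ((m : ℝ) + 1)) -
        (1 / (m : ℝ) + s * (1 - 1 / (m : ℝ))) * ((s + m) / (m + 1)) =
        s * (m - 1) * (1 - s) / (m * (m + 1)) := by
      field_simp
      ring
    rw [this]
    have h1 : 0 ≤ (m : ℝ) - 1 := by linarith
    have h2 : 0 ≤ 1 - s := by linarith
    positivity

theorem div_le_binCoef {s : ℝ} (hs : 0 ≤ s) {m : ℕ} (hm : 1 ≤ m) : s / m ≤ binCoef s m := by
  induction m, hm using Nat.le_induction with
  | base => simp
  | succ m hm ih =>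
    have hm' : (1 : ℝ) ≤ m := by exact_mod_cast hm
    rw [binCoef_succ]
    refine le_trans ?_ (mul_le_mul_of_nonneg_right ih (by positivity))
    push_cast
    rw [← sub_nonneg]
    have : s / (m : ℝ) * ((s + m) / (m + 1)) - s / ((m : ℝ) + 1) = s ^ 2 / (m * (m + 1)) := by
      field_simp
      ring
    rw [this]
    positivity

theorem choose_eq_binCoef (s : ℝ) (m : ℕ) :
    (Ring.choose ((s : ℂ) + m - 1) m) = (binCoef s m : ℂ) := by
  have key : Ring.choose (s + m - 1) m = binCoef s m := by
    have h1 : (m.factorial : ℝ) * Ring.choose (s + m - 1) m = ∏ k ∈ Finset.range m, (s + k) := by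
      rw [← nsmul_eq_mul, ← Ring.descPochhammer_eq_factorial_smul_choose,
        Polynomial.descPochhammer_smeval_eq_ascPochhammer]
      rw [Polynomial.ascPochhammer_smeval_cast, Polynomial.ascPochhammer_smeval_eq_eval]
      have : s + m - 1 - m + 1 = s := by ring
      rw [this]
      clear this
      induction m with
      | zero => simp
      | succ m ih => rw [Finset.prod_range_succ, ascPochhammer_succ_eval, ih]
    have h2 : binCoef s m = (∏ k ∈ Finset.range m, (s + k)) / m.factorial := by
      rw [binCoef, Finset.prod_div_distrib]
      congr 1
      exact_mod_cast Finset.prod_range_add_one_eq_factorial m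
    rw [h2, ← h1, mul_div_cancel_left₀ _ (by positivity)]
  rw [← key]
  have := Complex.ofReal_choose (s + m - 1) m
  rw [this]
  push_cast
  rfl

theorem hasSum_binCoef (s : ℝ) {ζ : ℂ} (hζ : ‖ζ‖ < 1) :
    HasSum (fun m : ℕ => (binCoef s m : ℂ) * ζ ^ m) ((1 - ζ) ^ (-(s : ℂ))) := by
  have h := (Complex.one_div_one_sub_cpow_hasFPowerSeriesOnBall_zero (s : ℂ)).hasSum
    (y := ζ) (by
      rw [← ENNReal.ofReal_one, Metric.eball_ofReal]
      simpa using hζ)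
  simp only [FormalMultilinearSeries.ofScalars_apply_eq, choose_eq_binCoef, zero_add,
    smul_eq_mul] at h
  rw [Complex.cpow_neg, ← one_div]
  exact h

/-- The kernel becomes the squared modulus of a holomorphic function, so its Taylor expansion is
controlled through a power series in one complex variable. -/
theorem norm_rpow_eq_sq (s : ℝ) {ζ : ℂ} (hζ : ‖ζ‖ < 1) :
    ‖1 - ζ‖ ^ (-2 * s) = ‖(1 - ζ) ^ (-(s : ℂ))‖ ^ 2 := by
  have h0 : 1 - ζ ≠ 0 := by
    intro h
    have : ζ = 1 := by linear_combination -h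
    simp [this] at hζ
  have h1 : ‖(1 - ζ) ^ (-(s : ℂ))‖ = ‖1 - ζ‖ ^ (-s) := by
    have := Complex.norm_cpow_of_ne_zero h0 (-(s : ℂ))
    rw [this]
    simp
  rw [h1, ← Real.rpow_natCast, ← Real.rpow_mul (norm_nonneg _)]
  congr 1
  push_cast
  ring

/-- The partial sum of the terms of index `a ≤ m < M` of the series of `(1 - ζ) ^ (-s)`. -/
def binPart (s : ℝ) (a M : ℕ) (ζ : ℂ) : ℂ := ∑ m ∈ Finset.Ico a M, (binCoef s m : ℂ) * ζ ^ m

/-- The coefficients decrease for 0 ≤ s ≤ 1, so the tail is dominated by its first coefficient times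
a geometric series. -/
theorem norm_sub_binPart_le {s : ℝ} (hs : 0 ≤ s) (hs1 : s ≤ 1) (M : ℕ) {ζ : ℂ} {q : ℝ}
    (hζ : ‖ζ‖ ≤ q) (hq : q < 1) :
    ‖(1 - ζ) ^ (-(s : ℂ)) - binPart s 0 M ζ‖ ≤ binCoef s M * ‖ζ‖ ^ M / (1 - q) := by
  have h := hasSum_binCoef s (lt_of_le_of_lt hζ hq)
  have h2 := (hasSum_nat_add_iff' M).2 h
  have e : binPart s 0 M ζ = ∑ i ∈ Finset.range M, (binCoef s i : ℂ) * ζ ^ i := by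
    simp [binPart]
  rw [← e] at h2
  have h3 : HasSum (fun m : ℕ => binCoef s M * ‖ζ‖ ^ M * q ^ m)
      (binCoef s M * ‖ζ‖ ^ M * (1 - q)⁻¹) :=
    (hasSum_geometric_of_lt_one ((norm_nonneg _).trans hζ) hq).mul_left _
  rw [← h2.tsum_eq, div_eq_mul_inv]
  refine tsum_of_norm_bounded h3 fun m => ?_
  rw [norm_mul, norm_pow, Complex.norm_real, Real.norm_of_nonneg (binCoef_nonneg hs _), pow_add]
  have h4 : binCoef s (m + M) ≤ binCoef s M := binCoef_antitone hs hs1 (by omega)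
  have h5 : ‖ζ‖ ^ m ≤ q ^ m := by gcongr
  calc binCoef s (m + M) * (‖ζ‖ ^ m * ‖ζ‖ ^ M) ≤ binCoef s M * (q ^ m * ‖ζ‖ ^ M) := by
        have := binCoef_nonneg hs M
        have := (norm_nonneg ζ).trans hζ
        gcongr
    _ = _ := by ring

theorem binPart_split (s : ℝ) {a b c : ℕ} (hab : a ≤ b) (hbc : b ≤ c) (ζ : ℂ) :
    binPart s a c ζ = binPart s a b ζ + binPart s b c ζ :=
  (Finset.sum_Ico_consecutive _ hab hbc).symm

theorem norm_sq_one_add (v : ℂ) : ‖1 + v‖ ^ 2 = 1 + 2 * v.re + ‖v‖ ^ 2 := by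
  rw [Complex.sq_norm, Complex.sq_norm, Complex.normSq_apply, Complex.normSq_apply]
  simp
  ring

theorem norm_sq_add' (a b : ℂ) :
    ‖a + b‖ ^ 2 = ‖a‖ ^ 2 + 2 * ((starRingEnd ℂ) a * b).re + ‖b‖ ^ 2 := by
  rw [Complex.sq_norm, Complex.sq_norm, Complex.sq_norm, Complex.normSq_apply,
    Complex.normSq_apply, Complex.normSq_apply]
  simp
  ring

theorem abs_re_conj_mul_le (a b : ℂ) : |((starRingEnd ℂ) a * b).re| ≤ ‖a‖ * ‖b‖ := by
  refine (Complex.abs_re_le_norm _).trans ?_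
  simp

/-- The first terms of `|1 - ζ| ^ (-2 s)`: those linear in the coefficients of index `1 ≤ m < M`,
and the product of the first coefficient with those of index `< 5`. -/
def kernelHead (s : ℝ) (M : ℕ) (ζ : ℂ) : ℝ :=
  1 + 2 * (binPart s 1 M ζ).re + s ^ 2 * ‖ζ‖ ^ 2 +
    2 * ((starRingEnd ℂ) (s * ζ) * binPart s 2 5 ζ).re

/-- With (1-ζ)^(-s) = 1 + sζ + tail, the squared modulus has a linear part, cut at M, a product of
sζ with the tail, cut at 5, and the square of the tail, kept exact because its sign alone suffices
for lower bounds. The cut at 5 is chosen because conj(ζ)ζ^m integrates to zero against a weight with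
square symmetry for m = 2, 3, 4; the first survivor is m = 5. -/
theorem kernel_sub_head {s : ℝ} (hs : 0 ≤ s) (hs1 : s ≤ 1) {M : ℕ} (hM : 1 ≤ M) {ζ : ℂ} {q : ℝ}
    (hζ : ‖ζ‖ ≤ q) (hq : q < 1) :
    ∃ E : ℝ, |E| ≤ 2 * (binCoef s M * ‖ζ‖ ^ M / (1 - q)) +
        2 * (s * ‖ζ‖ * (binCoef s 5 * ‖ζ‖ ^ 5 / (1 - q))) ∧
      ‖1 - ζ‖ ^ (-2 * s) = kernelHead s M ζ + E +
        ‖(1 - ζ) ^ (-(s : ℂ)) - binPart s 0 2 ζ‖ ^ 2 := by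
  set w := (1 - ζ) ^ (-(s : ℂ)) with hw
  have p1 : binPart s 0 1 ζ = 1 := by simp [binPart]
  have p2 : binPart s 1 2 ζ = s * ζ := by simp [binPart]
  have sM : binPart s 0 M ζ = 1 + binPart s 1 M ζ := by
    rw [binPart_split s (Nat.zero_le 1) hM, p1]
  have s2 : binPart s 0 2 ζ = 1 + s * ζ := by
    rw [binPart_split s (Nat.zero_le 1) (by norm_num : 1 ≤ 2), p1, p2]
  have s5 : binPart s 0 5 ζ = 1 + s * ζ + binPart s 2 5 ζ := by
    rw [binPart_split s (Nat.zero_le 2) (by norm_num : 2 ≤ 5), s2]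
  have tM := norm_sub_binPart_le hs hs1 M hζ hq
  have t5 := norm_sub_binPart_le hs hs1 5 hζ hq
  rw [← hw] at tM t5
  refine ⟨2 * (w - binPart s 0 M ζ).re +
    2 * ((starRingEnd ℂ) (s * ζ) * (w - binPart s 0 5 ζ)).re, ?_, ?_⟩
  · refine (abs_add_le _ _).trans (add_le_add ?_ ?_)
    · rw [abs_mul, abs_two]
      exact mul_le_mul_of_nonneg_left ((Complex.abs_re_le_norm _).trans tM) two_pos.le
    · rw [abs_mul, abs_two]
      refine mul_le_mul_of_nonneg_left ((abs_re_conj_mul_le _ _).trans ?_) two_pos.le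
      rw [norm_mul, Complex.norm_real, Real.norm_of_nonneg hs]
      exact mul_le_mul_of_nonneg_left t5 (by positivity)
  · rw [norm_rpow_eq_sq s (lt_of_le_of_lt hζ hq), ← hw]
    have e1 : w = 1 + (s * ζ + (w - binPart s 0 2 ζ)) := by rw [s2]; ring
    have e2 : ‖w‖ ^ 2 = 1 + 2 * (s * ζ + (w - binPart s 0 2 ζ)).re +
        (‖(s : ℂ) * ζ‖ ^ 2 + 2 * ((starRingEnd ℂ) (s * ζ) * (w - binPart s 0 2 ζ)).re +
          ‖w - binPart s 0 2 ζ‖ ^ 2) := by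
      rw [← norm_sq_add', ← norm_sq_one_add, ← e1]
    rw [e2, kernelHead]
    have e3 : s * ζ + (w - binPart s 0 2 ζ) = binPart s 1 M ζ + (w - binPart s 0 M ζ) := by
      rw [s2, sM]; ring
    have e4 : w - binPart s 0 2 ζ = binPart s 2 5 ζ + (w - binPart s 0 5 ζ) := by
      rw [s2, s5]; ring
    have e5 : ‖(s : ℂ) * ζ‖ ^ 2 = s ^ 2 * ‖ζ‖ ^ 2 := by
      rw [norm_mul, Complex.norm_real, Real.norm_of_nonneg hs]; ring
    have e6 : ((starRingEnd ℂ) (s * ζ) * (w - binPart s 0 2 ζ)).re =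
        ((starRingEnd ℂ) (s * ζ) * binPart s 2 5 ζ).re +
          ((starRingEnd ℂ) (s * ζ) * (w - binPart s 0 5 ζ)).re := by
      rw [← Complex.add_re, ← mul_add, ← e4]
    rw [e3, e5, e6, Complex.add_re]
    ring

theorem sq_tail_le {s : ℝ} (hs : 0 ≤ s) (hs1 : s ≤ 1) {ζ : ℂ} {q : ℝ}
    (hζ : ‖ζ‖ ≤ q) (hq : q < 1) :
    ‖(1 - ζ) ^ (-(s : ℂ)) - binPart s 0 2 ζ‖ ^ 2 ≤ (binCoef s 2 * ‖ζ‖ ^ 2 / (1 - q)) ^ 2 :=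
  pow_le_pow_left₀ (norm_nonneg _) (norm_sub_binPart_le hs hs1 2 hζ hq) 2

/-- Needed only for upper bounds, where the square of the tail cannot be dropped. The quadratic term
is split off, and its products with the terms of index 3, 4, 5 are kept explicit because they will
integrate to zero. -/
theorem sq_tail_le_head {s : ℝ} (hs : 0 ≤ s) (hs1 : s ≤ 1) {ζ : ℂ} {q : ℝ}
    (hζ : ‖ζ‖ ≤ q) (hq : q < 1) :
    ‖(1 - ζ) ^ (-(s : ℂ)) - binPart s 0 2 ζ‖ ^ 2 ≤
      (binCoef s 2 * ‖ζ‖ ^ 2) ^ 2 +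
        2 * ((starRingEnd ℂ) (binCoef s 2 * ζ ^ 2) * binPart s 3 6 ζ).re +
        2 * (binCoef s 2 * ‖ζ‖ ^ 2 * (binCoef s 6 * ‖ζ‖ ^ 6 / (1 - q))) +
        (binCoef s 3 * ‖ζ‖ ^ 3 / (1 - q)) ^ 2 := by
  set w := (1 - ζ) ^ (-(s : ℂ)) with hw
  have p3 : binPart s 2 3 ζ = binCoef s 2 * ζ ^ 2 := by simp [binPart]
  have s3 : binPart s 0 3 ζ = binPart s 0 2 ζ + binCoef s 2 * ζ ^ 2 := by
    rw [binPart_split s (Nat.zero_le 2) (by norm_num : 2 ≤ 3), p3]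
  have s6 : binPart s 0 6 ζ = binPart s 0 2 ζ + binCoef s 2 * ζ ^ 2 + binPart s 3 6 ζ := by
    rw [binPart_split s (Nat.zero_le 3) (by norm_num : 3 ≤ 6), s3]
  have t3 := norm_sub_binPart_le hs hs1 3 hζ hq
  have t6 := norm_sub_binPart_le hs hs1 6 hζ hq
  rw [← hw] at t3 t6
  have e1 : w - binPart s 0 2 ζ = binCoef s 2 * ζ ^ 2 + (w - binPart s 0 3 ζ) := by
    rw [s3]; ring
  have e2 : w - binPart s 0 3 ζ = binPart s 3 6 ζ + (w - binPart s 0 6 ζ) := by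
    rw [s3, s6]; ring
  have nb : ‖(binCoef s 2 : ℂ) * ζ ^ 2‖ = binCoef s 2 * ‖ζ‖ ^ 2 := by
    rw [norm_mul, Complex.norm_real, Real.norm_of_nonneg (binCoef_nonneg hs 2), norm_pow]
  rw [e1, norm_sq_add', nb]
  have e3 : ((starRingEnd ℂ) (binCoef s 2 * ζ ^ 2) * (w - binPart s 0 3 ζ)).re =
      ((starRingEnd ℂ) (binCoef s 2 * ζ ^ 2) * binPart s 3 6 ζ).re +
        ((starRingEnd ℂ) (binCoef s 2 * ζ ^ 2) * (w - binPart s 0 6 ζ)).re := by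
    rw [← Complex.add_re, ← mul_add, ← e2]
  have h6 : ((starRingEnd ℂ) (binCoef s 2 * ζ ^ 2) * (w - binPart s 0 6 ζ)).re ≤
      binCoef s 2 * ‖ζ‖ ^ 2 * (binCoef s 6 * ‖ζ‖ ^ 6 / (1 - q)) := by
    refine (le_abs_self _).trans ((abs_re_conj_mul_le _ _).trans ?_)
    rw [nb]
    have := binCoef_nonneg hs 2
    gcongr
  have h3 : ‖w - binPart s 0 3 ζ‖ ^ 2 ≤ (binCoef s 3 * ‖ζ‖ ^ 3 / (1 - q)) ^ 2 :=
    pow_le_pow_left₀ (norm_nonneg _) t3 2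
  rw [e3]
  linarith

/-! ### Euclidean norm on the plane and integrability of its powers -/

/-- The plane as the complex numbers. -/
def toC (z : ℝ × ℝ) : ℂ := ⟨z.1, z.2⟩

theorem euclidNorm_eq_norm (z : ℝ × ℝ) : euclidNorm z = ‖toC z‖ := by
  rw [euclidNorm, Complex.norm_eq_sqrt_sq_add_sq]
  rfl

@[simp] theorem toC_add (z w : ℝ × ℝ) : toC (z + w) = toC z + toC w := rfl
@[simp] theorem toC_neg (z : ℝ × ℝ) : toC (-z) = -toC z := rfl
@[simp] theorem toC_smul (c : ℝ) (z : ℝ × ℝ) : toC (c • z) = c * toC z := by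
  apply Complex.ext <;> simp [toC]

theorem euclidNorm_nonneg (z : ℝ × ℝ) : 0 ≤ euclidNorm z := Real.sqrt_nonneg _

theorem euclidNorm_sq (z : ℝ × ℝ) : euclidNorm z ^ 2 = z.1 ^ 2 + z.2 ^ 2 :=
  Real.sq_sqrt (by positivity)

theorem euclidNorm_neg (z : ℝ × ℝ) : euclidNorm (-z) = euclidNorm z := by
  simp [euclidNorm_eq_norm]

theorem euclidNorm_sub_comm (z w : ℝ × ℝ) : euclidNorm (z - w) = euclidNorm (w - z) := by
  rw [← euclidNorm_neg, neg_sub]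

theorem euclidNorm_smul (c : ℝ) (z : ℝ × ℝ) : euclidNorm (c • z) = |c| * euclidNorm z := by
  simp [euclidNorm_eq_norm]

theorem norm_le_euclidNorm (z : ℝ × ℝ) : ‖z‖ ≤ euclidNorm z := by
  rw [Prod.norm_def, euclidNorm]
  refine max_le ?_ ?_
  · exact Real.abs_le_sqrt (by nlinarith [sq_nonneg z.2])
  · exact Real.abs_le_sqrt (by nlinarith [sq_nonneg z.1])

theorem euclidNorm_sq_le (z : ℝ × ℝ) : euclidNorm z ^ 2 ≤ 2 * ‖z‖ ^ 2 := by
  rw [euclidNorm_sq]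
  have h1 : |z.1| ≤ ‖z‖ := norm_fst_le z
  have h2 : |z.2| ≤ ‖z‖ := norm_snd_le z
  have := sq_abs z.1
  have := sq_abs z.2
  nlinarith [abs_nonneg z.1, abs_nonneg z.2]

theorem euclidNorm_le (z : ℝ × ℝ) : euclidNorm z ≤ 2 * ‖z‖ := by
  have := euclidNorm_sq_le z
  nlinarith [norm_nonneg z, euclidNorm_nonneg z]

theorem euclidNorm_eq_zero {z : ℝ × ℝ} : euclidNorm z = 0 ↔ z = 0 := by
  constructor
  · intro h
    have := norm_le_euclidNorm z
    rw [h] at this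
    simpa using this
  · rintro rfl
    simp [euclidNorm]

theorem euclidNorm_pos {z : ℝ × ℝ} (hz : z ≠ 0) : 0 < euclidNorm z :=
  lt_of_le_of_ne (euclidNorm_nonneg z) fun h => hz (euclidNorm_eq_zero.1 h.symm)

@[fun_prop] theorem continuous_euclidNorm : Continuous euclidNorm := by
  unfold euclidNorm; fun_prop

theorem measurable_euclidNorm : Measurable euclidNorm := continuous_euclidNorm.measurable

theorem square_eq (r : ℝ) : square r = Metric.closedBall (0 : ℝ × ℝ) r := by
  rw [← Prod.mk_zero_zero, ← closedBall_prod_same, Real.closedBall_eq_Icc]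
  simp [square]

theorem mem_square {r : ℝ} {z : ℝ × ℝ} : z ∈ square r ↔ ‖z‖ ≤ r := by
  rw [square_eq, mem_closedBall_zero_iff]

theorem measurableSet_square (r : ℝ) : MeasurableSet (square r) := by
  rw [square_eq]; exact Metric.isClosed_closedBall.measurableSet

theorem isCompact_square (r : ℝ) : IsCompact (square r) := by
  rw [square_eq]; exact isCompact_closedBall 0 r

theorem ae_coord_ne_zero : ∀ᵐ z : ℝ × ℝ, z.1 ≠ 0 ∧ z.2 ≠ 0 := by
  have h : ∀ᵐ x : ℝ, x ≠ 0 := by simp [ae_iff, measure_singleton]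
  have h1 : ∀ᵐ z : ℝ × ℝ, z.1 ≠ 0 :=
    (Measure.quasiMeasurePreserving_fst (μ := (volume : Measure ℝ)) (ν := volume)).ae h
  have h2 : ∀ᵐ z : ℝ × ℝ, z.2 ≠ 0 :=
    (Measure.quasiMeasurePreserving_snd (μ := (volume : Measure ℝ)) (ν := volume)).ae h
  exact h1.and h2

theorem integrableOn_abs_rpow {a r : ℝ} (ha : a < 1) :
    IntegrableOn (fun x : ℝ => |x| ^ (-a)) (Set.Icc (-r) r) := by
  rcases lt_or_ge r 0 with hr | hr
  · rw [Set.Icc_eq_empty (by linarith)]; simp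
  have h1 : IntegrableOn (fun x : ℝ => |x| ^ (-a)) (Set.Icc 0 r) := by
    have h := (intervalIntegral.intervalIntegrable_rpow' (a := 0) (b := r)
      (by linarith : -1 < -a))
    rw [intervalIntegrable_iff_integrableOn_Icc_of_le hr] at h
    refine h.congr_fun (fun x hx => ?_) measurableSet_Icc
    simp only [abs_of_nonneg hx.1]
  have h2 : IntegrableOn (fun x : ℝ => |x| ^ (-a)) (Set.Icc (-r) 0) := by
    have h := h1.comp_neg
    simpa using h
  rw [← Set.Icc_union_Icc_eq_Icc (by linarith : -r ≤ 0) hr]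
  exact h2.union h1

/-- Since |z₁||z₂| ≤ |z|², the function is dominated by a product of one-variable powers with
exponent -a/2 > -1. -/
theorem integrableOn_euclidNorm_rpow {a : ℝ} (h0 : 0 ≤ a) (ha : a < 2) (r : ℝ) :
    IntegrableOn (fun z => euclidNorm z ^ (-a)) (square r) := by
  have h1 := integrableOn_abs_rpow (a := a / 2) (r := r) (by linarith)
  have h2 : IntegrableOn (fun z : ℝ × ℝ => |z.1| ^ (-(a / 2)) * |z.2| ^ (-(a / 2))) (square r) := by
    have := Integrable.mul_prod h1 h1
    rwa [Measure.prod_restrict] at this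
  refine Integrable.mono' h2
    (measurable_euclidNorm.pow_const _).aestronglyMeasurable
    ((ae_restrict_of_ae ae_coord_ne_zero).mono fun z hz => ?_)
  have p1 := abs_pos.2 hz.1
  have p2 := abs_pos.2 hz.2
  have p : |z.1| * |z.2| ≤ euclidNorm z ^ 2 := by
    rw [euclidNorm_sq, ← sq_abs z.1, ← sq_abs z.2]
    nlinarith [sq_nonneg (|z.1| - |z.2|), mul_pos p1 p2]
  have hpos : 0 < euclidNorm z := euclidNorm_pos (by
    intro h; rw [h] at hz; exact hz.1 rfl)
  rw [Real.norm_of_nonneg (by positivity), ← Real.mul_rpow p1.le p2.le]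
  have e : euclidNorm z ^ (-a) = (euclidNorm z ^ 2) ^ (-(a / 2)) := by
    rw [← Real.rpow_natCast, ← Real.rpow_mul hpos.le]
    congr 1
    push_cast; ring
  rw [e]
  exact Real.rpow_le_rpow_of_nonpos (by positivity) p (by linarith)

theorem integrableOn_compl_euclidNorm_rpow {a r : ℝ} (ha : 2 < a) (hr : 0 < r) :
    IntegrableOn (fun z => euclidNorm z ^ (-a)) (square r)ᶜ := by
  have h := integrable_one_add_norm (E := ℝ × ℝ) (μ := volume) (r := a) (by simpa using ha)
  have h2 : Integrable (fun z : ℝ × ℝ => (1 / r + 1) ^ a * (1 + ‖z‖) ^ (-a)) := h.const_mul _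
  refine Integrable.mono' h2.integrableOn
    (measurable_euclidNorm.pow_const _).aestronglyMeasurable ?_
  refine (ae_restrict_iff' (measurableSet_square r).compl).2 (Eventually.of_forall fun z hz => ?_)
  have hz' : r < ‖z‖ := by
    rw [Set.mem_compl_iff, mem_square] at hz; linarith
  have hpos : 0 < euclidNorm z := lt_of_lt_of_le (hr.trans hz') (norm_le_euclidNorm z)
  rw [Real.norm_of_nonneg (by positivity), Real.rpow_neg hpos.le,
    Real.rpow_neg (x := 1 + ‖z‖) (by positivity), ← div_eq_mul_inv, inv_eq_one_div, div_le_div_iff₀ (by positivity) (by positivity), one_mul,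
    ← Real.mul_rpow (by positivity) hpos.le]
  refine Real.rpow_le_rpow (by positivity) ?_ (by linarith)
  have := norm_le_euclidNorm z
  have h3 : 1 ≤ 1 / r * euclidNorm z := by
    rw [one_div, inv_mul_eq_div, le_div_iff₀ hr]; linarith
  nlinarith

/-! ### The kernel, the hat function, and scaling of the weights -/

/-- The kernel `|z| ^ (-2 s)`. -/
def ker (s : ℝ) (z : ℝ × ℝ) : ℝ := euclidNorm z ^ (-2 * s)

theorem ker_nonneg (s : ℝ) (z : ℝ × ℝ) : 0 ≤ ker s z := Real.rpow_nonneg (euclidNorm_nonneg z) _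

theorem measurable_ker (s : ℝ) : Measurable (ker s) := measurable_euclidNorm.pow_const _

theorem ker_neg (s : ℝ) (z : ℝ × ℝ) : ker s (-z) = ker s z := by rw [ker, ker, euclidNorm_neg]

theorem ker_smul (s : ℝ) {c : ℝ} (hc : 0 ≤ c) (z : ℝ × ℝ) :
    ker s (c • z) = c ^ (-2 * s) * ker s z := by
  rw [ker, ker, euclidNorm_smul, abs_of_nonneg hc, Real.mul_rpow hc (euclidNorm_nonneg z)]

theorem integrableOn_ker {s : ℝ} (hs : 0 ≤ s) (hs1 : s < 1) (r : ℝ) :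
    IntegrableOn (ker s) (square r) := by
  have := integrableOn_euclidNorm_rpow (a := 2 * s) (by linarith) (by linarith) r
  unfold ker
  simpa only [neg_mul] using this

theorem integrableOn_ker_add {s : ℝ} (hs : 0 ≤ s) (hs1 : s < 1) (w : ℝ × ℝ) (r : ℝ) :
    IntegrableOn (fun z => ker s (w + z)) (square r) := by
  have h := (integrableOn_ker hs hs1 (r + ‖w‖)).integrable_indicator
    (measurableSet_square _)
  have h2 := (h.comp_add_left w).integrableOn (s := square r)
  refine h2.congr_fun (fun z hz => ?_) (measurableSet_square r)
  simp only
  rw [Set.indicator_of_mem]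
  rw [mem_square] at hz ⊢
  linarith [norm_add_le w z]

/-- A bounded measurable function of bounded support is integrable against the kernel. -/
theorem integrable_ker_mul {s : ℝ} (hs : 0 ≤ s) (hs1 : s < 1) (w : ℝ × ℝ) {f : ℝ × ℝ → ℝ}
    (hf : AEStronglyMeasurable f) {C r : ℝ} (hC : ∀ᵐ z, |f z| ≤ C)
    (hr : ∀ z, z ∉ square r → f z = 0) : Integrable fun z => ker s (w + z) * f z := by
  have h := (integrableOn_ker_add hs hs1 w r).integrable_indicator (measurableSet_square r)
  have h2 := h.mul_bdd (c := C) hf (by simpa using hC)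
  refine h2.congr (Eventually.of_forall fun z => ?_)
  by_cases hz : z ∈ square r
  · simp [Set.indicator_of_mem hz]
  · simp [hr z hz]

/-- The hat function of one variable. -/
def tent (x : ℝ) : ℝ := max 0 (1 - |x|)

@[fun_prop] theorem continuous_tent : Continuous tent := by unfold tent; fun_prop

theorem tent_nonneg (x : ℝ) : 0 ≤ tent x := le_max_left _ _
theorem tent_le_one (x : ℝ) : tent x ≤ 1 := max_le zero_le_one (by linarith [abs_nonneg x])
theorem tent_neg (x : ℝ) : tent (-x) = tent x := by simp [tent]
theorem tent_eq_zero {x : ℝ} (h : 1 ≤ |x|) : tent x = 0 := max_eq_left (by linarith)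
theorem tent_of_abs_le {x : ℝ} (h : |x| ≤ 1) : tent x = 1 - |x| := max_eq_right (by linarith)

theorem hat_eq_tent {h : ℝ} (hh : 0 < h) (z : ℝ × ℝ) :
    hat h z = tent (z.1 / h) * tent (z.2 / h) := by
  have key : ∀ x : ℝ, |x / h| = |x| / h := fun x => by rw [abs_div, abs_of_pos hh]
  rw [hat]
  split_ifs with hz
  · rw [tent_of_abs_le, tent_of_abs_le, key, key]
    · rw [key, div_le_one hh]; exact hz.2.le
    · rw [key, div_le_one hh]; exact hz.1.le
  · rw [not_and_or, not_lt, not_lt] at hz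
    rcases hz with hz | hz
    · rw [tent_eq_zero, zero_mul]
      rwa [key, one_le_div hh]
    · rw [tent_eq_zero (x := z.2 / h), mul_zero]
      rwa [key, one_le_div hh]

theorem hat_one (z : ℝ × ℝ) : hat 1 z = tent z.1 * tent z.2 := by
  simp [hat_eq_tent one_pos]

theorem hat_smul {h : ℝ} (hh : 0 < h) (z : ℝ × ℝ) : hat h (h • z) = hat 1 z := by
  rw [hat_eq_tent hh, hat_one]
  simp [mul_div_cancel_left₀ _ hh.ne']

theorem continuous_hat {h : ℝ} (hh : 0 < h) : Continuous (hat h) := by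
  have : hat h = fun z => tent (z.1 / h) * tent (z.2 / h) := funext (hat_eq_tent hh)
  rw [this]; fun_prop

theorem hat_nonneg {h : ℝ} (hh : 0 < h) (z : ℝ × ℝ) : 0 ≤ hat h z := by
  rw [hat_eq_tent hh]; exact mul_nonneg (tent_nonneg _) (tent_nonneg _)

theorem hat_le_one {h : ℝ} (hh : 0 < h) (z : ℝ × ℝ) : hat h z ≤ 1 := by
  rw [hat_eq_tent hh]; exact mul_le_one₀ (tent_le_one _) (tent_nonneg _) (tent_le_one _)

theorem hat_eq_zero {h : ℝ} {z : ℝ × ℝ} (hz : z ∉ square h) : hat h z = 0 := by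
  rw [mem_square, not_le, Prod.norm_def, lt_max_iff] at hz
  rw [hat, if_neg]
  rintro ⟨h1, h2⟩
  rcases hz with h | h
  · exact absurd h (not_lt.2 h1.le)
  · exact absurd h (not_lt.2 h2.le)

theorem abs_hat_le_one {h : ℝ} (hh : 0 < h) (z : ℝ × ℝ) : |hat h z| ≤ 1 := by
  rw [abs_of_nonneg (hat_nonneg hh z)]; exact hat_le_one hh z

/-- The average of the kernel around `w`, with the hat function of width `1` as weight. -/
def kerAvg (s : ℝ) (w : ℝ × ℝ) : ℝ := ∫ z, ker s (w + z) * hat 1 z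

/-- Substituting hz for z gives h² from the area and h^(-2s) from the kernel. All sign questions
about the weights thus reduce to the unit mesh. -/
theorem omegaBar_eq (s : ℝ) {h : ℝ} (hh : 0 < h) (p q : ℤ) :
    omegaBar s h p q = fracConst (s - 1) * (h ^ (2 - 2 * s) * kerAvg s ((p : ℝ), (q : ℝ))) := by
  rw [omegaBar]
  congr 1
  rw [setIntegral_eq_integral_of_forall_compl_eq_zero
    (fun z hz => by rw [hat_eq_zero hz, mul_zero])]
  have h1 := Measure.integral_comp_smul (volume : Measure (ℝ × ℝ))
    (fun z => euclidNorm (((p : ℝ) * h, (q : ℝ) * h) + z) ^ (-2 * s) * hat h z) h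
  have h2 : ∀ z : ℝ × ℝ, euclidNorm (((p : ℝ) * h, (q : ℝ) * h) + h • z) ^ (-2 * s) *
      hat h (h • z) = h ^ (-2 * s) * (ker s (((p : ℝ), (q : ℝ)) + z) * hat 1 z) := by
    intro z
    have : ((p : ℝ) * h, (q : ℝ) * h) + h • z = h • (((p : ℝ), (q : ℝ)) + z) := by
      ext <;> simp <;> ring
    rw [hat_smul hh, this, ← ker, ker_smul s hh.le]
    ring
  simp only [h2] at h1
  rw [integral_const_mul, ← kerAvg] at h1
  simp only [Module.finrank_prod, Module.finrank_self, smul_eq_mul] at h1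
  have h3 : |(h ^ (1 + 1))⁻¹| = (h ^ 2)⁻¹ := by
    rw [abs_of_nonneg (by positivity)]
  rw [h3] at h1
  have h4 : h ^ (2 - 2 * s) = h ^ 2 * h ^ (-2 * s) := by
    rw [sub_eq_add_neg, Real.rpow_add hh, ← neg_mul]; norm_num
  rw [h4, mul_assoc, h1, ← mul_assoc, mul_inv_cancel₀ (by positivity), one_mul]

/-! ### Integration against weights with the symmetries of a square -/

@[fun_prop] theorem continuous_toC : Continuous toC :=
  Complex.equivRealProdCLM.symm.continuous

@[fun_prop] theorem continuous_binPart (s : ℝ) (a M : ℕ) : Continuous (binPart s a M) := by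
  unfold binPart; fun_prop

/-- Rotation of the plane by a right angle. -/
def rot : ℝ × ℝ ≃ᵐ ℝ × ℝ :=
  MeasurableEquiv.prodComm.trans ((MeasurableEquiv.neg ℝ).prodCongr (MeasurableEquiv.refl ℝ))

theorem rot_apply (z : ℝ × ℝ) : rot z = (-z.2, z.1) := rfl

theorem toC_rot (z : ℝ × ℝ) : toC (rot z) = Complex.I * toC z := by
  apply Complex.ext <;> simp [toC, rot_apply]

theorem measurePreserving_rot : MeasurePreserving rot := by
  have h1 : MeasurePreserving (Prod.swap : ℝ × ℝ → ℝ × ℝ) := Measure.measurePreserving_swap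
  have h2 : MeasurePreserving (Prod.map (fun x : ℝ => -x) (id : ℝ → ℝ)) :=
    (Measure.measurePreserving_neg volume).prod (MeasurePreserving.id volume)
  exact h2.comp h1

/-- Reflection of the plane in the first axis. -/
def refl2 : ℝ × ℝ ≃ᵐ ℝ × ℝ := (MeasurableEquiv.refl ℝ).prodCongr (MeasurableEquiv.neg ℝ)

theorem refl2_apply (z : ℝ × ℝ) : refl2 z = (z.1, -z.2) := rfl

theorem toC_refl2 (z : ℝ × ℝ) : toC (refl2 z) = (starRingEnd ℂ) (toC z) := by
  apply Complex.ext <;> simp [toC, refl2_apply]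

theorem measurePreserving_refl2 : MeasurePreserving refl2 :=
  (MeasurePreserving.id volume).prod (Measure.measurePreserving_neg volume)

/-- A continuous weight of bounded support with the symmetries of a square. -/
structure IsSymmWeight (ρ : ℝ × ℝ → ℝ) (r : ℝ) : Prop where
  cont : Continuous ρ
  eq_zero : ∀ z, z ∉ square r → ρ z = 0
  rot : ∀ z, ρ (FracDirichlet.rot z) = ρ z
  refl : ∀ z, ρ (refl2 z) = ρ z

theorem integrable_mul_of_eq_zero {f ρ : ℝ × ℝ → ℝ} {r : ℝ} (hf : Continuous f)
    (hρ : Continuous ρ) (h0 : ∀ z, z ∉ square r → ρ z = 0) : Integrable fun z => f z * ρ z := by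
  refine (hf.mul hρ).integrable_of_hasCompactSupport ?_
  refine HasCompactSupport.intro (isCompact_square r) fun z hz => ?_
  rw [Pi.mul_apply, h0 z hz, mul_zero]

theorem IsSymmWeight.integrable {ρ : ℝ × ℝ → ℝ} {r : ℝ} (h : IsSymmWeight ρ r)
    {f : ℝ × ℝ → ℝ} (hf : Continuous f) : Integrable fun z => f z * ρ z :=
  integrable_mul_of_eq_zero hf h.cont h.eq_zero

theorem IsSymmWeight.integral_rot {ρ : ℝ × ℝ → ℝ} {r : ℝ} (h : IsSymmWeight ρ r) (k m : ℕ)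
    (c : ℂ) : ∫ z, ((starRingEnd ℂ) (toC z) ^ k * toC z ^ m * c).re * ρ z =
      ∫ z, ((starRingEnd ℂ) (toC z) ^ k * toC z ^ m * ((-Complex.I) ^ k * Complex.I ^ m * c)).re *
        ρ z := by
  rw [← measurePreserving_rot.integral_comp']
  congr 1
  ext z
  rw [h.rot, toC_rot]
  congr 2
  simp only [map_mul, Complex.conj_I, mul_pow]
  ring

/-- A right-angle rotation multiplies conj(z)^k z^m by i^(m+3k). If this root of unity is not 1,
applying the rotation once or twice produces the factor -1, so the integral equals its own negative.
-/
theorem IsSymmWeight.integral_eq_zero {ρ : ℝ × ℝ → ℝ} {r : ℝ} (h : IsSymmWeight ρ r) {k m : ℕ}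
    (hkm : (m + 3 * k) % 4 ≠ 0) (c : ℂ) :
    ∫ z, ((starRingEnd ℂ) (toC z) ^ k * toC z ^ m * c).re * ρ z = 0 := by
  have hω : (-Complex.I) ^ k * Complex.I ^ m = Complex.I ^ (m + 3 * k) := by
    have : -Complex.I = Complex.I ^ 3 := by rw [Complex.I_pow_three]
    rw [this, ← pow_mul, ← pow_add, add_comm]
  have hneg : ∀ c : ℂ, ∫ z, ((starRingEnd ℂ) (toC z) ^ k * toC z ^ m * (-1 * c)).re * ρ z =
      -∫ z, ((starRingEnd ℂ) (toC z) ^ k * toC z ^ m * c).re * ρ z := by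
    intro c
    rw [← integral_neg]
    congr 1
    ext z
    have : (starRingEnd ℂ) (toC z) ^ k * toC z ^ m * (-1 * c) =
      -((starRingEnd ℂ) (toC z) ^ k * toC z ^ m * c) := by ring
    rw [this, Complex.neg_re, neg_mul]
  have h1 := h.integral_rot k m c
  rw [hω] at h1
  have h2 := h.integral_rot k m (Complex.I ^ (m + 3 * k) * c)
  rw [hω, ← mul_assoc, ← pow_add] at h2
  have hI : Complex.I ^ (m + 3 * k) = Complex.I ^ ((m + 3 * k) % 4) := Complex.I_pow_eq_pow_mod _
  have hI2 : Complex.I ^ (m + 3 * k + (m + 3 * k)) = (Complex.I ^ ((m + 3 * k) % 4)) ^ 2 := by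
    rw [pow_add, hI]; ring
  rw [hI2] at h2
  rw [hI] at h1 h2
  have h4 : (m + 3 * k) % 4 < 4 := Nat.mod_lt _ (by norm_num)
  generalize (m + 3 * k) % 4 = j at *
  interval_cases j
  · exact absurd rfl hkm
  · rw [h2] at h1
    rw [pow_one, Complex.I_sq, hneg c] at h1
    linarith
  · rw [Complex.I_sq, hneg c] at h1
    linarith
  · rw [h2] at h1
    have e : (Complex.I ^ 3) ^ 2 = -1 := by
      rw [← pow_mul, Complex.I_pow_eq_pow_mod]; norm_num
    rw [e, hneg c] at h1
    linarith

/-- Reflection in the first axis replaces c by its conjugate; averaging the two integrals leaves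
only the real part of c. -/
theorem IsSymmWeight.integral_pow_mul {ρ : ℝ × ℝ → ℝ} {r : ℝ} (h : IsSymmWeight ρ r) (m : ℕ)
    (c : ℂ) : ∫ z, (toC z ^ m * c).re * ρ z = c.re * ∫ z, (toC z ^ m).re * ρ z := by
  have h1 : ∫ z, (toC z ^ m * c).re * ρ z =
      ∫ z, (toC z ^ m * (starRingEnd ℂ) c).re * ρ z := by
    rw [← measurePreserving_refl2.integral_comp']
    congr 1
    ext z
    rw [h.refl, toC_refl2]
    congr 1
    rw [← Complex.conj_re]
    simp
  have i1 : Integrable fun z => (toC z ^ m * c).re * ρ z :=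
    h.integrable (by fun_prop)
  have i2 : Integrable fun z => (toC z ^ m * (starRingEnd ℂ) c).re * ρ z :=
    h.integrable (by fun_prop)
  have h2 : (∫ z, (toC z ^ m * c).re * ρ z) + ∫ z, (toC z ^ m * (starRingEnd ℂ) c).re * ρ z =
      2 * (c.re * ∫ z, (toC z ^ m).re * ρ z) := by
    rw [← integral_add i1 i2, ← integral_const_mul, ← integral_const_mul]
    congr 1
    ext z
    simp only [Complex.mul_re, Complex.conj_re, Complex.conj_im]
    ring
  linarith

theorem IsSymmWeight.integral_binPart {ρ : ℝ × ℝ → ℝ} {r : ℝ} (h : IsSymmWeight ρ r) (s : ℝ)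
    (a M : ℕ) (κ : ℂ) : ∫ z, (binPart s a M (toC z * κ)).re * ρ z =
      ∑ m ∈ Finset.Ico a M, binCoef s m * ((κ ^ m).re * ∫ z, (toC z ^ m).re * ρ z) := by
  have e : ∀ z, (binPart s a M (toC z * κ)).re * ρ z =
      ∑ m ∈ Finset.Ico a M, binCoef s m * ((toC z ^ m * κ ^ m).re * ρ z) := by
    intro z
    rw [binPart, Complex.re_sum, Finset.sum_mul]
    refine Finset.sum_congr rfl fun m _ => ?_
    rw [Complex.re_ofReal_mul, mul_pow]
    ring
  simp only [e]
  rw [integral_finsetSum]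
  · refine Finset.sum_congr rfl fun m _ => ?_
    rw [integral_const_mul, h.integral_pow_mul]
  · intro m _
    exact (h.integrable (by fun_prop)).const_mul _

/-- The exponents satisfy k < m < k + 4, so m - k is never a multiple of 4 and every term vanishes
under rotation. -/
theorem IsSymmWeight.integral_cross {ρ : ℝ × ℝ → ℝ} {r : ℝ} (h : IsSymmWeight ρ r) (s : ℝ)
    {k a M : ℕ} (ha : k < a) (hM : M ≤ k + 4) (c : ℝ) (κ : ℂ) :
    ∫ z, ((starRingEnd ℂ) (c * (toC z * κ) ^ k) * binPart s a M (toC z * κ)).re * ρ z = 0 := by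
  have e : ∀ z, ((starRingEnd ℂ) (c * (toC z * κ) ^ k) * binPart s a M (toC z * κ)).re * ρ z =
      ∑ m ∈ Finset.Ico a M, ((starRingEnd ℂ) (toC z) ^ k * toC z ^ m *
        (c * (starRingEnd ℂ) κ ^ k * (binCoef s m * κ ^ m))).re * ρ z := by
    intro z
    rw [binPart, Finset.mul_sum, Complex.re_sum, Finset.sum_mul]
    refine Finset.sum_congr rfl fun m _ => ?_
    congr 2
    simp only [map_mul, map_pow, Complex.conj_ofReal]
    ring
  simp only [e]
  rw [integral_finsetSum]
  · refine Finset.sum_eq_zero fun m hm => ?_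
    rw [Finset.mem_Ico] at hm
    exact h.integral_eq_zero (by omega) _
  · intro m _
    exact h.integrable (by fun_prop)

theorem IsSymmWeight.integral_kernelHead {ρ : ℝ × ℝ → ℝ} {r : ℝ} (h : IsSymmWeight ρ r) (s : ℝ)
    (M : ℕ) (κ : ℂ) : ∫ z, kernelHead s M (toC z * κ) * ρ z =
      (∫ z, ρ z) + 2 * (∑ m ∈ Finset.Ico 1 M,
        binCoef s m * ((κ ^ m).re * ∫ z, (toC z ^ m).re * ρ z)) +
      s ^ 2 * (‖κ‖ ^ 2 * ∫ z, euclidNorm z ^ 2 * ρ z) := by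
  have i0 : Integrable ρ := by simpa using h.integrable (f := fun _ => 1) (by fun_prop)
  have i1 : Integrable fun z => (binPart s 1 M (toC z * κ)).re * ρ z := h.integrable (by fun_prop)
  have i2 : Integrable fun z => euclidNorm z ^ 2 * ρ z := h.integrable (by fun_prop)
  have i3 : Integrable fun z => ((starRingEnd ℂ) (s * (toC z * κ) ^ 1) *
    binPart s 2 5 (toC z * κ)).re * ρ z := h.integrable (by fun_prop)
  have c := h.integral_cross s (k := 1) (a := 2) (M := 5) (by norm_num) (by norm_num) s κ
  have e : ∀ z, kernelHead s M (toC z * κ) * ρ z =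
      ρ z + 2 * ((binPart s 1 M (toC z * κ)).re * ρ z) +
        s ^ 2 * (‖κ‖ ^ 2 * (euclidNorm z ^ 2 * ρ z)) +
        2 * (((starRingEnd ℂ) (s * (toC z * κ) ^ 1) *
          binPart s 2 5 (toC z * κ)).re * ρ z) := by
    intro z
    rw [kernelHead, norm_mul, ← euclidNorm_eq_norm, pow_one]
    ring
  simp only [e]
  rw [integral_add (by fun_prop) (by fun_prop), integral_add (by fun_prop) (by fun_prop),
    integral_add (by fun_prop) (by fun_prop), integral_const_mul, integral_const_mul,
    integral_const_mul, integral_const_mul, c, h.integral_binPart]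
  ring

theorem isSymmWeight_hat : IsSymmWeight (hat 1) 1 where
  cont := continuous_hat one_pos
  eq_zero := fun z hz => hat_eq_zero hz
  rot := fun z => by
    rw [hat_one, hat_one, rot_apply]; simp only [tent_neg]; ring
  refl := fun z => by rw [hat_one, hat_one, refl2_apply]; simp only [tent_neg]

/-! ### Moments of the hat function -/

theorem integral_pow_mul_tent (k : ℕ) :
    ∫ x, x ^ (2 * k) * tent x = 2 / ((2 * k + 1) * (2 * k + 2)) := by
  have h0 : ∀ x : ℝ, x ^ (2 * k) * tent x = |x| ^ (2 * k) * tent |x| := by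
    intro x
    rw [(even_two_mul k).pow_abs]
    simp [tent]
  have h1 : ∫ x, x ^ (2 * k) * tent x = 2 * ∫ x in Set.Ioi (0 : ℝ), x ^ (2 * k) * tent x := by
    rw [← integral_comp_abs (f := fun x => x ^ (2 * k) * tent x)]
    exact integral_congr_ae (Eventually.of_forall h0)
  have h2 : ∫ x in Set.Ioi (0 : ℝ), x ^ (2 * k) * tent x =
      ∫ x in Set.Ioc (0 : ℝ) 1, (x ^ (2 * k) - x ^ (2 * k + 1)) := by
    rw [setIntegral_eq_of_subset_of_forall_sdiff_eq_zero (s := Set.Ioc 0 1) measurableSet_Ioi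
      (fun x hx => hx.1)]
    · refine setIntegral_congr_fun measurableSet_Ioc fun x hx => ?_
      rw [tent_of_abs_le (by rw [abs_of_pos hx.1]; exact hx.2), abs_of_pos hx.1]
      ring
    · intro x hx
      have h3 : 1 < x := by
        by_contra hc
        exact hx.2 ⟨hx.1, not_lt.1 hc⟩
      rw [tent_eq_zero (by rw [abs_of_pos (by linarith)]; exact h3.le), mul_zero]
  rw [h1, h2, ← intervalIntegral.integral_of_le zero_le_one, intervalIntegral.integral_sub
    (by simp) (by simp), integral_pow, integral_pow]
  push_cast
  field_simp
  ring

/-- The even moments of the hat function of one variable. -/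
def tentMoment (k : ℕ) : ℝ := 2 / ((2 * k + 1) * (2 * k + 2))

theorem integral_monomial_hat (j k : ℕ) :
    ∫ z : ℝ × ℝ, z.1 ^ (2 * j) * z.2 ^ (2 * k) * hat 1 z = tentMoment j * tentMoment k := by
  rw [tentMoment, tentMoment, ← integral_pow_mul_tent, ← integral_pow_mul_tent,
    ← integral_prod_mul]
  congr 1
  ext z
  rw [hat_one]
  ring

theorem integrable_monomial_hat (j k : ℕ) :
    Integrable fun z : ℝ × ℝ => z.1 ^ (2 * j) * z.2 ^ (2 * k) * hat 1 z :=
  isSymmWeight_hat.integrable (by fun_prop)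

theorem integral_poly_hat {ι : Type*} (t : Finset ι) (c : ι → ℝ) (j k : ι → ℕ) {f : ℝ × ℝ → ℝ}
    (hf : ∀ z, f z = ∑ i ∈ t, c i * (z.1 ^ (2 * j i) * z.2 ^ (2 * k i))) :
    ∫ z, f z * hat 1 z = ∑ i ∈ t, c i * (tentMoment (j i) * tentMoment (k i)) := by
  have : ∀ z, f z * hat 1 z =
      ∑ i ∈ t, c i * (z.1 ^ (2 * j i) * z.2 ^ (2 * k i) * hat 1 z) := by
    intro z
    rw [hf, Finset.sum_mul]
    exact Finset.sum_congr rfl fun i _ => by ring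
  simp only [this]
  rw [integral_finsetSum _ fun i _ => (integrable_monomial_hat _ _).const_mul _]
  exact Finset.sum_congr rfl fun i _ => by rw [integral_const_mul, integral_monomial_hat]

theorem integral_hat : ∫ z, hat 1 z = 1 := by
  have := integral_monomial_hat 0 0
  simpa [tentMoment] using this

theorem integral_euclidNorm_pow_hat (k : ℕ) : ∫ z, euclidNorm z ^ (2 * k) * hat 1 z =
    ∑ i ∈ Finset.range (k + 1), (k.choose i : ℝ) * (tentMoment i * tentMoment (k - i)) := by
  refine integral_poly_hat _ _ _ _ fun z => ?_
  rw [pow_mul, euclidNorm_sq, add_pow]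
  refine Finset.sum_congr rfl fun i _ => ?_
  rw [← pow_mul, ← pow_mul]
  ring

theorem integral_sq_hat : ∫ z, euclidNorm z ^ 2 * hat 1 z = 1 / 3 := by
  have := integral_euclidNorm_pow_hat 1
  norm_num [Finset.sum_range_succ, tentMoment] at this ⊢
  exact this

theorem integral_pow_four_hat : ∫ z, euclidNorm z ^ 4 * hat 1 z = 17 / 90 := by
  have := integral_euclidNorm_pow_hat 2
  norm_num [Finset.sum_range_succ, tentMoment] at this ⊢
  exact this

theorem integral_pow_six_hat : ∫ z, euclidNorm z ^ 6 * hat 1 z = 29 / 210 := by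
  have := integral_euclidNorm_pow_hat 3
  norm_num [Finset.sum_range_succ, tentMoment, Nat.choose] at this ⊢
  exact this

theorem integral_pow_eight_hat : ∫ z, euclidNorm z ^ 8 * hat 1 z = 187 / 1575 := by
  have := integral_euclidNorm_pow_hat 4
  norm_num [Finset.sum_range_succ, tentMoment, Nat.choose] at this ⊢
  exact this

theorem integral_pow_twelve_hat : ∫ z, euclidNorm z ^ 12 * hat 1 z = 154171 / 1261260 := by
  have := integral_euclidNorm_pow_hat 6
  norm_num [Finset.sum_range_succ, tentMoment, Nat.choose] at this ⊢
  exact this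

theorem integral_re_pow_four_hat : ∫ z, (toC z ^ 4).re * hat 1 z = -1 / 30 := by
  rw [integral_poly_hat (Finset.univ : Finset (Fin 3)) ![1, -6, 1] ![2, 1, 0] ![0, 1, 2]]
  · norm_num [Fin.sum_univ_succ, tentMoment]
  · intro z
    have : (toC z ^ 4).re = z.1 ^ 4 - 6 * z.1 ^ 2 * z.2 ^ 2 + z.2 ^ 4 := by
      simp only [pow_succ, pow_zero, one_mul, Complex.mul_re, Complex.mul_im, toC]
      ring
    rw [this]
    simp [Fin.sum_univ_succ]
    ring

theorem integral_re_pow_eight_hat : ∫ z, (toC z ^ 8).re * hat 1 z = 1 / 45 := by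
  rw [integral_poly_hat (Finset.univ : Finset (Fin 5)) ![1, -28, 70, -28, 1] ![4, 3, 2, 1, 0] ![0, 1, 2, 3, 4]]
  · norm_num [Fin.sum_univ_succ, tentMoment]
  · intro z
    have : (toC z ^ 8).re = z.1 ^ 8 - 28 * z.1 ^ 6 * z.2 ^ 2 + 70 * z.1 ^ 4 * z.2 ^ 4
        - 28 * z.1 ^ 2 * z.2 ^ 6 + z.2 ^ 8 := by
      simp only [pow_succ, pow_zero, one_mul, Complex.mul_re, Complex.mul_im, toC]
      ring
    rw [this]
    simp [Fin.sum_univ_succ]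
    ring

/-! ### Two-sided bounds for the averaged kernel away from the origin -/

theorem ker_add_eq (s : ℝ) {w : ℝ × ℝ} (hw : w ≠ 0) (z : ℝ × ℝ) :
    ker s (w + z) = ker s w * ‖1 - toC z * (-(toC w)⁻¹)‖ ^ (-2 * s) := by
  have h0 : toC w ≠ 0 := by
    rw [← norm_pos_iff, ← euclidNorm_eq_norm]
    exact euclidNorm_pos hw
  have : toC (w + z) = toC w * (1 - toC z * (-(toC w)⁻¹)) := by
    rw [toC_add]; field_simp; ring
  rw [ker, ker, euclidNorm_eq_norm, this, norm_mul, Real.mul_rpow (norm_nonneg _) (norm_nonneg _),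
    euclidNorm_eq_norm]

theorem ker_eq_rpow (s : ℝ) (w : ℝ × ℝ) : ker s w = (euclidNorm w ^ 2) ^ (-s) := by
  rw [ker, ← Real.rpow_natCast, ← Real.rpow_mul (euclidNorm_nonneg w)]
  congr 1
  push_cast; ring

theorem norm_neg_inv_toC_sq (w : ℝ × ℝ) : ‖-(toC w)⁻¹‖ ^ 2 = (euclidNorm w ^ 2)⁻¹ := by
  rw [norm_neg, norm_inv, ← euclidNorm_eq_norm, inv_pow]

theorem norm_toC_mul_sq (w z : ℝ × ℝ) :
    ‖toC z * (-(toC w)⁻¹)‖ ^ 2 = euclidNorm z ^ 2 / euclidNorm w ^ 2 := by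
  rw [norm_mul, mul_pow, norm_neg_inv_toC_sq, ← euclidNorm_eq_norm, div_eq_mul_inv]

theorem norm_toC_mul_le {w z : ℝ × ℝ} (hw : w ≠ 0) {q R : ℝ} (hq : 0 ≤ q) (hz : ‖z‖ ≤ R)
    (h : 2 * R ^ 2 ≤ q ^ 2 * euclidNorm w ^ 2) : ‖toC z * (-(toC w)⁻¹)‖ ≤ q := by
  have h1 := euclidNorm_pos hw
  rw [← abs_of_nonneg hq, ← abs_of_nonneg (norm_nonneg (toC z * _))]
  refine sq_le_sq.1 ?_
  rw [norm_toC_mul_sq, div_le_iff₀ (by positivity)]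
  have := euclidNorm_sq_le z
  have h3 : ‖z‖ ^ 2 ≤ R ^ 2 := pow_le_pow_left₀ (norm_nonneg z) hz 2
  linarith

theorem integrable_norm_rpow_mul {s : ℝ} (hs : 0 ≤ s) (hs1 : s < 1) {w : ℝ × ℝ} (hw : w ≠ 0)
    {ρ : ℝ × ℝ → ℝ} {r : ℝ} (hρ : Continuous ρ) (h0 : ∀ z, z ∉ square r → ρ z = 0) :
    Integrable fun z => ‖1 - toC z * (-(toC w)⁻¹)‖ ^ (-2 * s) * ρ z := by
  obtain ⟨C, hC⟩ := (isCompact_square r).exists_bound_of_continuousOn hρ.continuousOn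
  have hb : ∀ z, |ρ z| ≤ |C| := by
    intro z
    by_cases hz : z ∈ square r
    · exact (hC z hz).trans (le_abs_self C)
    · rw [h0 z hz]; simp
  have h := integrable_ker_mul hs hs1 w hρ.aestronglyMeasurable (Eventually.of_forall hb) h0
  have hk : ker s w ≠ 0 := by
    have := euclidNorm_pos hw
    rw [ker]; positivity
  refine (h.const_mul (ker s w)⁻¹).congr (Eventually.of_forall fun z => ?_)
  simp only
  rw [ker_add_eq s hw]
  field_simp

theorem rpow_mul_kerAvg (s : ℝ) {w : ℝ × ℝ} (hw : w ≠ 0) :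
    (euclidNorm w ^ 2) ^ s * kerAvg s w =
      ∫ z, ‖1 - toC z * (-(toC w)⁻¹)‖ ^ (-2 * s) * hat 1 z := by
  have h1 := euclidNorm_pos hw
  rw [kerAvg, ← integral_const_mul]
  congr 1
  ext z
  rw [ker_add_eq s hw, ker_eq_rpow]
  have : (euclidNorm w ^ 2) ^ s * (euclidNorm w ^ 2) ^ (-s) = 1 := by
    rw [← Real.rpow_add (by positivity)]; simp
  linear_combination (‖1 - toC z * (-(toC w)⁻¹)‖ ^ (-2 * s) * hat 1 z) * this

/-- Rotation invariance leaves only exponents divisible by 4; below the cut 12 these are 4 and 8. -/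
theorem integral_head_hat (s : ℝ) (κ : ℂ) :
    ∫ z, kernelHead s 12 (toC z * κ) * hat 1 z =
      1 + 2 * (binCoef s 4 * ((κ ^ 4).re * (-1 / 30)) + binCoef s 8 * ((κ ^ 8).re * (1 / 45))) +
        s ^ 2 * (‖κ‖ ^ 2 * (1 / 3)) := by
  have hz : ∀ m : ℕ, m % 4 ≠ 0 → ∫ z, (toC z ^ m).re * hat 1 z = 0 := by
    intro m hm
    have := isSymmWeight_hat.integral_eq_zero (k := 0) (m := m) (by simpa using hm) 1
    simpa using this
  rw [isSymmWeight_hat.integral_kernelHead, integral_hat, integral_sq_hat]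
  congr 3
  rw [Finset.sum_Ico_eq_sum_range]
  simp only [Finset.sum_range_succ, Finset.sum_range_zero, Nat.add_one_sub_one,
    Nat.reduceAdd, zero_add, add_zero]
  rw [hz 1 (by norm_num), hz 2 (by norm_num), hz 3 (by norm_num), hz 5 (by norm_num),
    hz 6 (by norm_num), hz 7 (by norm_num), hz 9 (by norm_num), hz 10 (by norm_num),
    hz 11 (by norm_num), integral_re_pow_four_hat, integral_re_pow_eight_hat]
  ring

/-- The weighted error of the series of `kerAvg` after the terms in `kernelHead`. -/
def headErr (s n G : ℝ) : ℝ :=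
  2 * G * binCoef s 12 * (154171 / 1261260) / n ^ 6 + 2 * s * binCoef s 5 * G * (29 / 210) / n ^ 3

/-- The explicit terms of the series of `kerAvg`. -/
def headVal (s n : ℝ) (κ : ℂ) : ℝ :=
  1 + 2 * (binCoef s 4 * ((κ ^ 4).re * (-1 / 30)) + binCoef s 8 * ((κ ^ 8).re * (1 / 45))) +
    s ^ 2 * (n⁻¹ * (1 / 3))

theorem integral_err_hat (s n q : ℝ) {w : ℝ × ℝ} (hn : euclidNorm w ^ 2 = n) :
    ∫ z, (2 * (binCoef s 12 * ‖toC z * (-(toC w)⁻¹)‖ ^ 12 / (1 - q)) +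
        2 * (s * ‖toC z * (-(toC w)⁻¹)‖ *
          (binCoef s 5 * ‖toC z * (-(toC w)⁻¹)‖ ^ 5 / (1 - q)))) * hat 1 z =
      headErr s n (1 - q)⁻¹ := by
  have e : ∀ z, (2 * (binCoef s 12 * ‖toC z * (-(toC w)⁻¹)‖ ^ 12 / (1 - q)) +
        2 * (s * ‖toC z * (-(toC w)⁻¹)‖ *
          (binCoef s 5 * ‖toC z * (-(toC w)⁻¹)‖ ^ 5 / (1 - q)))) * hat 1 z =
      2 * binCoef s 12 * (1 - q)⁻¹ / n ^ 6 * (euclidNorm z ^ 12 * hat 1 z) +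
      2 * s * binCoef s 5 * (1 - q)⁻¹ / n ^ 3 * (euclidNorm z ^ 6 * hat 1 z) := by
    intro z
    have h2 := norm_toC_mul_sq w z
    rw [hn] at h2
    have h12 : ‖toC z * (-(toC w)⁻¹)‖ ^ 12 = euclidNorm z ^ 12 / n ^ 6 := by
      rw [show 12 = 2 * 6 by norm_num, pow_mul, h2, div_pow, ← pow_mul]
    have h6 : ‖toC z * (-(toC w)⁻¹)‖ * ‖toC z * (-(toC w)⁻¹)‖ ^ 5 = euclidNorm z ^ 6 / n ^ 3 := by
      rw [← pow_succ', show 5 + 1 = 2 * 3 by norm_num, pow_mul, h2, div_pow, ← pow_mul]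
    rw [h12]
    linear_combination (2 * s * binCoef s 5 * (1 - q)⁻¹ * hat 1 z) * h6
  have i1 : Integrable fun z => euclidNorm z ^ 12 * hat 1 z :=
    isSymmWeight_hat.integrable (by fun_prop)
  have i2 : Integrable fun z => euclidNorm z ^ 6 * hat 1 z :=
    isSymmWeight_hat.integrable (by fun_prop)
  simp only [e]
  rw [integral_add (i1.const_mul _) (i2.const_mul _), integral_const_mul, integral_const_mul,
    integral_pow_twelve_hat, integral_pow_six_hat, headErr]
  ring

theorem continuous_kernelHead (s : ℝ) (M : ℕ) (κ : ℂ) :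
    Continuous fun z => kernelHead s M (toC z * κ) := by
  unfold kernelHead; fun_prop

/-- The square of the tail is nonnegative and is dropped. The hypothesis on q ensures |ζ| ≤ q on the
support of the hat, whose corners have norm √2. It can hold with q < 1 only if n > 2, which excludes
the nodes (1,0) and (1,1). -/
theorem kerAvg_lower {s : ℝ} (hs : 0 ≤ s) (hs1 : s < 1) {w : ℝ × ℝ} (hw : w ≠ 0) {n q : ℝ}
    (hn : euclidNorm w ^ 2 = n) (hq : 0 ≤ q) (hq1 : q < 1) (hqn : 2 ≤ q ^ 2 * n) :
    headVal s n (-(toC w)⁻¹) - headErr s n (1 - q)⁻¹ ≤ n ^ s * kerAvg s w := by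
  rw [← hn, rpow_mul_kerAvg s hw, hn, headVal, ← hn, ← norm_neg_inv_toC_sq w, hn,
    ← integral_head_hat, ← integral_err_hat s n q hn, ← integral_sub]
  · refine integral_mono_ae ?_ (integrable_norm_rpow_mul hs hs1 hw (continuous_hat one_pos)
      fun z hz => hat_eq_zero hz) (Eventually.of_forall fun z => ?_)
    · exact (isSymmWeight_hat.integrable (continuous_kernelHead _ _ _)).sub
        (isSymmWeight_hat.integrable (by fun_prop))
    · simp only
      rw [← sub_mul]
      by_cases hz : z ∈ square 1
      · refine mul_le_mul_of_nonneg_right ?_ (hat_nonneg one_pos z)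
        have hζ : ‖toC z * (-(toC w)⁻¹)‖ ≤ q :=
          norm_toC_mul_le hw hq (mem_square.1 hz) (by rw [hn]; linarith)
        obtain ⟨E, hE, he⟩ := kernel_sub_head hs hs1.le (M := 12) (by norm_num) hζ hq1
        rw [he]
        have := neg_abs_le E
        have := sq_nonneg ‖(1 - toC z * (-(toC w)⁻¹)) ^ (-(s : ℂ)) -
          binPart s 0 2 (toC z * (-(toC w)⁻¹))‖
        linarith
      · rw [hat_eq_zero hz, mul_zero, mul_zero]
  · exact isSymmWeight_hat.integrable (continuous_kernelHead _ _ _)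
  · exact isSymmWeight_hat.integrable (by fun_prop)

/-- The last bracket is the integrated bound of `sq_tail_le_head`, whose cross terms have
disappeared by symmetry. -/
theorem kerAvg_upper {s : ℝ} (hs : 0 ≤ s) (hs1 : s < 1) {w : ℝ × ℝ} (hw : w ≠ 0) {n q : ℝ}
    (hn : euclidNorm w ^ 2 = n) (hq : 0 ≤ q) (hq1 : q < 1) (hqn : 2 ≤ q ^ 2 * n) :
    n ^ s * kerAvg s w ≤ headVal s n (-(toC w)⁻¹) + headErr s n (1 - q)⁻¹ +
      (binCoef s 2 ^ 2 * (17 / 90) / n ^ 2 +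
        2 * (1 - q)⁻¹ * binCoef s 2 * binCoef s 6 * (187 / 1575) / n ^ 4 +
        (1 - q)⁻¹ ^ 2 * binCoef s 3 ^ 2 * (29 / 210) / n ^ 3) := by
  set κ := -(toC w)⁻¹ with hκ
  have j4 : Integrable fun z => euclidNorm z ^ 4 * hat 1 z :=
    isSymmWeight_hat.integrable (by fun_prop)
  have j6 : Integrable fun z => euclidNorm z ^ 6 * hat 1 z :=
    isSymmWeight_hat.integrable (by fun_prop)
  have j8 : Integrable fun z => euclidNorm z ^ 8 * hat 1 z :=
    isSymmWeight_hat.integrable (by fun_prop)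
  have jc : Integrable fun z => ((starRingEnd ℂ) (binCoef s 2 * (toC z * κ) ^ 2) *
      binPart s 3 6 (toC z * κ)).re * hat 1 z := isSymmWeight_hat.integrable (by fun_prop)
  have c := isSymmWeight_hat.integral_cross s (k := 2) (a := 3) (M := 6) (by norm_num)
    (by norm_num) (binCoef s 2) κ
  have hx : ∫ z, (binCoef s 2 ^ 2 / n ^ 2 * (euclidNorm z ^ 4 * hat 1 z) +
      2 * (((starRingEnd ℂ) (binCoef s 2 * (toC z * κ) ^ 2) *
        binPart s 3 6 (toC z * κ)).re * hat 1 z) +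
      2 * (1 - q)⁻¹ * binCoef s 2 * binCoef s 6 / n ^ 4 * (euclidNorm z ^ 8 * hat 1 z) +
      (1 - q)⁻¹ ^ 2 * binCoef s 3 ^ 2 / n ^ 3 * (euclidNorm z ^ 6 * hat 1 z)) =
      (binCoef s 2 ^ 2 * (17 / 90) / n ^ 2 +
        2 * (1 - q)⁻¹ * binCoef s 2 * binCoef s 6 * (187 / 1575) / n ^ 4 +
        (1 - q)⁻¹ ^ 2 * binCoef s 3 ^ 2 * (29 / 210) / n ^ 3) := by
    rw [integral_add (by fun_prop) (by fun_prop), integral_add (by fun_prop) (by fun_prop),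
      integral_add (by fun_prop) (by fun_prop), integral_const_mul, integral_const_mul,
      integral_const_mul, integral_const_mul, c, integral_pow_four_hat, integral_pow_six_hat,
      integral_pow_eight_hat]
    ring
  have ih := isSymmWeight_hat.integrable (continuous_kernelHead s 12 κ)
  have ie : Integrable fun z => (2 * (binCoef s 12 * ‖toC z * κ‖ ^ 12 / (1 - q)) +
        2 * (s * ‖toC z * κ‖ * (binCoef s 5 * ‖toC z * κ‖ ^ 5 / (1 - q)))) * hat 1 z :=
    isSymmWeight_hat.integrable (by fun_prop)
  have ihe : Integrable fun z => kernelHead s 12 (toC z * κ) * hat 1 z +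
      (2 * (binCoef s 12 * ‖toC z * κ‖ ^ 12 / (1 - q)) +
        2 * (s * ‖toC z * κ‖ * (binCoef s 5 * ‖toC z * κ‖ ^ 5 / (1 - q)))) * hat 1 z := ih.add ie
  rw [← hn, rpow_mul_kerAvg s hw, hn, headVal, ← hn, ← norm_neg_inv_toC_sq w, hn,
    ← integral_head_hat, ← integral_err_hat s n q hn, ← hx, ← hκ, ← integral_add ih ie,
    ← integral_add ihe (by fun_prop)]
  refine integral_mono_ae (integrable_norm_rpow_mul hs hs1 hw (continuous_hat one_pos)
      fun z hz => hat_eq_zero hz) (ihe.add (by fun_prop))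
      (Eventually.of_forall fun z => ?_)
  simp only
  by_cases hz : z ∈ square 1
  · have hζ : ‖toC z * κ‖ ≤ q :=
      norm_toC_mul_le hw hq (mem_square.1 hz) (by rw [hn]; linarith)
    obtain ⟨E, hE, he⟩ := kernel_sub_head hs hs1.le (M := 12) (by norm_num) hζ hq1
    have ht := sq_tail_le_head hs hs1.le hζ hq1
    have h2 := norm_toC_mul_sq w z
    rw [hn, ← hκ] at h2
    have h4 : ‖toC z * κ‖ ^ 4 = euclidNorm z ^ 4 / n ^ 2 := by
      rw [show 4 = 2 * 2 by norm_num, pow_mul, h2, div_pow, ← pow_mul]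
    have h6 : ‖toC z * κ‖ ^ 6 = euclidNorm z ^ 6 / n ^ 3 := by
      rw [show 6 = 2 * 3 by norm_num, pow_mul, h2, div_pow, ← pow_mul]
    have h8 : ‖toC z * κ‖ ^ 8 = euclidNorm z ^ 8 / n ^ 4 := by
      rw [show 8 = 2 * 4 by norm_num, pow_mul, h2, div_pow, ← pow_mul]
    have hE' := (le_abs_self E).trans hE
    have := mul_le_mul_of_nonneg_right (add_le_add (add_le_add_right hE' (kernelHead s 12
      (toC z * κ))) ht) (hat_nonneg one_pos z)
    rw [he]
    refine this.trans (le_of_eq ?_)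
    linear_combination (binCoef s 2 ^ 2 * hat 1 z) * h4 +
      (2 * (1 - q)⁻¹ * binCoef s 2 * binCoef s 6 * hat 1 z) * h8 +
      ((1 - q)⁻¹ ^ 2 * binCoef s 3 ^ 2 * hat 1 z) * h6
  · simp [hat_eq_zero hz]

/-- The real part of `(p + i q) ^ (-4)`. -/
def reInvFour (p q : ℝ) : ℝ := (p ^ 4 - 6 * p ^ 2 * q ^ 2 + q ^ 4) / (p ^ 2 + q ^ 2) ^ 4

/-- The real part of `(p + i q) ^ (-8)`. -/
def reInvEight (p q : ℝ) : ℝ :=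
  (p ^ 8 - 28 * p ^ 6 * q ^ 2 + 70 * p ^ 4 * q ^ 4 - 28 * p ^ 2 * q ^ 6 + q ^ 8) /
    (p ^ 2 + q ^ 2) ^ 8

theorem neg_inv_toC (w : ℝ × ℝ) :
    -(toC w)⁻¹ = ((-(w.1 / euclidNorm w ^ 2) : ℝ) : ℂ) + ((w.2 / euclidNorm w ^ 2 : ℝ) : ℂ) *
      Complex.I := by
  have h : Complex.normSq (toC w) = euclidNorm w ^ 2 := by
    rw [euclidNorm_eq_norm, Complex.sq_norm]
  apply Complex.ext
  · rw [Complex.neg_re, Complex.inv_re, h]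
    simp only [toC, Complex.add_re, Complex.mul_re, Complex.ofReal_re, Complex.ofReal_im,
      Complex.I_re, Complex.I_im]
    ring
  · rw [Complex.neg_im, Complex.inv_im, h]
    simp only [toC, Complex.add_im, Complex.mul_im, Complex.ofReal_re, Complex.ofReal_im,
      Complex.I_re, Complex.I_im]
    ring

theorem re_pow_four (a b : ℝ) : (((a : ℂ) + (b : ℂ) * Complex.I) ^ 4).re =
    a ^ 4 - 6 * a ^ 2 * b ^ 2 + b ^ 4 := by
  simp only [pow_succ, pow_zero, one_mul, Complex.mul_re, Complex.mul_im, Complex.add_re,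
    Complex.add_im, Complex.ofReal_re, Complex.ofReal_im, Complex.I_re, Complex.I_im]
  ring

theorem re_pow_eight (a b : ℝ) : (((a : ℂ) + (b : ℂ) * Complex.I) ^ 8).re =
    a ^ 8 - 28 * a ^ 6 * b ^ 2 + 70 * a ^ 4 * b ^ 4 - 28 * a ^ 2 * b ^ 6 + b ^ 8 := by
  simp only [pow_succ, pow_zero, one_mul, Complex.mul_re, Complex.mul_im, Complex.add_re,
    Complex.add_im, Complex.ofReal_re, Complex.ofReal_im, Complex.I_re, Complex.I_im]
  ring

theorem re_neg_inv_pow_four {w : ℝ × ℝ} (hw : w ≠ 0) :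
    ((-(toC w)⁻¹) ^ 4).re = reInvFour w.1 w.2 := by
  have h := euclidNorm_pos hw
  rw [neg_inv_toC, re_pow_four, reInvFour, ← euclidNorm_sq]
  field_simp

theorem re_neg_inv_pow_eight {w : ℝ × ℝ} (hw : w ≠ 0) :
    ((-(toC w)⁻¹) ^ 8).re = reInvEight w.1 w.2 := by
  have h := euclidNorm_pos hw
  rw [neg_inv_toC, re_pow_eight, reInvEight, ← euclidNorm_sq]
  field_simp

theorem abs_re_neg_inv_pow_le (w : ℝ × ℝ) (m : ℕ) :
    |((-(toC w)⁻¹) ^ (2 * m)).re| ≤ ((euclidNorm w ^ 2) ^ m)⁻¹ := by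
  refine (Complex.abs_re_le_norm _).trans (le_of_eq ?_)
  rw [norm_pow, pow_mul, norm_neg_inv_toC_sq, inv_pow]

/-- The part that the lower and the upper bound of `kerAvg` have in common. -/
def midPoly (p q n s : ℝ) : ℝ :=
  1 + s * (-reInvFour p q / 60 + reInvEight p q / 180) +
    s ^ 2 * (-29 * reInvFour p q / 720 + 1 / (3 * n))

/-- The distance of both bounds from `midPoly`. -/
def errPoly (n G s : ℝ) : ℝ :=
  s * (G * (154171 / 1261260) / 6 / n ^ 6) +
    s ^ 2 * (7 / (720 * n ^ 2) + 2 / (45 * n ^ 4) + 2 * G * (154171 / 1261260) / n ^ 6 +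
      2 * G * (29 / 210) / 5 / n ^ 3) +
    s ^ 3 * (2 * G * (29 / 210) * (4 / 5) / n ^ 3)

/-- The additional terms of the upper bound. -/
def extraPoly (n G s : ℝ) : ℝ :=
  (s * (1 / 2 + s * (1 / 2))) ^ 2 * (17 / 90) / n ^ 2 +
    2 * G * (s * (1 / 2 + s * (1 / 2))) * (s * (1 / 6 + s * (5 / 6))) * (187 / 1575) / n ^ 4 +
    G ^ 2 * (s * (1 / 3 + s * (2 / 3))) ^ 2 * (29 / 210) / n ^ 3

theorem abs_headVal_sub_midPoly {s : ℝ} (hs : 0 ≤ s) (hs1 : s ≤ 1) {w : ℝ × ℝ} (hw : w ≠ 0)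
    {n : ℝ} (hn : euclidNorm w ^ 2 = n) :
    |headVal s n (-(toC w)⁻¹) - midPoly w.1 w.2 n s| ≤
      s ^ 2 * (7 / (720 * n ^ 2) + 2 / (45 * n ^ 4)) := by
  have hn0 : 0 < n := by rw [← hn]; have := euclidNorm_pos hw; positivity
  have a4 := abs_re_neg_inv_pow_le w 2
  have a8 := abs_re_neg_inv_pow_le w 4
  norm_num only at a4 a8
  rw [re_neg_inv_pow_four hw, hn] at a4
  rw [re_neg_inv_pow_eight hw, hn] at a8
  rw [headVal, midPoly, re_neg_inv_pow_four hw, re_neg_inv_pow_eight hw]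
  generalize reInvFour w.1 w.2 = D4 at *
  generalize reInvEight w.1 w.2 = D8 at *
  have b4 : binCoef s 4 = s / 4 + 11 / 24 * s ^ 2 + s ^ 3 / 4 + s ^ 4 / 24 := by
    simp only [binCoef, Finset.prod_range_succ, Finset.prod_range_zero]
    push_cast; ring
  have hs3 : s ^ 3 ≤ s ^ 2 := pow_le_pow_of_le_one hs hs1 (by norm_num)
  have hs4 : s ^ 4 ≤ s ^ 2 := pow_le_pow_of_le_one hs hs1 (by norm_num)
  -- As s³, s⁴ ≤ s², the part of degree at least two lies between 11/24 s² and (11/24 + 1/4 + 1/24)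
  -- s² = 36/48 s²; 29/48 is the midpoint and 7/48 the half-width.
  have b4' : |binCoef s 4 - s / 4 - 29 / 48 * s ^ 2| ≤ 7 / 48 * s ^ 2 := by
    rw [b4, abs_le]
    have : 0 ≤ s ^ 3 := by positivity
    have : 0 ≤ s ^ 4 := by positivity
    constructor <;> linarith
  have l8 := div_le_binCoef hs (m := 8) (by norm_num)
  have u8 := binCoef_le hs hs1 (m := 8) (by norm_num)
  have b8' : |binCoef s 8 - s / 8| ≤ s ^ 2 := by
    norm_num at l8 u8
    rw [abs_le]
    constructor <;> nlinarith
  have e : 1 + 2 * (binCoef s 4 * (D4 * (-1 / 30)) + binCoef s 8 * (D8 * (1 / 45))) +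
      s ^ 2 * (n⁻¹ * (1 / 3)) -
      (1 + s * (-D4 / 60 + D8 / 180) + s ^ 2 * (-29 * D4 / 720 + 1 / (3 * n))) =
      (-1 / 15) * ((binCoef s 4 - s / 4 - 29 / 48 * s ^ 2) * D4) +
        (2 / 45) * ((binCoef s 8 - s / 8) * D8) := by
    field_simp; ring
  rw [e]
  refine (abs_add_le _ _).trans ?_
  rw [abs_mul, abs_mul, abs_mul, abs_mul]
  have m4 := mul_le_mul b4' a4 (abs_nonneg _) (by positivity)
  have m8 := mul_le_mul b8' a8 (abs_nonneg _) (by positivity)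
  have : s ^ 2 * (7 / (720 * n ^ 2) + 2 / (45 * n ^ 4)) =
      1 / 15 * (7 / 48 * s ^ 2 * (n ^ 2)⁻¹) + 2 / 45 * (s ^ 2 * (n ^ 4)⁻¹) := by
    field_simp; ring
  rw [this]
  norm_num [abs_of_neg, abs_of_pos] 
  linarith

theorem headErr_le {s : ℝ} (hs : 0 ≤ s) (hs1 : s ≤ 1) {n G : ℝ} (hn : 0 < n) (hG : 0 ≤ G) :
    headErr s n G + s ^ 2 * (7 / (720 * n ^ 2) + 2 / (45 * n ^ 4)) ≤ errPoly n G s := by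
  have u12 := binCoef_le hs hs1 (m := 12) (by norm_num)
  have u5 := binCoef_le hs hs1 (m := 5) (by norm_num)
  norm_num at u12 u5
  have h12 : binCoef s 12 ≤ s / 12 + s ^ 2 := by nlinarith
  have h5 : binCoef s 5 ≤ s / 5 + 4 / 5 * s ^ 2 := by nlinarith
  have m12 := mul_le_mul_of_nonneg_left h12
    (by positivity : 0 ≤ 2 * G * (154171 / 1261260) / n ^ 6)
  have m5 := mul_le_mul_of_nonneg_left h5 (by positivity : 0 ≤ 2 * s * G * (29 / 210) / n ^ 3)
  have e1 : headErr s n G = 2 * G * (154171 / 1261260) / n ^ 6 * binCoef s 12 +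
      2 * s * G * (29 / 210) / n ^ 3 * binCoef s 5 := by rw [headErr]; ring
  have e2 : errPoly n G s = 2 * G * (154171 / 1261260) / n ^ 6 * (s / 12 + s ^ 2) +
      2 * s * G * (29 / 210) / n ^ 3 * (s / 5 + 4 / 5 * s ^ 2) +
      s ^ 2 * (7 / (720 * n ^ 2) + 2 / (45 * n ^ 4)) := by rw [errPoly]; ring
  rw [e1, e2]
  linarith

theorem midPoly_sub_errPoly_le {s : ℝ} (hs : 0 ≤ s) (hs1 : s < 1) {p r n q G : ℝ}
    (hn : p ^ 2 + r ^ 2 = n) (hn0 : 0 < n) (hq : 0 ≤ q) (hq1 : q < 1) (hqn : 2 ≤ q ^ 2 * n)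
    (hG : (1 - q)⁻¹ = G) :
    midPoly p r n s - errPoly n G s ≤ n ^ s * kerAvg s (p, r) := by
  have hw : (p, r) ≠ (0 : ℝ × ℝ) := by
    intro h
    rw [Prod.mk_eq_zero] at h
    rw [h.1, h.2] at hn
    norm_num at hn
    exact hn0.ne hn
  have hn' : euclidNorm (p, r) ^ 2 = n := by rw [euclidNorm_sq]; exact hn
  have h1 := kerAvg_lower hs hs1 hw hn' hq hq1 hqn
  have h2 := abs_headVal_sub_midPoly hs hs1.le hw hn'
  have hG0 : 0 ≤ G := by rw [← hG]; exact inv_nonneg.2 (by linarith)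
  have h3 := headErr_le hs hs1.le hn0 hG0
  rw [hG] at h1
  have := (abs_le.1 h2).1
  simp only at this
  linarith

theorem le_midPoly_add_errPoly {s : ℝ} (hs : 0 ≤ s) (hs1 : s < 1) {p r n q G : ℝ}
    (hn : p ^ 2 + r ^ 2 = n) (hn0 : 0 < n) (hq : 0 ≤ q) (hq1 : q < 1) (hqn : 2 ≤ q ^ 2 * n)
    (hG : (1 - q)⁻¹ = G) :
    n ^ s * kerAvg s (p, r) ≤ midPoly p r n s + errPoly n G s + extraPoly n G s := by
  have hw : (p, r) ≠ (0 : ℝ × ℝ) := by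
    intro h
    rw [Prod.mk_eq_zero] at h
    rw [h.1, h.2] at hn
    norm_num at hn
    exact hn0.ne hn
  have hn' : euclidNorm (p, r) ^ 2 = n := by rw [euclidNorm_sq]; exact hn
  have h1 := kerAvg_upper hs hs1 hw hn' hq hq1 hqn
  have h2 := abs_headVal_sub_midPoly hs hs1.le hw hn'
  have hG0 : 0 ≤ G := by rw [← hG]; exact inv_nonneg.2 (by linarith)
  have h3 := headErr_le hs hs1.le hn0 hG0
  rw [hG] at h1
  have := (abs_le.1 h2).2
  simp only at this
  have u2 := binCoef_le hs hs1.le (m := 2) (by norm_num)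
  have u3 := binCoef_le hs hs1.le (m := 3) (by norm_num)
  have u6 := binCoef_le hs hs1.le (m := 6) (by norm_num)
  norm_num at u2 u3 u6
  have p2 := binCoef_nonneg hs 2
  have p3 := binCoef_nonneg hs 3
  have p6 := binCoef_nonneg hs 6
  have h4 : binCoef s 2 ^ 2 * (17 / 90) / n ^ 2 +
        2 * G * binCoef s 2 * binCoef s 6 * (187 / 1575) / n ^ 4 +
        G ^ 2 * binCoef s 3 ^ 2 * (29 / 210) / n ^ 3 ≤ extraPoly n G s := by
    rw [extraPoly]
    norm_num
    gcongr
  linarith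

/-! ### Symmetries and the two-scale equation of the averaged kernel -/

theorem kerAvg_comp {e : ℝ × ℝ ≃ᵐ ℝ × ℝ} (he : MeasurePreserving e) (s : ℝ) (w : ℝ × ℝ)
    (h1 : ∀ z, euclidNorm (e w + e z) = euclidNorm (w + z)) (h2 : ∀ z, hat 1 (e z) = hat 1 z) :
    kerAvg s (e w) = kerAvg s w := by
  rw [kerAvg, ← he.integral_comp', kerAvg]
  congr 1
  ext z
  rw [h2, ker, ker, h1]

theorem kerAvg_rot (s : ℝ) (p q : ℝ) : kerAvg s (-q, p) = kerAvg s (p, q) :=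
  kerAvg_comp measurePreserving_rot s (p, q)
    (fun z => by simp only [rot_apply, euclidNorm, Prod.fst_add, Prod.snd_add]; ring_nf)
    isSymmWeight_hat.rot

theorem kerAvg_neg_right (s : ℝ) (p q : ℝ) : kerAvg s (p, -q) = kerAvg s (p, q) :=
  kerAvg_comp measurePreserving_refl2 s (p, q)
    (fun z => by simp only [refl2_apply, euclidNorm, Prod.fst_add, Prod.snd_add]; ring_nf)
    isSymmWeight_hat.refl


theorem kerAvg_swap (s : ℝ) (p q : ℝ) : kerAvg s (q, p) = kerAvg s (p, q) := by
  rw [← kerAvg_neg_right s p q, ← kerAvg_rot s p (-q), neg_neg]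

theorem kerAvg_nonneg (s : ℝ) (w : ℝ × ℝ) : 0 ≤ kerAvg s w :=
  integral_nonneg fun z => mul_nonneg (ker_nonneg _ _) (hat_nonneg one_pos z)

theorem kerAvg_add (s : ℝ) (w v : ℝ × ℝ) :
    kerAvg s (w + v) = ∫ z, ker s (w + z) * hat 1 (z - v) := by
  have h := integral_sub_right_eq_self (μ := volume)
    (fun z : ℝ × ℝ => ker s (w + v + z) * hat 1 z) v
  rw [kerAvg, ← h]
  congr 1
  ext z
  congr 2
  abel

/-- The two-scale equation of linear finite elements: a hat of width 2 is its own interpolant on the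
unit mesh, with nodal values 1/2, 1, 1/2. -/
theorem tent_half (x : ℝ) : tent (x / 2) = tent (x + 1) / 2 + tent x + tent (x - 1) / 2 := by
  have key : ∀ x : ℝ, 0 ≤ x →
      tent (x / 2) = tent (x + 1) / 2 + tent x + tent (x - 1) / 2 := by
    intro x hx
    rw [tent_eq_zero (x := x + 1) (by rw [abs_of_nonneg] <;> linarith)]
    rcases le_total x 1 with h1 | h1
    · rw [tent_of_abs_le (x := x / 2) (by rw [abs_of_nonneg] <;> linarith),
        tent_of_abs_le (x := x) (by rw [abs_of_nonneg] <;> linarith),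
        tent_of_abs_le (x := x - 1) (by rw [abs_of_nonpos] <;> linarith),
        abs_of_nonneg (by linarith : 0 ≤ x / 2), abs_of_nonneg hx,
        abs_of_nonpos (by linarith : x - 1 ≤ 0)]
      ring
    · rw [tent_eq_zero (x := x) (by rw [abs_of_nonneg] <;> linarith)]
      rcases le_total x 2 with h2 | h2
      · rw [tent_of_abs_le (x := x / 2) (by rw [abs_of_nonneg] <;> linarith),
          tent_of_abs_le (x := x - 1) (by rw [abs_of_nonneg] <;> linarith),
          abs_of_nonneg (by linarith : 0 ≤ x / 2), abs_of_nonneg (by linarith : 0 ≤ x - 1)]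
        ring
      · rw [tent_eq_zero (x := x / 2) (by rw [abs_of_nonneg] <;> linarith),
          tent_eq_zero (x := x - 1) (by rw [abs_of_nonneg] <;> linarith)]
        ring
  rcases le_total 0 x with h | h
  · exact key x h
  · have := key (-x) (by linarith)
    rw [neg_div, tent_neg, tent_neg, show -x + 1 = -(x - 1) by ring,
      show -x - 1 = -(x + 1) by ring, tent_neg, tent_neg] at this
    linarith

theorem integrable_ker_mul_hat {s : ℝ} (hs : 0 ≤ s) (hs1 : s < 1) (w v : ℝ × ℝ) :
    Integrable fun z => ker s (w + z) * hat 1 (z - v) := by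
  refine integrable_ker_mul hs hs1 w (C := 1) (r := 1 + ‖v‖)
    ((continuous_hat one_pos).comp (by fun_prop)).aestronglyMeasurable
    (Eventually.of_forall fun z => abs_hat_le_one one_pos _) fun z hz => hat_eq_zero ?_
  rw [mem_square, not_le] at hz ⊢
  have := norm_sub_norm_le z v
  linarith

/-- The tensor square of `tent_half` writes the hat of width 2 as nine unit hats, and homogeneity of
the kernel brings width 2 back to width 1. This expresses the average at a node by averages near
twice that node, which gives access to (1,0) and (1,1), where the series is not available. -/
theorem kerAvg_refine {s : ℝ} (hs : 0 ≤ s) (hs1 : s < 1) (p q : ℝ) :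
    4 * 2 ^ (-2 * s) * kerAvg s (p, q) =
      kerAvg s (2 * p, 2 * q) +
      (kerAvg s (2 * p + 1, 2 * q) + kerAvg s (2 * p - 1, 2 * q) +
        kerAvg s (2 * p, 2 * q + 1) + kerAvg s (2 * p, 2 * q - 1)) / 2 +
      (kerAvg s (2 * p + 1, 2 * q + 1) + kerAvg s (2 * p - 1, 2 * q + 1) +
        kerAvg s (2 * p + 1, 2 * q - 1) + kerAvg s (2 * p - 1, 2 * q - 1)) / 4 := by
  have h1 : ∫ z : ℝ × ℝ, ker s ((2 * p, 2 * q) + z) * hat 1 ((1 / 2 : ℝ) • z) =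
      4 * 2 ^ (-2 * s) * kerAvg s (p, q) := by
    have h := Measure.integral_comp_smul (volume : Measure (ℝ × ℝ))
      (fun z => ker s ((2 * p, 2 * q) + z) * hat 1 ((1 / 2 : ℝ) • z)) 2
    have h2 : ∀ z : ℝ × ℝ, ker s ((2 * p, 2 * q) + (2 : ℝ) • z) *
        hat 1 ((1 / 2 : ℝ) • ((2 : ℝ) • z)) = 2 ^ (-2 * s) * (ker s ((p, q) + z) * hat 1 z) := by
      intro z
      rw [smul_smul, show (1 / 2 : ℝ) * 2 = 1 by norm_num, one_smul, ← mul_assoc,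
        ← ker_smul s two_pos.le, smul_add]
      rfl
    simp only [h2] at h
    rw [integral_const_mul, ← kerAvg] at h
    norm_num at h ⊢
    linarith
  have a : ∀ a b : ℝ, kerAvg s (2 * p + a, 2 * q + b) =
      ∫ z, ker s ((2 * p, 2 * q) + z) * hat 1 (z - (a, b)) := fun a b => by
    rw [← kerAvg_add]; rfl
  have i : ∀ a b : ℝ, Integrable fun z => ker s ((2 * p, 2 * q) + z) * hat 1 (z - (a, b)) :=
    fun a b => integrable_ker_mul_hat hs hs1 _ _
  have h3 : ∀ z : ℝ × ℝ, ker s ((2 * p, 2 * q) + z) * hat 1 ((1 / 2 : ℝ) • z) =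
      (ker s ((2 * p, 2 * q) + z) * hat 1 (z - (0, 0)) +
      (1 / 2) * (ker s ((2 * p, 2 * q) + z) * hat 1 (z - (1, 0)) +
        ker s ((2 * p, 2 * q) + z) * hat 1 (z - (-1, 0)) +
        ker s ((2 * p, 2 * q) + z) * hat 1 (z - (0, 1)) +
        ker s ((2 * p, 2 * q) + z) * hat 1 (z - (0, -1)))) +
      (1 / 4) * (ker s ((2 * p, 2 * q) + z) * hat 1 (z - (1, 1)) +
        ker s ((2 * p, 2 * q) + z) * hat 1 (z - (-1, 1)) +
        ker s ((2 * p, 2 * q) + z) * hat 1 (z - (1, -1)) +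
        ker s ((2 * p, 2 * q) + z) * hat 1 (z - (-1, -1))) := by
    intro z
    have e1 := tent_half z.1
    have e2 := tent_half z.2
    simp only [hat_one, Prod.fst_sub, Prod.snd_sub, Prod.smul_fst, Prod.smul_snd, smul_eq_mul,
      sub_zero, sub_neg_eq_add]
    rw [show 1 / 2 * z.1 = z.1 / 2 by ring, show 1 / 2 * z.2 = z.2 / 2 by ring, e1, e2]
    ring
  simp only [h3] at h1
  have i00 := i 0 0
  have i10 := i 1 0
  have i20 := i (-1) 0
  have i01 := i 0 1
  have i02 := i 0 (-1)
  have i11 := i 1 1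
  have i21 := i (-1) 1
  have i12 := i 1 (-1)
  have i22 := i (-1) (-1)
  rw [integral_add (by fun_prop) (by fun_prop), integral_add (by fun_prop) (by fun_prop),
    integral_const_mul, integral_const_mul,
    integral_add (by fun_prop) (by fun_prop), integral_add (by fun_prop) (by fun_prop),
    integral_add (by fun_prop) (by fun_prop), integral_add (by fun_prop) (by fun_prop),
    integral_add (by fun_prop) (by fun_prop), integral_add (by fun_prop) (by fun_prop)] at h1
  simp only [← a, add_zero, ← sub_eq_add_neg] at h1
  rw [← h1]
  ring

/-! ### Numerical bounds for the exponential and for logarithms -/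

/-- The Taylor polynomial of degree three of the exponential function. -/
def expPoly (x : ℝ) : ℝ := 1 + x + x ^ 2 / 2 + x ^ 3 / 6

/-- Odd degree is essential: only then does the Taylor polynomial lie below the exponential on the
negative axis too. There, expPoly(y)e^(-y) has derivative -(y³/6)e^(-y) ≥ 0 and reaches 1 at 0. -/
theorem expPoly_le_exp (x : ℝ) : expPoly x ≤ Real.exp x := by
  rcases le_total 0 x with h | h
  · have := Real.sum_le_exp_of_nonneg h 4
    refine le_trans (le_of_eq ?_) this
    norm_num [Finset.sum_range_succ, expPoly, Nat.factorial]
  · have hd : ∀ y : ℝ, HasDerivAt (fun y => expPoly y * Real.exp (-y))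
        (-(y ^ 3 / 6) * Real.exp (-y)) y := by
      intro y
      have h1 : HasDerivAt expPoly (1 + y + y ^ 2 / 2) y := by
        have := (((hasDerivAt_id y).const_add 1).add ((hasDerivAt_pow 2 y).div_const 2)).add
          ((hasDerivAt_pow 3 y).div_const 6)
        convert! this using 1
        norm_num; ring
      have h2 : HasDerivAt (fun y : ℝ => Real.exp (-y)) (Real.exp (-y) * -1) y :=
        (hasDerivAt_neg y).exp
      convert! h1.mul h2 using 1
      rw [expPoly]; ring
    have hmono : MonotoneOn (fun y => expPoly y * Real.exp (-y)) (Set.Iic 0) := by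
      refine monotoneOn_of_deriv_nonneg (convex_Iic 0)
        (fun y _ => (hd y).continuousAt.continuousWithinAt)
        (fun y _ => (hd y).differentiableAt.differentiableWithinAt) fun y hy => ?_
      rw [interior_Iic, Set.mem_Iio] at hy
      rw [(hd y).deriv]
      have : y ^ 3 ≤ 0 := by nlinarith [sq_nonneg y]
      have := Real.exp_pos (-y)
      nlinarith
    have := hmono (Set.mem_Iic.2 h) (Set.mem_Iic.2 le_rfl) h
    simp only at this
    rw [neg_zero, Real.exp_zero, mul_one, Real.exp_neg, show expPoly 0 = 1 by norm_num [expPoly]] at this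
    rw [← div_eq_mul_inv, div_le_iff₀ (Real.exp_pos x)] at this
    linarith

theorem log_near {y a : ℝ} (x : ℝ) (hx : |x| < 1) (n : ℕ) (hy : y = 1 - x)
    {ε : ℝ} (hε : |x| ^ (n + 1) / (1 - |x|) + |(∑ i ∈ Finset.range n, x ^ (i + 1) / (i + 1)) + a| ≤ ε) :
    |Real.log y - a| ≤ ε := by
  have h := Real.abs_log_sub_add_sum_range_le hx n
  rw [← hy] at h
  refine le_trans ?_ hε
  have e : Real.log y - a = ((∑ i ∈ Finset.range n, x ^ (i + 1) / (i + 1)) + Real.log y) -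
    ((∑ i ∈ Finset.range n, x ^ (i + 1) / (i + 1)) + a) := by ring
  rw [e]
  exact (abs_sub _ _).trans (add_le_add_left h _)

/-- The ratio 80/81 = 2⁴·5/3⁴ is close to 1, so a few terms of the logarithmic series suffice, and
log 5 follows from log 2 and log 3. The ratios 26/27, 50/51 and 29/30 play the same role for 13, 17
and 29. -/
theorem log_five_bounds : 1.60943791 < Real.log 5 ∧ Real.log 5 < 1.60943792 := by
  have h : |Real.log (80 / 81) - (-0.012422519999)| ≤ 1 / 10 ^ 10 :=
    log_near (1 / 81) (by norm_num [abs_of_pos]) 6 (by norm_num)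
      (by norm_num [Finset.sum_range_succ, abs_of_pos, abs_of_neg])
  have e : Real.log (80 / 81) = 4 * Real.log 2 + Real.log 5 - 4 * Real.log 3 := by
    rw [Real.log_div (by norm_num) (by norm_num), show (80 : ℝ) = 2 ^ 4 * 5 by norm_num,
      show (81 : ℝ) = 3 ^ 4 by norm_num, Real.log_mul (by norm_num) (by norm_num), Real.log_pow,
      Real.log_pow]
    norm_num
  rw [e, abs_le] at h
  have := Real.log_two_gt_d9
  have := Real.log_two_lt_d9
  have := Real.log_three_gt_d9
  have := Real.log_three_lt_d9
  norm_num at *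
  constructor <;> linarith

theorem log_thirteen_bounds : 2.56494935 < Real.log 13 ∧ Real.log 13 < 2.56494936 := by
  have h : |Real.log (26 / 27) - (-0.037740327983)| ≤ 1 / 10 ^ 10 :=
    log_near (1 / 27) (by norm_num [abs_of_pos]) 7 (by norm_num)
      (by norm_num [Finset.sum_range_succ, abs_of_pos, abs_of_neg])
  have e : Real.log (26 / 27) = Real.log 2 + Real.log 13 - 3 * Real.log 3 := by
    rw [Real.log_div (by norm_num) (by norm_num), show (26 : ℝ) = 2 * 13 by norm_num,
      show (27 : ℝ) = 3 ^ 3 by norm_num, Real.log_mul (by norm_num) (by norm_num), Real.log_pow]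
    norm_num
  rw [e, abs_le] at h
  have := Real.log_two_gt_d9
  have := Real.log_two_lt_d9
  have := Real.log_three_gt_d9
  have := Real.log_three_lt_d9
  norm_num at *
  constructor <;> linarith

theorem log_seventeen_bounds : 2.83321333 < Real.log 17 ∧ Real.log 17 < 2.83321336 := by
  have h : |Real.log (50 / 51) - (-0.019802627296)| ≤ 1 / 10 ^ 10 :=
    log_near (1 / 51) (by norm_num [abs_of_pos]) 7 (by norm_num)
      (by norm_num [Finset.sum_range_succ, abs_of_pos, abs_of_neg])
  have e : Real.log (50 / 51) = Real.log 2 + 2 * Real.log 5 - (Real.log 3 + Real.log 17) := by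
    rw [Real.log_div (by norm_num) (by norm_num), show (50 : ℝ) = 2 * 5 ^ 2 by norm_num,
      show (51 : ℝ) = 3 * 17 by norm_num, Real.log_mul (by norm_num) (by norm_num),
      Real.log_mul (by norm_num) (by norm_num), Real.log_pow]
    norm_num
  rw [e, abs_le] at h
  have := Real.log_two_gt_d9
  have := Real.log_two_lt_d9
  have := Real.log_three_gt_d9
  have := Real.log_three_lt_d9
  obtain ⟨_, _⟩ := log_five_bounds
  norm_num at *
  constructor <;> linarith

theorem log_twenty_nine_bounds : 3.36729581 < Real.log 29 ∧ Real.log 29 < 3.36729585 := by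
  have h : |Real.log (29 / 30) - (-0.033901551676)| ≤ 1 / 10 ^ 10 :=
    log_near (1 / 30) (by norm_num [abs_of_pos]) 7 (by norm_num)
      (by norm_num [Finset.sum_range_succ, abs_of_pos, abs_of_neg])
  have e : Real.log (29 / 30) = Real.log 29 - (Real.log 2 + Real.log 3 + Real.log 5) := by
    rw [Real.log_div (by norm_num) (by norm_num), show (30 : ℝ) = 2 * 3 * 5 by norm_num,
      Real.log_mul (by norm_num) (by norm_num), Real.log_mul (by norm_num) (by norm_num)]
  rw [e, abs_le] at h
  have := Real.log_two_gt_d9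
  have := Real.log_two_lt_d9
  have := Real.log_three_gt_d9
  have := Real.log_three_lt_d9
  obtain ⟨_, _⟩ := log_five_bounds
  norm_num at *
  constructor <;> linarith

/-- A polynomial of degree three with constant coefficient `1`. -/
def cubic (a b c s : ℝ) : ℝ := 1 + a * s + b * s ^ 2 + c * s ^ 3

/-- Bounds at different nodes are normalised by different powers n^s. This brings them to a common
n₀^s: the factor is exp(s(log n₀ - log n)), bounded below by a cubic polynomial, so a whole stencil
can be compared as polynomials in s. -/
theorem expPoly_mul_le {s : ℝ} (hs : 0 ≤ s) {n n₀ u l c I : ℝ} (hn : 0 < n) (hn₀ : 0 < n₀)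
    (hu : Real.log n ≤ u) (hl : l ≤ Real.log n₀) (hc : 0 ≤ c) (h : c ≤ n ^ s * I) :
    expPoly (-(s * (u - l))) * c ≤ n₀ ^ s * I := by
  have h1 : n₀ ^ s * I = Real.exp (s * (Real.log n₀ - Real.log n)) * (n ^ s * I) := by
    rw [Real.rpow_def_of_pos hn, Real.rpow_def_of_pos hn₀, ← mul_assoc, ← Real.exp_add]
    congr 2
    ring
  have h2 : Real.exp (-(s * (u - l))) ≤ Real.exp (s * (Real.log n₀ - Real.log n)) := by
    refine Real.exp_le_exp.2 ?_
    have := mul_le_mul_of_nonneg_left (add_le_add hu (neg_le_neg hl)) hs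
    linarith
  rw [h1]
  exact (mul_le_mul_of_nonneg_right ((expPoly_le_exp _).trans h2) hc).trans
    (mul_le_mul_of_nonneg_left h (Real.exp_pos _).le)

theorem node_bound {c d e : ℝ} (h0 : 0 ≤ c) (h : d ≤ e)
    (hd : c ≤ d) : 0 ≤ c ∧ c ≤ e := ⟨h0, hd.trans h⟩

theorem log_two_mem : 0.693146 ≤ Real.log 2 ∧ Real.log 2 ≤ 0.693148 := by
  have := Real.log_two_gt_d9
  have := Real.log_two_lt_d9
  norm_num at *
  constructor <;> linarith

theorem log_four_mem : 1.386294 ≤ Real.log 4 ∧ Real.log 4 ≤ 1.386295 := by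
  have h : (4 : ℝ) = 2 ^ 2 := by norm_num
  rw [h, Real.log_pow]
  have := Real.log_two_gt_d9
  have := Real.log_two_lt_d9
  norm_num at *
  constructor <;> linarith

theorem log_five_mem : 1.609437 ≤ Real.log 5 ∧ Real.log 5 ≤ 1.609439 := by
  obtain ⟨_, _⟩ := log_five_bounds
  norm_num at *
  constructor <;> linarith

theorem log_eight_mem : 2.079441 ≤ Real.log 8 ∧ Real.log 8 ≤ 2.079442 := by
  have h : (8 : ℝ) = 2 ^ 3 := by norm_num
  rw [h, Real.log_pow]
  have := Real.log_two_gt_d9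
  have := Real.log_two_lt_d9
  norm_num at *
  constructor <;> linarith

theorem log_nine_mem : 2.197224 ≤ Real.log 9 ∧ Real.log 9 ≤ 2.197225 := by
  have h : (9 : ℝ) = 3 ^ 2 := by norm_num
  rw [h, Real.log_pow]
  have := Real.log_three_gt_d9
  have := Real.log_three_lt_d9
  norm_num at *
  constructor <;> linarith

theorem log_ten_mem : 2.302584 ≤ Real.log 10 ∧ Real.log 10 ≤ 2.302586 := by
  have h : (10 : ℝ) = 2 ^ 1 * 5 ^ 1 := by norm_num
  rw [h, Real.log_mul (by norm_num) (by norm_num), Real.log_pow, Real.log_pow]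
  have := Real.log_two_gt_d9
  have := Real.log_two_lt_d9
  obtain ⟨_, _⟩ := log_five_bounds
  norm_num at *
  constructor <;> linarith

theorem log_thirteen_mem : 2.564949 ≤ Real.log 13 ∧ Real.log 13 ≤ 2.56495 := by
  obtain ⟨_, _⟩ := log_thirteen_bounds
  norm_num at *
  constructor <;> linarith

theorem log_sixteen_mem : 2.772588 ≤ Real.log 16 ∧ Real.log 16 ≤ 2.77259 := by
  have h : (16 : ℝ) = 2 ^ 4 := by norm_num
  rw [h, Real.log_pow]
  have := Real.log_two_gt_d9
  have := Real.log_two_lt_d9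
  norm_num at *
  constructor <;> linarith

theorem log_seventeen_mem : 2.833213 ≤ Real.log 17 ∧ Real.log 17 ≤ 2.833214 := by
  obtain ⟨_, _⟩ := log_seventeen_bounds
  norm_num at *
  constructor <;> linarith

theorem log_eighteen_mem : 2.890371 ≤ Real.log 18 ∧ Real.log 18 ≤ 2.890373 := by
  have h : (18 : ℝ) = 2 ^ 1 * 3 ^ 2 := by norm_num
  rw [h, Real.log_mul (by norm_num) (by norm_num), Real.log_pow, Real.log_pow]
  have := Real.log_two_gt_d9
  have := Real.log_two_lt_d9
  have := Real.log_three_gt_d9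
  have := Real.log_three_lt_d9
  norm_num at *
  constructor <;> linarith

theorem log_twenty_mem : 2.995731 ≤ Real.log 20 ∧ Real.log 20 ≤ 2.995733 := by
  have h : (20 : ℝ) = 2 ^ 2 * 5 ^ 1 := by norm_num
  rw [h, Real.log_mul (by norm_num) (by norm_num), Real.log_pow, Real.log_pow]
  have := Real.log_two_gt_d9
  have := Real.log_two_lt_d9
  obtain ⟨_, _⟩ := log_five_bounds
  norm_num at *
  constructor <;> linarith

theorem log_twentyfive_mem : 3.218875 ≤ Real.log 25 ∧ Real.log 25 ≤ 3.218877 := by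
  have h : (25 : ℝ) = 5 ^ 2 := by norm_num
  rw [h, Real.log_pow]
  obtain ⟨_, _⟩ := log_five_bounds
  norm_num at *
  constructor <;> linarith

theorem log_twentysix_mem : 3.258096 ≤ Real.log 26 ∧ Real.log 26 ≤ 3.258097 := by
  have h : (26 : ℝ) = 2 ^ 1 * 13 ^ 1 := by norm_num
  rw [h, Real.log_mul (by norm_num) (by norm_num), Real.log_pow, Real.log_pow]
  have := Real.log_two_gt_d9
  have := Real.log_two_lt_d9
  obtain ⟨_, _⟩ := log_thirteen_bounds
  norm_num at *
  constructor <;> linarith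

theorem log_twentynine_mem : 3.367295 ≤ Real.log 29 ∧ Real.log 29 ≤ 3.367297 := by
  obtain ⟨_, _⟩ := log_twenty_nine_bounds
  norm_num at *
  constructor <;> linarith

theorem log_thirtytwo_mem : 3.465735 ≤ Real.log 32 ∧ Real.log 32 ≤ 3.465737 := by
  have h : (32 : ℝ) = 2 ^ 5 := by norm_num
  rw [h, Real.log_pow]
  have := Real.log_two_gt_d9
  have := Real.log_two_lt_d9
  norm_num at *
  constructor <;> linarith

theorem log_thirtyfour_mem : 3.52636 ≤ Real.log 34 ∧ Real.log 34 ≤ 3.526361 := by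
  have h : (34 : ℝ) = 2 ^ 1 * 17 ^ 1 := by norm_num
  rw [h, Real.log_mul (by norm_num) (by norm_num), Real.log_pow, Real.log_pow]
  have := Real.log_two_gt_d9
  have := Real.log_two_lt_d9
  obtain ⟨_, _⟩ := log_seventeen_bounds
  norm_num at *
  constructor <;> linarith

/-! ### Cubic lower bounds at individual nodes -/

/-- Here and at the other nodes treated by series, the decimals are lower roundings of the
coefficients of `midPoly - errPoly`. The fraction q is a convenient rational with q²n ≥ 2 and G =
1/(1-q): 5/7 serves n = 4, and 7/11 every n ≥ 5. -/
theorem kerAvg_two_zero {s : ℝ} (hs : 0 ≤ s) (hs1 : s < 1) :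
    0 ≤ cubic (-0.0010374) (0.0768) (-0.013) s ∧ cubic (-0.0010374) (0.0768) (-0.013) s ≤ 4 ^ s * kerAvg s (2, 0) := by
  refine node_bound ?_ (midPoly_sub_errPoly_le (q := 5 / 7) (G := 7 / 2) hs hs1
    (by norm_num) (by norm_num) (by norm_num) (by norm_num) (by norm_num) (by norm_num)) ?_
  · norm_num [cubic]
    nlinarith [mul_nonneg hs (sub_nonneg.2 hs1.le), pow_nonneg hs 2, pow_nonneg hs 3]
  · norm_num [cubic, midPoly, errPoly, reInvFour, reInvEight]
    linarith [pow_nonneg hs 2, pow_nonneg hs 3]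

theorem kerAvg_two_one {s : ℝ} (hs : 0 ≤ s) (hs1 : s < 1) :
    0 ≤ cubic (0.0001755) (0.06539) (-0.005) s ∧ cubic (0.0001755) (0.06539) (-0.005) s ≤ 5 ^ s * kerAvg s (2, 1) := by
  refine node_bound ?_ (midPoly_sub_errPoly_le (q := 7 / 11) (G := 11 / 4) hs hs1
    (by norm_num) (by norm_num) (by norm_num) (by norm_num) (by norm_num) (by norm_num)) ?_
  · norm_num [cubic]
    nlinarith [mul_nonneg hs (sub_nonneg.2 hs1.le), pow_nonneg hs 2, pow_nonneg hs 3]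
  · norm_num [cubic, midPoly, errPoly, reInvFour, reInvEight]
    linarith [pow_nonneg hs 2, pow_nonneg hs 3]

theorem kerAvg_two_two {s : ℝ} (hs : 0 ≤ s) (hs1 : s < 1) :
    0 ≤ cubic (0.0002615) (0.04183) (-0.002) s ∧ cubic (0.0002615) (0.04183) (-0.002) s ≤ 8 ^ s * kerAvg s (2, 2) := by
  refine node_bound ?_ (midPoly_sub_errPoly_le (q := 7 / 11) (G := 11 / 4) hs hs1
    (by norm_num) (by norm_num) (by norm_num) (by norm_num) (by norm_num) (by norm_num)) ?_
  · norm_num [cubic]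
    nlinarith [mul_nonneg hs (sub_nonneg.2 hs1.le), pow_nonneg hs 2, pow_nonneg hs 3]
  · norm_num [cubic, midPoly, errPoly, reInvFour, reInvEight]
    linarith [pow_nonneg hs 2, pow_nonneg hs 3]

theorem kerAvg_three_zero {s : ℝ} (hs : 0 ≤ s) (hs1 : s < 1) :
    0 ≤ cubic (-0.0002051) (0.0362) (-0.001) s ∧ cubic (-0.0002051) (0.0362) (-0.001) s ≤ 9 ^ s * kerAvg s (3, 0) := by
  refine node_bound ?_ (midPoly_sub_errPoly_le (q := 7 / 11) (G := 11 / 4) hs hs1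
    (by norm_num) (by norm_num) (by norm_num) (by norm_num) (by norm_num) (by norm_num)) ?_
  · norm_num [cubic]
    nlinarith [mul_nonneg hs (sub_nonneg.2 hs1.le), pow_nonneg hs 2, pow_nonneg hs 3]
  · norm_num [cubic, midPoly, errPoly, reInvFour, reInvEight]
    linarith [pow_nonneg hs 2, pow_nonneg hs 3]

theorem kerAvg_three_one {s : ℝ} (hs : 0 ≤ s) (hs1 : s < 1) :
    0 ≤ cubic (-0.0000472) (0.03296) (-0.001) s ∧ cubic (-0.0000472) (0.03296) (-0.001) s ≤ 10 ^ s * kerAvg s (3, 1) := by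
  refine node_bound ?_ (midPoly_sub_errPoly_le (q := 7 / 11) (G := 11 / 4) hs hs1
    (by norm_num) (by norm_num) (by norm_num) (by norm_num) (by norm_num) (by norm_num)) ?_
  · norm_num [cubic]
    nlinarith [mul_nonneg hs (sub_nonneg.2 hs1.le), pow_nonneg hs 2, pow_nonneg hs 3]
  · norm_num [cubic, midPoly, errPoly, reInvFour, reInvEight]
    linarith [pow_nonneg hs 2, pow_nonneg hs 3]

theorem kerAvg_three_two {s : ℝ} (hs : 0 ≤ s) (hs1 : s < 1) :
    0 ≤ cubic (0.0000694) (0.02568) (-0.001) s ∧ cubic (0.0000694) (0.02568) (-0.001) s ≤ 13 ^ s * kerAvg s (3, 2) := by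
  refine node_bound ?_ (midPoly_sub_errPoly_le (q := 7 / 11) (G := 11 / 4) hs hs1
    (by norm_num) (by norm_num) (by norm_num) (by norm_num) (by norm_num) (by norm_num)) ?_
  · norm_num [cubic]
    nlinarith [mul_nonneg hs (sub_nonneg.2 hs1.le), pow_nonneg hs 2, pow_nonneg hs 3]
  · norm_num [cubic, midPoly, errPoly, reInvFour, reInvEight]
    linarith [pow_nonneg hs 2, pow_nonneg hs 3]

theorem kerAvg_three_three {s : ℝ} (hs : 0 ≤ s) (hs1 : s < 1) :
    0 ≤ cubic (0.0000514) (0.01858) (-0.001) s ∧ cubic (0.0000514) (0.01858) (-0.001) s ≤ 18 ^ s * kerAvg s (3, 3) := by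
  refine node_bound ?_ (midPoly_sub_errPoly_le (q := 7 / 11) (G := 11 / 4) hs hs1
    (by norm_num) (by norm_num) (by norm_num) (by norm_num) (by norm_num) (by norm_num)) ?_
  · norm_num [cubic]
    nlinarith [mul_nonneg hs (sub_nonneg.2 hs1.le), pow_nonneg hs 2, pow_nonneg hs 3]
  · norm_num [cubic, midPoly, errPoly, reInvFour, reInvEight]
    linarith [pow_nonneg hs 2, pow_nonneg hs 3]

theorem kerAvg_four_zero {s : ℝ} (hs : 0 ≤ s) (hs1 : s < 1) :
    0 ≤ cubic (-0.0000651) (0.0206) (-0.001) s ∧ cubic (-0.0000651) (0.0206) (-0.001) s ≤ 16 ^ s * kerAvg s (4, 0) := by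
  refine node_bound ?_ (midPoly_sub_errPoly_le (q := 7 / 11) (G := 11 / 4) hs hs1
    (by norm_num) (by norm_num) (by norm_num) (by norm_num) (by norm_num) (by norm_num)) ?_
  · norm_num [cubic]
    nlinarith [mul_nonneg hs (sub_nonneg.2 hs1.le), pow_nonneg hs 2, pow_nonneg hs 3]
  · norm_num [cubic, midPoly, errPoly, reInvFour, reInvEight]
    linarith [pow_nonneg hs 2, pow_nonneg hs 3]

theorem kerAvg_four_one {s : ℝ} (hs : 0 ≤ s) (hs1 : s < 1) :
    0 ≤ cubic (-0.0000322) (0.01946) (-0.001) s ∧ cubic (-0.0000322) (0.01946) (-0.001) s ≤ 17 ^ s * kerAvg s (4, 1) := by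
  refine node_bound ?_ (midPoly_sub_errPoly_le (q := 7 / 11) (G := 11 / 4) hs hs1
    (by norm_num) (by norm_num) (by norm_num) (by norm_num) (by norm_num) (by norm_num)) ?_
  · norm_num [cubic]
    nlinarith [mul_nonneg hs (sub_nonneg.2 hs1.le), pow_nonneg hs 2, pow_nonneg hs 3]
  · norm_num [cubic, midPoly, errPoly, reInvFour, reInvEight]
    linarith [pow_nonneg hs 2, pow_nonneg hs 3]

theorem kerAvg_four_two {s : ℝ} (hs : 0 ≤ s) (hs1 : s < 1) :
    0 ≤ cubic (0.0000116) (0.01665) (-0.001) s ∧ cubic (0.0000116) (0.01665) (-0.001) s ≤ 20 ^ s * kerAvg s (4, 2) := by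
  refine node_bound ?_ (midPoly_sub_errPoly_le (q := 7 / 11) (G := 11 / 4) hs hs1
    (by norm_num) (by norm_num) (by norm_num) (by norm_num) (by norm_num) (by norm_num)) ?_
  · norm_num [cubic]
    nlinarith [mul_nonneg hs (sub_nonneg.2 hs1.le), pow_nonneg hs 2, pow_nonneg hs 3]
  · norm_num [cubic, midPoly, errPoly, reInvFour, reInvEight]
    linarith [pow_nonneg hs 2, pow_nonneg hs 3]

theorem kerAvg_four_three {s : ℝ} (hs : 0 ≤ s) (hs1 : s < 1) :
    0 ≤ cubic (0.0000224) (0.01336) (-0.001) s ∧ cubic (0.0000224) (0.01336) (-0.001) s ≤ 25 ^ s * kerAvg s (4, 3) := by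
  refine node_bound ?_ (midPoly_sub_errPoly_le (q := 7 / 11) (G := 11 / 4) hs hs1
    (by norm_num) (by norm_num) (by norm_num) (by norm_num) (by norm_num) (by norm_num)) ?_
  · norm_num [cubic]
    nlinarith [mul_nonneg hs (sub_nonneg.2 hs1.le), pow_nonneg hs 2, pow_nonneg hs 3]
  · norm_num [cubic, midPoly, errPoly, reInvFour, reInvEight]
    linarith [pow_nonneg hs 2, pow_nonneg hs 3]

theorem kerAvg_four_four {s : ℝ} (hs : 0 ≤ s) (hs1 : s < 1) :
    0 ≤ cubic (0.0000162) (0.01044) (-0.001) s ∧ cubic (0.0000162) (0.01044) (-0.001) s ≤ 32 ^ s * kerAvg s (4, 4) := by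
  refine node_bound ?_ (midPoly_sub_errPoly_le (q := 7 / 11) (G := 11 / 4) hs hs1
    (by norm_num) (by norm_num) (by norm_num) (by norm_num) (by norm_num) (by norm_num)) ?_
  · norm_num [cubic]
    nlinarith [mul_nonneg hs (sub_nonneg.2 hs1.le), pow_nonneg hs 2, pow_nonneg hs 3]
  · norm_num [cubic, midPoly, errPoly, reInvFour, reInvEight]
    linarith [pow_nonneg hs 2, pow_nonneg hs 3]

theorem kerAvg_five_zero {s : ℝ} (hs : 0 ≤ s) (hs1 : s < 1) :
    0 ≤ cubic (-0.0000267) (0.01324) (-0.001) s ∧ cubic (-0.0000267) (0.01324) (-0.001) s ≤ 25 ^ s * kerAvg s (5, 0) := by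
  refine node_bound ?_ (midPoly_sub_errPoly_le (q := 7 / 11) (G := 11 / 4) hs hs1
    (by norm_num) (by norm_num) (by norm_num) (by norm_num) (by norm_num) (by norm_num)) ?_
  · norm_num [cubic]
    nlinarith [mul_nonneg hs (sub_nonneg.2 hs1.le), pow_nonneg hs 2, pow_nonneg hs 3]
  · norm_num [cubic, midPoly, errPoly, reInvFour, reInvEight]
    linarith [pow_nonneg hs 2, pow_nonneg hs 3]

theorem kerAvg_five_one {s : ℝ} (hs : 0 ≤ s) (hs1 : s < 1) :
    0 ≤ cubic (-0.0000174) (0.01275) (-0.001) s ∧ cubic (-0.0000174) (0.01275) (-0.001) s ≤ 26 ^ s * kerAvg s (5, 1) := by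
  refine node_bound ?_ (midPoly_sub_errPoly_le (q := 7 / 11) (G := 11 / 4) hs hs1
    (by norm_num) (by norm_num) (by norm_num) (by norm_num) (by norm_num) (by norm_num)) ?_
  · norm_num [cubic]
    nlinarith [mul_nonneg hs (sub_nonneg.2 hs1.le), pow_nonneg hs 2, pow_nonneg hs 3]
  · norm_num [cubic, midPoly, errPoly, reInvFour, reInvEight]
    linarith [pow_nonneg hs 2, pow_nonneg hs 3]

theorem kerAvg_five_two {s : ℝ} (hs : 0 ≤ s) (hs1 : s < 1) :
    0 ≤ cubic (-0.000001) (0.01147) (-0.001) s ∧ cubic (-0.000001) (0.01147) (-0.001) s ≤ 29 ^ s * kerAvg s (5, 2) := by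
  refine node_bound ?_ (midPoly_sub_errPoly_le (q := 7 / 11) (G := 11 / 4) hs hs1
    (by norm_num) (by norm_num) (by norm_num) (by norm_num) (by norm_num) (by norm_num)) ?_
  · norm_num [cubic]
    nlinarith [mul_nonneg hs (sub_nonneg.2 hs1.le), pow_nonneg hs 2, pow_nonneg hs 3]
  · norm_num [cubic, midPoly, errPoly, reInvFour, reInvEight]
    linarith [pow_nonneg hs 2, pow_nonneg hs 3]

theorem kerAvg_five_three {s : ℝ} (hs : 0 ≤ s) (hs1 : s < 1) :
    0 ≤ cubic (0.000008) (0.00981) (-0.001) s ∧ cubic (0.000008) (0.00981) (-0.001) s ≤ 34 ^ s * kerAvg s (5, 3) := by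
  refine node_bound ?_ (midPoly_sub_errPoly_le (q := 7 / 11) (G := 11 / 4) hs hs1
    (by norm_num) (by norm_num) (by norm_num) (by norm_num) (by norm_num) (by norm_num)) ?_
  · norm_num [cubic]
    nlinarith [mul_nonneg hs (sub_nonneg.2 hs1.le), pow_nonneg hs 2, pow_nonneg hs 3]
  · norm_num [cubic, midPoly, errPoly, reInvFour, reInvEight]
    linarith [pow_nonneg hs 2, pow_nonneg hs 3]

/-- The two-scale equation at (1,1) involves the nine nodes around (2,2), one of which is (1,1)
itself. Moving that term to the left leaves (4 - 4^s/4) times the unknown, and the other eight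
averages are already bounded. -/
theorem kerAvg_one_one {s : ℝ} (hs : 0 ≤ s) (hs1 : s < 1) :
    0 ≤ cubic (0.0046) (0.191) (0.042) s ∧ cubic (0.0046) (0.191) (0.042) s ≤ 2 ^ s * kerAvg s (1, 1) := by
  have hr := kerAvg_refine hs hs1 1 1
  norm_num at hr
  rw [kerAvg_swap s 3 2, kerAvg_swap s 2 1] at hr
  rw [kerAvg_swap s 3 1] at hr
  have h0 := expPoly_mul_le (n₀ := 8) hs (by norm_num) (by norm_num) log_eight_mem.2 log_eight_mem.1
    (kerAvg_two_two hs hs1).1 (kerAvg_two_two hs hs1).2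
  have h1 := expPoly_mul_le (n₀ := 8) hs (by norm_num) (by norm_num) log_five_mem.2 log_eight_mem.1
    (kerAvg_two_one hs hs1).1 (kerAvg_two_one hs hs1).2
  have h2 := expPoly_mul_le (n₀ := 8) hs (by norm_num) (by norm_num) log_thirteen_mem.2 log_eight_mem.1
    (kerAvg_three_two hs hs1).1 (kerAvg_three_two hs hs1).2
  have h3 := expPoly_mul_le (n₀ := 8) hs (by norm_num) (by norm_num) log_eighteen_mem.2 log_eight_mem.1
    (kerAvg_three_three hs hs1).1 (kerAvg_three_three hs hs1).2
  have h4 := expPoly_mul_le (n₀ := 8) hs (by norm_num) (by norm_num) log_ten_mem.2 log_eight_mem.1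
    (kerAvg_three_one hs hs1).1 (kerAvg_three_one hs hs1).2
  have h4 := expPoly_le_exp (s * 1.386294)
  have h5 : Real.exp (s * 1.386294) ≤ 4 ^ s := by
    rw [Real.rpow_def_of_pos (by norm_num), mul_comm]
    exact Real.exp_le_exp.2 (mul_le_mul_of_nonneg_right log_four_mem.1 hs)
  have e1 : (8 : ℝ) ^ s * 2 ^ (-(2 * s)) = 2 ^ s := by
    rw [show (8 : ℝ) = 2 ^ (2 : ℝ) * 2 by norm_num, Real.mul_rpow (by positivity) (by norm_num),
      ← Real.rpow_mul (by norm_num), mul_right_comm, ← Real.rpow_add (by norm_num)]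
    simp
  have e2 : (8 : ℝ) ^ s = 4 ^ s * 2 ^ s := by
    rw [← Real.mul_rpow (by norm_num) (by norm_num)]; norm_num
  have h0 : 0 ≤ cubic (0.0046) (0.191) (0.042) s := by
    norm_num [cubic]
    nlinarith [mul_nonneg hs (sub_nonneg.2 hs1.le), pow_nonneg hs 2, pow_nonneg hs 3]
  refine ⟨h0, ?_⟩
  set I := kerAvg s (1, 1) with hI
  have hI0 : 0 ≤ I := kerAvg_nonneg _ _
  set J := (2 : ℝ) ^ s * I with hJ
  have hJ0 : 0 ≤ J := by positivity
  have hR : (4 - 1 / 4 * 4 ^ s) * J = ((8 : ℝ) ^ s * kerAvg s (2, 2)) + ((8 : ℝ) ^ s * kerAvg s (2, 1)) + ((8 : ℝ) ^ s * kerAvg s (3, 2)) + 1/4 * ((8 : ℝ) ^ s * kerAvg s (3, 3)) + 1/2 * ((8 : ℝ) ^ s * kerAvg s (3, 1)) := by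
    have e3 : (8 : ℝ) ^ s * I = 4 ^ s * J := by rw [e2, hJ]; ring
    linear_combination (8 : ℝ) ^ s * hr - 4 * I * e1 + 1 / 4 * e3 
  have hpos : 0 < (4 - 1 / 4 * expPoly (s * 1.386294)) := by
    rw [expPoly]
    nlinarith [pow_nonneg hs 2, pow_nonneg hs 3, pow_le_one₀ (n := 2) hs hs1.le, pow_le_one₀ (n := 3) hs hs1.le]
  -- A lower bound for 4^s makes the left factor larger, which is harmless because J ≥ 0, and makes
  -- it polynomial.
  have hle : (4 - 1 / 4 * 4 ^ s) * J ≤ (4 - 1 / 4 * expPoly (s * 1.386294)) * J :=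
    mul_le_mul_of_nonneg_right (by linarith) hJ0
  refine le_of_mul_le_mul_left (le_trans ?_ (hR.symm.le.trans hle)) hpos
  have key : (4 - 1 / 4 * expPoly (s * 1.386294)) * cubic (0.0046) (0.191) (0.042) s ≤
      (expPoly (-(s * (2.079442 - 2.079441))) * cubic (0.0002615) (0.04183) (-0.002) s) +
      (expPoly (-(s * (1.609439 - 2.079441))) * cubic (0.0001755) (0.06539) (-0.005) s) +
      (expPoly (-(s * (2.56495 - 2.079441))) * cubic (0.0000694) (0.02568) (-0.001) s) +
      1/4 * (expPoly (-(s * (2.890373 - 2.079441))) * cubic (0.0000514) (0.01858) (-0.001) s) +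
      1/2 * (expPoly (-(s * (2.302586 - 2.079441))) * cubic (-0.0000472) (0.03296) (-0.001) s) := by
    simp only [expPoly, cubic]
    norm_num only [neg_mul]
    linarith [pow_nonneg hs 2, pow_nonneg hs 3, pow_nonneg hs 4, pow_nonneg hs 5, pow_nonneg hs 6,
      pow_le_pow_of_le_one hs hs1.le (show 2 ≤ 3 by norm_num)]
  linarith
-- The same device around (2,0): the unknown reappears with weight 1/2, and the corners (1,±1)
-- require the preceding bound.
theorem kerAvg_one_zero {s : ℝ} (hs : 0 ≤ s) (hs1 : s < 1) :
    0 ≤ cubic (-0.01307) (0.361) (0.116) s ∧ cubic (-0.01307) (0.361) (0.116) s ≤ 1 ^ s * kerAvg s (1, 0) := by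
  have hp : (1 : ℝ) ^ s = 1 := Real.one_rpow s
  have hr := kerAvg_refine hs hs1 1 0
  norm_num at hr
  rw [kerAvg_neg_right s 2 1, kerAvg_neg_right s 3 1, kerAvg_neg_right s 1 1] at hr
  have h0 := expPoly_mul_le (n₀ := 4) hs (by norm_num) (by norm_num) log_four_mem.2 log_four_mem.1
    (kerAvg_two_zero hs hs1).1 (kerAvg_two_zero hs hs1).2
  have h1 := expPoly_mul_le (n₀ := 4) hs (by norm_num) (by norm_num) log_nine_mem.2 log_four_mem.1
    (kerAvg_three_zero hs hs1).1 (kerAvg_three_zero hs hs1).2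
  have h2 := expPoly_mul_le (n₀ := 4) hs (by norm_num) (by norm_num) log_five_mem.2 log_four_mem.1
    (kerAvg_two_one hs hs1).1 (kerAvg_two_one hs hs1).2
  have h3 := expPoly_mul_le (n₀ := 4) hs (by norm_num) (by norm_num) log_two_mem.2 log_four_mem.1
    (kerAvg_one_one hs hs1).1 (kerAvg_one_one hs hs1).2
  have h4 := expPoly_mul_le (n₀ := 4) hs (by norm_num) (by norm_num) log_ten_mem.2 log_four_mem.1
    (kerAvg_three_one hs hs1).1 (kerAvg_three_one hs hs1).2
  have h4 := expPoly_le_exp (s * 1.386294)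
  have h5 : Real.exp (s * 1.386294) ≤ 4 ^ s := by
    rw [Real.rpow_def_of_pos (by norm_num), mul_comm]
    exact Real.exp_le_exp.2 (mul_le_mul_of_nonneg_right log_four_mem.1 hs)
  have e1 : (4 : ℝ) ^ s * 2 ^ (-(2 * s)) = 1 ^ s := by
    rw [show (4 : ℝ) = 2 ^ (2 : ℝ) * 1 by norm_num, Real.mul_rpow (by positivity) (by norm_num),
      ← Real.rpow_mul (by norm_num), mul_right_comm, ← Real.rpow_add (by norm_num)]
    simp
  have e2 : (4 : ℝ) ^ s = 4 ^ s * 1 ^ s := by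
    rw [← Real.mul_rpow (by norm_num) (by norm_num)]; norm_num
  have h0 : 0 ≤ cubic (-0.01307) (0.361) (0.116) s := by
    norm_num [cubic]
    nlinarith [mul_nonneg hs (sub_nonneg.2 hs1.le), pow_nonneg hs 2, pow_nonneg hs 3]
  refine ⟨h0, ?_⟩
  set I := kerAvg s (1, 0) with hI
  have hI0 : 0 ≤ I := kerAvg_nonneg _ _
  set J := (1 : ℝ) ^ s * I with hJ
  have hJ0 : 0 ≤ J := by positivity
  have hR : (4 - 1 / 2 * 4 ^ s) * J = ((4 : ℝ) ^ s * kerAvg s (2, 0)) + 1/2 * ((4 : ℝ) ^ s * kerAvg s (3, 0)) + ((4 : ℝ) ^ s * kerAvg s (2, 1)) + 1/2 * ((4 : ℝ) ^ s * kerAvg s (1, 1)) + 1/2 * ((4 : ℝ) ^ s * kerAvg s (3, 1)) := by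
    have e3 : (4 : ℝ) ^ s * I = 4 ^ s * J := by rw [hJ, hp, one_mul]
    linear_combination (4 : ℝ) ^ s * hr - 4 * I * e1 + 1 / 2 * e3
  have hpos : 0 < (4 - 1 / 2 * expPoly (s * 1.386294)) := by
    rw [expPoly]
    nlinarith [pow_nonneg hs 2, pow_nonneg hs 3, pow_le_one₀ (n := 2) hs hs1.le, pow_le_one₀ (n := 3) hs hs1.le]
  have hle : (4 - 1 / 2 * 4 ^ s) * J ≤ (4 - 1 / 2 * expPoly (s * 1.386294)) * J :=
    mul_le_mul_of_nonneg_right (by linarith) hJ0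
  refine le_of_mul_le_mul_left (le_trans ?_ (hR.symm.le.trans hle)) hpos
  have key : (4 - 1 / 2 * expPoly (s * 1.386294)) * cubic (-0.01307) (0.361) (0.116) s ≤
      (expPoly (-(s * (1.386295 - 1.386294))) * cubic (-0.0010374) (0.0768) (-0.013) s) +
      1/2 * (expPoly (-(s * (2.197225 - 1.386294))) * cubic (-0.0002051) (0.0362) (-0.001) s) +
      (expPoly (-(s * (1.609439 - 1.386294))) * cubic (0.0001755) (0.06539) (-0.005) s) +
      1/2 * (expPoly (-(s * (0.693148 - 1.386294))) * cubic (0.0046) (0.191) (0.042) s) +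
      1/2 * (expPoly (-(s * (2.302586 - 1.386294))) * cubic (-0.0000472) (0.03296) (-0.001) s) := by
    simp only [expPoly, cubic]
    norm_num only [neg_mul]
    linarith [pow_nonneg hs 2, pow_nonneg hs 3, pow_nonneg hs 4, pow_nonneg hs 5, pow_nonneg hs 6,
      pow_le_pow_of_le_one hs hs1.le (show 2 ≤ 3 by norm_num)]
  linarith
-- Negativity of the weights at the nodes near the origin
/-- Eleven times the negative of the discrete Laplacian with `θ = 7 / 11`, applied to `kerAvg`. -/
def lapAvg (s p q : ℝ) : ℝ :=
  36 * kerAvg s (p, q) -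
    7 * (kerAvg s (p + 1, q) + kerAvg s (p - 1, q) + kerAvg s (p, q + 1) + kerAvg s (p, q - 1)) -
    2 * (kerAvg s (p + 1, q + 1) + kerAvg s (p - 1, q + 1) + kerAvg s (p + 1, q - 1) +
      kerAvg s (p - 1, q - 1))

/-- The centre is bounded above by a cubic, its eight neighbours below by `expPoly_mul_le`, all
normalised by n^s of the centre. The claim becomes a polynomial inequality of degree six in s. The
other nodes follow the same pattern. -/
theorem lapAvg_two_zero {s : ℝ} (hs0 : 1 / 250 ≤ s) (hs1 : s < 1) : lapAvg s 2 0 < 0 := by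
  have hs : 0 ≤ s := by linarith
  have hu := (le_midPoly_add_errPoly (p := 2) (r := 0) (n := 4) (q := 5 / 7) (G := 7 / 2) hs hs1
    (by norm_num) (by norm_num) (by norm_num) (by norm_num) (by norm_num) (by norm_num)).trans
    (show _ ≤ cubic (-0.0010025) (0.09099) (0.048) s by
      norm_num [cubic, midPoly, errPoly, extraPoly, reInvFour, reInvEight]
      nlinarith [pow_nonneg hs 2, pow_nonneg hs 3, pow_le_pow_of_le_one hs hs1.le (show 3 ≤ 4 by norm_num)])
  have h0 := expPoly_mul_le (n₀ := 4) hs (by norm_num) (by norm_num) log_two_mem.2 log_four_mem.1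
    (kerAvg_one_one hs hs1).1 (kerAvg_one_one hs hs1).2
  have h1 := expPoly_mul_le (n₀ := 4) hs (by norm_num) (by norm_num) Real.log_one.le log_four_mem.1
    (kerAvg_one_zero hs hs1).1 (kerAvg_one_zero hs hs1).2
  have h2 := expPoly_mul_le (n₀ := 4) hs (by norm_num) (by norm_num) log_five_mem.2 log_four_mem.1
    (kerAvg_two_one hs hs1).1 (kerAvg_two_one hs hs1).2
  have h3 := expPoly_mul_le (n₀ := 4) hs (by norm_num) (by norm_num) log_ten_mem.2 log_four_mem.1
    (kerAvg_three_one hs hs1).1 (kerAvg_three_one hs hs1).2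
  have h4 := expPoly_mul_le (n₀ := 4) hs (by norm_num) (by norm_num) log_nine_mem.2 log_four_mem.1
    (kerAvg_three_zero hs hs1).1 (kerAvg_three_zero hs hs1).2
  have hn : (0 : ℝ) < 4 ^ s := by positivity
  refine neg_of_mul_neg_right ?_ hn.le
  rw [lapAvg]
  norm_num
  rw [kerAvg_neg_right s 1 1, kerAvg_neg_right s 2 1, kerAvg_neg_right s 3 1]
  -- The constant terms cancel, since 4 + 7 + 14 + 4 + 7 = 36. The linear coefficient is positive
  -- (about 0.025), the quadratic one about -13; the bound s ≥ 1/250 lets the latter win.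
  have key : 36 * cubic (-0.0010025) (0.09099) (0.048) s -
      (4 * (expPoly (-(s * (0.693148 - 1.386294))) * cubic (0.0046) (0.191) (0.042) s) +
      7 * (expPoly (-(s * (0 - 1.386294))) * cubic (-0.01307) (0.361) (0.116) s) +
      14 * (expPoly (-(s * (1.609439 - 1.386294))) * cubic (0.0001755) (0.06539) (-0.005) s) +
      4 * (expPoly (-(s * (2.302586 - 1.386294))) * cubic (-0.0000472) (0.03296) (-0.001) s) +
      7 * (expPoly (-(s * (2.197225 - 1.386294))) * cubic (-0.0002051) (0.0362) (-0.001) s)) < 0 := by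
    simp only [expPoly, cubic]
    linarith only [mul_nonneg hs (sub_nonneg.2 hs0), hs0, pow_nonneg hs 3, pow_nonneg hs 4,
      pow_nonneg hs 5, pow_nonneg hs 6,
      pow_le_pow_of_le_one hs hs1.le (show 5 ≤ 6 by norm_num)]
  linarith
theorem lapAvg_two_one {s : ℝ} (hs0 : 1 / 250 ≤ s) (hs1 : s < 1) : lapAvg s 2 1 < 0 := by
  have hs : 0 ≤ s := by linarith
  have hu := (le_midPoly_add_errPoly (p := 2) (r := 1) (n := 5) (q := 7 / 11) (G := 11 / 4) hs hs1
    (by norm_num) (by norm_num) (by norm_num) (by norm_num) (by norm_num) (by norm_num)).trans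
    (show _ ≤ cubic (0.0001828) (0.07175) (0.019) s by
      norm_num [cubic, midPoly, errPoly, extraPoly, reInvFour, reInvEight]
      nlinarith [pow_nonneg hs 2, pow_nonneg hs 3, pow_le_pow_of_le_one hs hs1.le (show 3 ≤ 4 by norm_num)])
  have h0 := expPoly_mul_le (n₀ := 5) hs (by norm_num) (by norm_num) Real.log_one.le log_five_mem.1
    (kerAvg_one_zero hs hs1).1 (kerAvg_one_zero hs hs1).2
  have h1 := expPoly_mul_le (n₀ := 5) hs (by norm_num) (by norm_num) log_two_mem.2 log_five_mem.1
    (kerAvg_one_one hs hs1).1 (kerAvg_one_one hs hs1).2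
  have h2 := expPoly_mul_le (n₀ := 5) hs (by norm_num) (by norm_num) log_five_mem.2 log_five_mem.1
    (kerAvg_two_one hs hs1).1 (kerAvg_two_one hs hs1).2
  have h3 := expPoly_mul_le (n₀ := 5) hs (by norm_num) (by norm_num) log_four_mem.2 log_five_mem.1
    (kerAvg_two_zero hs hs1).1 (kerAvg_two_zero hs hs1).2
  have h4 := expPoly_mul_le (n₀ := 5) hs (by norm_num) (by norm_num) log_eight_mem.2 log_five_mem.1
    (kerAvg_two_two hs hs1).1 (kerAvg_two_two hs hs1).2
  have h5 := expPoly_mul_le (n₀ := 5) hs (by norm_num) (by norm_num) log_nine_mem.2 log_five_mem.1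
    (kerAvg_three_zero hs hs1).1 (kerAvg_three_zero hs hs1).2
  have h6 := expPoly_mul_le (n₀ := 5) hs (by norm_num) (by norm_num) log_ten_mem.2 log_five_mem.1
    (kerAvg_three_one hs hs1).1 (kerAvg_three_one hs hs1).2
  have h7 := expPoly_mul_le (n₀ := 5) hs (by norm_num) (by norm_num) log_thirteen_mem.2 log_five_mem.1
    (kerAvg_three_two hs hs1).1 (kerAvg_three_two hs hs1).2
  have hn : (0 : ℝ) < 5 ^ s := by positivity
  refine neg_of_mul_neg_right ?_ hn.le
  rw [lapAvg]
  norm_num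
  rw [kerAvg_swap s 2 1]
  have key : 36 * cubic (0.0001828) (0.07175) (0.019) s -
      (2 * (expPoly (-(s * (0 - 1.609437))) * cubic (-0.01307) (0.361) (0.116) s) +
      7 * (expPoly (-(s * (0.693148 - 1.609437))) * cubic (0.0046) (0.191) (0.042) s) +
      2 * (expPoly (-(s * (1.609439 - 1.609437))) * cubic (0.0001755) (0.06539) (-0.005) s) +
      7 * (expPoly (-(s * (1.386295 - 1.609437))) * cubic (-0.0010374) (0.0768) (-0.013) s) +
      7 * (expPoly (-(s * (2.079442 - 1.609437))) * cubic (0.0002615) (0.04183) (-0.002) s) +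
      2 * (expPoly (-(s * (2.197225 - 1.609437))) * cubic (-0.0002051) (0.0362) (-0.001) s) +
      7 * (expPoly (-(s * (2.302586 - 1.609437))) * cubic (-0.0000472) (0.03296) (-0.001) s) +
      2 * (expPoly (-(s * (2.56495 - 1.609437))) * cubic (0.0000694) (0.02568) (-0.001) s)) < 0 := by
    simp only [expPoly, cubic]
    linarith only [mul_nonneg hs (sub_nonneg.2 hs0), hs0, pow_nonneg hs 3, pow_nonneg hs 4,
      pow_nonneg hs 5, pow_nonneg hs 6,
      pow_le_pow_of_le_one hs hs1.le (show 5 ≤ 6 by norm_num)]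
  linarith
theorem lapAvg_two_two {s : ℝ} (hs0 : 1 / 250 ≤ s) (hs1 : s < 1) : lapAvg s 2 2 < 0 := by
  have hs : 0 ≤ s := by linarith
  have hu := (le_midPoly_add_errPoly (p := 2) (r := 2) (n := 8) (q := 7 / 11) (G := 11 / 4) hs hs1
    (by norm_num) (by norm_num) (by norm_num) (by norm_num) (by norm_num) (by norm_num)).trans
    (show _ ≤ cubic (0.000262) (0.04374) (0.006) s by
      norm_num [cubic, midPoly, errPoly, extraPoly, reInvFour, reInvEight]
      nlinarith [pow_nonneg hs 2, pow_nonneg hs 3, pow_le_pow_of_le_one hs hs1.le (show 3 ≤ 4 by norm_num)])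
  have h0 := expPoly_mul_le (n₀ := 8) hs (by norm_num) (by norm_num) log_two_mem.2 log_eight_mem.1
    (kerAvg_one_one hs hs1).1 (kerAvg_one_one hs hs1).2
  have h1 := expPoly_mul_le (n₀ := 8) hs (by norm_num) (by norm_num) log_five_mem.2 log_eight_mem.1
    (kerAvg_two_one hs hs1).1 (kerAvg_two_one hs hs1).2
  have h2 := expPoly_mul_le (n₀ := 8) hs (by norm_num) (by norm_num) log_ten_mem.2 log_eight_mem.1
    (kerAvg_three_one hs hs1).1 (kerAvg_three_one hs hs1).2
  have h3 := expPoly_mul_le (n₀ := 8) hs (by norm_num) (by norm_num) log_thirteen_mem.2 log_eight_mem.1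
    (kerAvg_three_two hs hs1).1 (kerAvg_three_two hs hs1).2
  have h4 := expPoly_mul_le (n₀ := 8) hs (by norm_num) (by norm_num) log_eighteen_mem.2 log_eight_mem.1
    (kerAvg_three_three hs hs1).1 (kerAvg_three_three hs hs1).2
  have hn : (0 : ℝ) < 8 ^ s := by positivity
  refine neg_of_mul_neg_right ?_ hn.le
  rw [lapAvg]
  norm_num
  rw [kerAvg_swap s 2 1, kerAvg_swap s 3 1, kerAvg_swap s 3 2]
  have key : 36 * cubic (0.000262) (0.04374) (0.006) s -
      (2 * (expPoly (-(s * (0.693148 - 2.079441))) * cubic (0.0046) (0.191) (0.042) s) +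
      14 * (expPoly (-(s * (1.609439 - 2.079441))) * cubic (0.0001755) (0.06539) (-0.005) s) +
      4 * (expPoly (-(s * (2.302586 - 2.079441))) * cubic (-0.0000472) (0.03296) (-0.001) s) +
      14 * (expPoly (-(s * (2.56495 - 2.079441))) * cubic (0.0000694) (0.02568) (-0.001) s) +
      2 * (expPoly (-(s * (2.890373 - 2.079441))) * cubic (0.0000514) (0.01858) (-0.001) s)) < 0 := by
    simp only [expPoly, cubic]
    linarith only [mul_nonneg hs (sub_nonneg.2 hs0), hs0, pow_nonneg hs 3, pow_nonneg hs 4,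
      pow_nonneg hs 5, pow_nonneg hs 6,
      pow_le_pow_of_le_one hs hs1.le (show 5 ≤ 6 by norm_num)]
  linarith
theorem lapAvg_three_zero {s : ℝ} (hs0 : 1 / 250 ≤ s) (hs1 : s < 1) : lapAvg s 3 0 < 0 := by
  have hs : 0 ≤ s := by linarith
  have hu := (le_midPoly_add_errPoly (p := 3) (r := 0) (n := 9) (q := 7 / 11) (G := 11 / 4) hs hs1
    (by norm_num) (by norm_num) (by norm_num) (by norm_num) (by norm_num) (by norm_num)).trans
    (show _ ≤ cubic (-0.0002048) (0.03763) (0.004) s by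
      norm_num [cubic, midPoly, errPoly, extraPoly, reInvFour, reInvEight]
      nlinarith [pow_nonneg hs 2, pow_nonneg hs 3, pow_le_pow_of_le_one hs hs1.le (show 3 ≤ 4 by norm_num)])
  have h0 := expPoly_mul_le (n₀ := 9) hs (by norm_num) (by norm_num) log_five_mem.2 log_nine_mem.1
    (kerAvg_two_one hs hs1).1 (kerAvg_two_one hs hs1).2
  have h1 := expPoly_mul_le (n₀ := 9) hs (by norm_num) (by norm_num) log_four_mem.2 log_nine_mem.1
    (kerAvg_two_zero hs hs1).1 (kerAvg_two_zero hs hs1).2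
  have h2 := expPoly_mul_le (n₀ := 9) hs (by norm_num) (by norm_num) log_ten_mem.2 log_nine_mem.1
    (kerAvg_three_one hs hs1).1 (kerAvg_three_one hs hs1).2
  have h3 := expPoly_mul_le (n₀ := 9) hs (by norm_num) (by norm_num) log_seventeen_mem.2 log_nine_mem.1
    (kerAvg_four_one hs hs1).1 (kerAvg_four_one hs hs1).2
  have h4 := expPoly_mul_le (n₀ := 9) hs (by norm_num) (by norm_num) log_sixteen_mem.2 log_nine_mem.1
    (kerAvg_four_zero hs hs1).1 (kerAvg_four_zero hs hs1).2
  have hn : (0 : ℝ) < 9 ^ s := by positivity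
  refine neg_of_mul_neg_right ?_ hn.le
  rw [lapAvg]
  norm_num
  rw [kerAvg_neg_right s 2 1, kerAvg_neg_right s 3 1, kerAvg_neg_right s 4 1]
  have key : 36 * cubic (-0.0002048) (0.03763) (0.004) s -
      (4 * (expPoly (-(s * (1.609439 - 2.197224))) * cubic (0.0001755) (0.06539) (-0.005) s) +
      7 * (expPoly (-(s * (1.386295 - 2.197224))) * cubic (-0.0010374) (0.0768) (-0.013) s) +
      14 * (expPoly (-(s * (2.302586 - 2.197224))) * cubic (-0.0000472) (0.03296) (-0.001) s) +
      4 * (expPoly (-(s * (2.833214 - 2.197224))) * cubic (-0.0000322) (0.01946) (-0.001) s) +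
      7 * (expPoly (-(s * (2.77259 - 2.197224))) * cubic (-0.0000651) (0.0206) (-0.001) s)) < 0 := by
    simp only [expPoly, cubic]
    linarith only [mul_nonneg hs (sub_nonneg.2 hs0), hs0, pow_nonneg hs 3, pow_nonneg hs 4,
      pow_nonneg hs 5, pow_nonneg hs 6,
      pow_le_pow_of_le_one hs hs1.le (show 5 ≤ 6 by norm_num)]
  linarith
theorem lapAvg_three_one {s : ℝ} (hs0 : 1 / 250 ≤ s) (hs1 : s < 1) : lapAvg s 3 1 < 0 := by
  have hs : 0 ≤ s := by linarith
  have hu := (le_midPoly_add_errPoly (p := 3) (r := 1) (n := 10) (q := 7 / 11) (G := 11 / 4) hs hs1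
    (by norm_num) (by norm_num) (by norm_num) (by norm_num) (by norm_num) (by norm_num)).trans
    (show _ ≤ cubic (-0.000047) (0.03407) (0.004) s by
      norm_num [cubic, midPoly, errPoly, extraPoly, reInvFour, reInvEight]
      nlinarith [pow_nonneg hs 2, pow_nonneg hs 3, pow_le_pow_of_le_one hs hs1.le (show 3 ≤ 4 by norm_num)])
  have h0 := expPoly_mul_le (n₀ := 10) hs (by norm_num) (by norm_num) log_four_mem.2 log_ten_mem.1
    (kerAvg_two_zero hs hs1).1 (kerAvg_two_zero hs hs1).2
  have h1 := expPoly_mul_le (n₀ := 10) hs (by norm_num) (by norm_num) log_five_mem.2 log_ten_mem.1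
    (kerAvg_two_one hs hs1).1 (kerAvg_two_one hs hs1).2
  have h2 := expPoly_mul_le (n₀ := 10) hs (by norm_num) (by norm_num) log_eight_mem.2 log_ten_mem.1
    (kerAvg_two_two hs hs1).1 (kerAvg_two_two hs hs1).2
  have h3 := expPoly_mul_le (n₀ := 10) hs (by norm_num) (by norm_num) log_nine_mem.2 log_ten_mem.1
    (kerAvg_three_zero hs hs1).1 (kerAvg_three_zero hs hs1).2
  have h4 := expPoly_mul_le (n₀ := 10) hs (by norm_num) (by norm_num) log_thirteen_mem.2 log_ten_mem.1
    (kerAvg_three_two hs hs1).1 (kerAvg_three_two hs hs1).2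
  have h5 := expPoly_mul_le (n₀ := 10) hs (by norm_num) (by norm_num) log_sixteen_mem.2 log_ten_mem.1
    (kerAvg_four_zero hs hs1).1 (kerAvg_four_zero hs hs1).2
  have h6 := expPoly_mul_le (n₀ := 10) hs (by norm_num) (by norm_num) log_seventeen_mem.2 log_ten_mem.1
    (kerAvg_four_one hs hs1).1 (kerAvg_four_one hs hs1).2
  have h7 := expPoly_mul_le (n₀ := 10) hs (by norm_num) (by norm_num) log_twenty_mem.2 log_ten_mem.1
    (kerAvg_four_two hs hs1).1 (kerAvg_four_two hs hs1).2
  have hn : (0 : ℝ) < 10 ^ s := by positivity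
  refine neg_of_mul_neg_right ?_ hn.le
  rw [lapAvg]
  norm_num
  have key : 36 * cubic (-0.000047) (0.03407) (0.004) s -
      (2 * (expPoly (-(s * (1.386295 - 2.302584))) * cubic (-0.0010374) (0.0768) (-0.013) s) +
      7 * (expPoly (-(s * (1.609439 - 2.302584))) * cubic (0.0001755) (0.06539) (-0.005) s) +
      2 * (expPoly (-(s * (2.079442 - 2.302584))) * cubic (0.0002615) (0.04183) (-0.002) s) +
      7 * (expPoly (-(s * (2.197225 - 2.302584))) * cubic (-0.0002051) (0.0362) (-0.001) s) +
      7 * (expPoly (-(s * (2.56495 - 2.302584))) * cubic (0.0000694) (0.02568) (-0.001) s) +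
      2 * (expPoly (-(s * (2.77259 - 2.302584))) * cubic (-0.0000651) (0.0206) (-0.001) s) +
      7 * (expPoly (-(s * (2.833214 - 2.302584))) * cubic (-0.0000322) (0.01946) (-0.001) s) +
      2 * (expPoly (-(s * (2.995733 - 2.302584))) * cubic (0.0000116) (0.01665) (-0.001) s)) < 0 := by
    simp only [expPoly, cubic]
    linarith only [mul_nonneg hs (sub_nonneg.2 hs0), hs0, pow_nonneg hs 3, pow_nonneg hs 4,
      pow_nonneg hs 5, pow_nonneg hs 6,
      pow_le_pow_of_le_one hs hs1.le (show 5 ≤ 6 by norm_num)]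
  linarith
theorem lapAvg_three_two {s : ℝ} (hs0 : 1 / 250 ≤ s) (hs1 : s < 1) : lapAvg s 3 2 < 0 := by
  have hs : 0 ≤ s := by linarith
  have hu := (le_midPoly_add_errPoly (p := 3) (r := 2) (n := 13) (q := 7 / 11) (G := 11 / 4) hs hs1
    (by norm_num) (by norm_num) (by norm_num) (by norm_num) (by norm_num) (by norm_num)).trans
    (show _ ≤ cubic (0.0000695) (0.02628) (0.002) s by
      norm_num [cubic, midPoly, errPoly, extraPoly, reInvFour, reInvEight]
      nlinarith [pow_nonneg hs 2, pow_nonneg hs 3, pow_le_pow_of_le_one hs hs1.le (show 3 ≤ 4 by norm_num)])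
  have h0 := expPoly_mul_le (n₀ := 13) hs (by norm_num) (by norm_num) log_five_mem.2 log_thirteen_mem.1
    (kerAvg_two_one hs hs1).1 (kerAvg_two_one hs hs1).2
  have h1 := expPoly_mul_le (n₀ := 13) hs (by norm_num) (by norm_num) log_eight_mem.2 log_thirteen_mem.1
    (kerAvg_two_two hs hs1).1 (kerAvg_two_two hs hs1).2
  have h2 := expPoly_mul_le (n₀ := 13) hs (by norm_num) (by norm_num) log_thirteen_mem.2 log_thirteen_mem.1
    (kerAvg_three_two hs hs1).1 (kerAvg_three_two hs hs1).2
  have h3 := expPoly_mul_le (n₀ := 13) hs (by norm_num) (by norm_num) log_ten_mem.2 log_thirteen_mem.1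
    (kerAvg_three_one hs hs1).1 (kerAvg_three_one hs hs1).2
  have h4 := expPoly_mul_le (n₀ := 13) hs (by norm_num) (by norm_num) log_eighteen_mem.2 log_thirteen_mem.1
    (kerAvg_three_three hs hs1).1 (kerAvg_three_three hs hs1).2
  have h5 := expPoly_mul_le (n₀ := 13) hs (by norm_num) (by norm_num) log_seventeen_mem.2 log_thirteen_mem.1
    (kerAvg_four_one hs hs1).1 (kerAvg_four_one hs hs1).2
  have h6 := expPoly_mul_le (n₀ := 13) hs (by norm_num) (by norm_num) log_twenty_mem.2 log_thirteen_mem.1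
    (kerAvg_four_two hs hs1).1 (kerAvg_four_two hs hs1).2
  have h7 := expPoly_mul_le (n₀ := 13) hs (by norm_num) (by norm_num) log_twentyfive_mem.2 log_thirteen_mem.1
    (kerAvg_four_three hs hs1).1 (kerAvg_four_three hs hs1).2
  have hn : (0 : ℝ) < 13 ^ s := by positivity
  refine neg_of_mul_neg_right ?_ hn.le
  rw [lapAvg]
  norm_num
  rw [kerAvg_swap s 3 2]
  have key : 36 * cubic (0.0000695) (0.02628) (0.002) s -
      (2 * (expPoly (-(s * (1.609439 - 2.564949))) * cubic (0.0001755) (0.06539) (-0.005) s) +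
      7 * (expPoly (-(s * (2.079442 - 2.564949))) * cubic (0.0002615) (0.04183) (-0.002) s) +
      2 * (expPoly (-(s * (2.56495 - 2.564949))) * cubic (0.0000694) (0.02568) (-0.001) s) +
      7 * (expPoly (-(s * (2.302586 - 2.564949))) * cubic (-0.0000472) (0.03296) (-0.001) s) +
      7 * (expPoly (-(s * (2.890373 - 2.564949))) * cubic (0.0000514) (0.01858) (-0.001) s) +
      2 * (expPoly (-(s * (2.833214 - 2.564949))) * cubic (-0.0000322) (0.01946) (-0.001) s) +
      7 * (expPoly (-(s * (2.995733 - 2.564949))) * cubic (0.0000116) (0.01665) (-0.001) s) +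
      2 * (expPoly (-(s * (3.218877 - 2.564949))) * cubic (0.0000224) (0.01336) (-0.001) s)) < 0 := by
    simp only [expPoly, cubic]
    linarith only [mul_nonneg hs (sub_nonneg.2 hs0), hs0, pow_nonneg hs 3, pow_nonneg hs 4,
      pow_nonneg hs 5, pow_nonneg hs 6,
      pow_le_pow_of_le_one hs hs1.le (show 5 ≤ 6 by norm_num)]
  linarith
theorem lapAvg_three_three {s : ℝ} (hs0 : 1 / 250 ≤ s) (hs1 : s < 1) : lapAvg s 3 3 < 0 := by
  have hs : 0 ≤ s := by linarith
  have hu := (le_midPoly_add_errPoly (p := 3) (r := 3) (n := 18) (q := 7 / 11) (G := 11 / 4) hs hs1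
    (by norm_num) (by norm_num) (by norm_num) (by norm_num) (by norm_num) (by norm_num)).trans
    (show _ ≤ cubic (0.0000515) (0.01887) (0.001) s by
      norm_num [cubic, midPoly, errPoly, extraPoly, reInvFour, reInvEight]
      nlinarith [pow_nonneg hs 2, pow_nonneg hs 3, pow_le_pow_of_le_one hs hs1.le (show 3 ≤ 4 by norm_num)])
  have h0 := expPoly_mul_le (n₀ := 18) hs (by norm_num) (by norm_num) log_eight_mem.2 log_eighteen_mem.1
    (kerAvg_two_two hs hs1).1 (kerAvg_two_two hs hs1).2
  have h1 := expPoly_mul_le (n₀ := 18) hs (by norm_num) (by norm_num) log_thirteen_mem.2 log_eighteen_mem.1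
    (kerAvg_three_two hs hs1).1 (kerAvg_three_two hs hs1).2
  have h2 := expPoly_mul_le (n₀ := 18) hs (by norm_num) (by norm_num) log_twenty_mem.2 log_eighteen_mem.1
    (kerAvg_four_two hs hs1).1 (kerAvg_four_two hs hs1).2
  have h3 := expPoly_mul_le (n₀ := 18) hs (by norm_num) (by norm_num) log_twentyfive_mem.2 log_eighteen_mem.1
    (kerAvg_four_three hs hs1).1 (kerAvg_four_three hs hs1).2
  have h4 := expPoly_mul_le (n₀ := 18) hs (by norm_num) (by norm_num) log_thirtytwo_mem.2 log_eighteen_mem.1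
    (kerAvg_four_four hs hs1).1 (kerAvg_four_four hs hs1).2
  have hn : (0 : ℝ) < 18 ^ s := by positivity
  refine neg_of_mul_neg_right ?_ hn.le
  rw [lapAvg]
  norm_num
  rw [kerAvg_swap s 3 2, kerAvg_swap s 4 2, kerAvg_swap s 4 3]
  have key : 36 * cubic (0.0000515) (0.01887) (0.001) s -
      (2 * (expPoly (-(s * (2.079442 - 2.890371))) * cubic (0.0002615) (0.04183) (-0.002) s) +
      14 * (expPoly (-(s * (2.56495 - 2.890371))) * cubic (0.0000694) (0.02568) (-0.001) s) +
      4 * (expPoly (-(s * (2.995733 - 2.890371))) * cubic (0.0000116) (0.01665) (-0.001) s) +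
      14 * (expPoly (-(s * (3.218877 - 2.890371))) * cubic (0.0000224) (0.01336) (-0.001) s) +
      2 * (expPoly (-(s * (3.465737 - 2.890371))) * cubic (0.0000162) (0.01044) (-0.001) s)) < 0 := by
    simp only [expPoly, cubic]
    linarith only [mul_nonneg hs (sub_nonneg.2 hs0), hs0, pow_nonneg hs 3, pow_nonneg hs 4,
      pow_nonneg hs 5, pow_nonneg hs 6,
      pow_le_pow_of_le_one hs hs1.le (show 5 ≤ 6 by norm_num)]
  linarith
theorem lapAvg_four_zero {s : ℝ} (hs0 : 1 / 250 ≤ s) (hs1 : s < 1) : lapAvg s 4 0 < 0 := by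
  have hs : 0 ≤ s := by linarith
  have hu := (le_midPoly_add_errPoly (p := 4) (r := 0) (n := 16) (q := 7 / 11) (G := 11 / 4) hs hs1
    (by norm_num) (by norm_num) (by norm_num) (by norm_num) (by norm_num) (by norm_num)).trans
    (show _ ≤ cubic (-0.000065) (0.02097) (0.001) s by
      norm_num [cubic, midPoly, errPoly, extraPoly, reInvFour, reInvEight]
      nlinarith [pow_nonneg hs 2, pow_nonneg hs 3, pow_le_pow_of_le_one hs hs1.le (show 3 ≤ 4 by norm_num)])
  have h0 := expPoly_mul_le (n₀ := 16) hs (by norm_num) (by norm_num) log_ten_mem.2 log_sixteen_mem.1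
    (kerAvg_three_one hs hs1).1 (kerAvg_three_one hs hs1).2
  have h1 := expPoly_mul_le (n₀ := 16) hs (by norm_num) (by norm_num) log_nine_mem.2 log_sixteen_mem.1
    (kerAvg_three_zero hs hs1).1 (kerAvg_three_zero hs hs1).2
  have h2 := expPoly_mul_le (n₀ := 16) hs (by norm_num) (by norm_num) log_seventeen_mem.2 log_sixteen_mem.1
    (kerAvg_four_one hs hs1).1 (kerAvg_four_one hs hs1).2
  have h3 := expPoly_mul_le (n₀ := 16) hs (by norm_num) (by norm_num) log_twentysix_mem.2 log_sixteen_mem.1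
    (kerAvg_five_one hs hs1).1 (kerAvg_five_one hs hs1).2
  have h4 := expPoly_mul_le (n₀ := 16) hs (by norm_num) (by norm_num) log_twentyfive_mem.2 log_sixteen_mem.1
    (kerAvg_five_zero hs hs1).1 (kerAvg_five_zero hs hs1).2
  have hn : (0 : ℝ) < 16 ^ s := by positivity
  refine neg_of_mul_neg_right ?_ hn.le
  rw [lapAvg]
  norm_num
  rw [kerAvg_neg_right s 3 1, kerAvg_neg_right s 4 1, kerAvg_neg_right s 5 1]
  have key : 36 * cubic (-0.000065) (0.02097) (0.001) s -
      (4 * (expPoly (-(s * (2.302586 - 2.772588))) * cubic (-0.0000472) (0.03296) (-0.001) s) +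
      7 * (expPoly (-(s * (2.197225 - 2.772588))) * cubic (-0.0002051) (0.0362) (-0.001) s) +
      14 * (expPoly (-(s * (2.833214 - 2.772588))) * cubic (-0.0000322) (0.01946) (-0.001) s) +
      4 * (expPoly (-(s * (3.258097 - 2.772588))) * cubic (-0.0000174) (0.01275) (-0.001) s) +
      7 * (expPoly (-(s * (3.218877 - 2.772588))) * cubic (-0.0000267) (0.01324) (-0.001) s)) < 0 := by
    simp only [expPoly, cubic]
    linarith only [mul_nonneg hs (sub_nonneg.2 hs0), hs0, pow_nonneg hs 3, pow_nonneg hs 4,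
      pow_nonneg hs 5, pow_nonneg hs 6,
      pow_le_pow_of_le_one hs hs1.le (show 5 ≤ 6 by norm_num)]
  linarith
theorem lapAvg_four_one {s : ℝ} (hs0 : 1 / 250 ≤ s) (hs1 : s < 1) : lapAvg s 4 1 < 0 := by
  have hs : 0 ≤ s := by linarith
  have hu := (le_midPoly_add_errPoly (p := 4) (r := 1) (n := 17) (q := 7 / 11) (G := 11 / 4) hs hs1
    (by norm_num) (by norm_num) (by norm_num) (by norm_num) (by norm_num) (by norm_num)).trans
    (show _ ≤ cubic (-0.0000321) (0.01979) (0.001) s by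
      norm_num [cubic, midPoly, errPoly, extraPoly, reInvFour, reInvEight]
      nlinarith [pow_nonneg hs 2, pow_nonneg hs 3, pow_le_pow_of_le_one hs hs1.le (show 3 ≤ 4 by norm_num)])
  have h0 := expPoly_mul_le (n₀ := 17) hs (by norm_num) (by norm_num) log_nine_mem.2 log_seventeen_mem.1
    (kerAvg_three_zero hs hs1).1 (kerAvg_three_zero hs hs1).2
  have h1 := expPoly_mul_le (n₀ := 17) hs (by norm_num) (by norm_num) log_ten_mem.2 log_seventeen_mem.1
    (kerAvg_three_one hs hs1).1 (kerAvg_three_one hs hs1).2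
  have h2 := expPoly_mul_le (n₀ := 17) hs (by norm_num) (by norm_num) log_thirteen_mem.2 log_seventeen_mem.1
    (kerAvg_three_two hs hs1).1 (kerAvg_three_two hs hs1).2
  have h3 := expPoly_mul_le (n₀ := 17) hs (by norm_num) (by norm_num) log_sixteen_mem.2 log_seventeen_mem.1
    (kerAvg_four_zero hs hs1).1 (kerAvg_four_zero hs hs1).2
  have h4 := expPoly_mul_le (n₀ := 17) hs (by norm_num) (by norm_num) log_twenty_mem.2 log_seventeen_mem.1
    (kerAvg_four_two hs hs1).1 (kerAvg_four_two hs hs1).2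
  have h5 := expPoly_mul_le (n₀ := 17) hs (by norm_num) (by norm_num) log_twentyfive_mem.2 log_seventeen_mem.1
    (kerAvg_five_zero hs hs1).1 (kerAvg_five_zero hs hs1).2
  have h6 := expPoly_mul_le (n₀ := 17) hs (by norm_num) (by norm_num) log_twentysix_mem.2 log_seventeen_mem.1
    (kerAvg_five_one hs hs1).1 (kerAvg_five_one hs hs1).2
  have h7 := expPoly_mul_le (n₀ := 17) hs (by norm_num) (by norm_num) log_twentynine_mem.2 log_seventeen_mem.1
    (kerAvg_five_two hs hs1).1 (kerAvg_five_two hs hs1).2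
  have hn : (0 : ℝ) < 17 ^ s := by positivity
  refine neg_of_mul_neg_right ?_ hn.le
  rw [lapAvg]
  norm_num
  have key : 36 * cubic (-0.0000321) (0.01979) (0.001) s -
      (2 * (expPoly (-(s * (2.197225 - 2.833213))) * cubic (-0.0002051) (0.0362) (-0.001) s) +
      7 * (expPoly (-(s * (2.302586 - 2.833213))) * cubic (-0.0000472) (0.03296) (-0.001) s) +
      2 * (expPoly (-(s * (2.56495 - 2.833213))) * cubic (0.0000694) (0.02568) (-0.001) s) +
      7 * (expPoly (-(s * (2.77259 - 2.833213))) * cubic (-0.0000651) (0.0206) (-0.001) s) +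
      7 * (expPoly (-(s * (2.995733 - 2.833213))) * cubic (0.0000116) (0.01665) (-0.001) s) +
      2 * (expPoly (-(s * (3.218877 - 2.833213))) * cubic (-0.0000267) (0.01324) (-0.001) s) +
      7 * (expPoly (-(s * (3.258097 - 2.833213))) * cubic (-0.0000174) (0.01275) (-0.001) s) +
      2 * (expPoly (-(s * (3.367297 - 2.833213))) * cubic (-0.000001) (0.01147) (-0.001) s)) < 0 := by
    simp only [expPoly, cubic]
    linarith only [mul_nonneg hs (sub_nonneg.2 hs0), hs0, pow_nonneg hs 3, pow_nonneg hs 4,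
      pow_nonneg hs 5, pow_nonneg hs 6,
      pow_le_pow_of_le_one hs hs1.le (show 5 ≤ 6 by norm_num)]
  linarith
theorem lapAvg_four_two {s : ℝ} (hs0 : 1 / 250 ≤ s) (hs1 : s < 1) : lapAvg s 4 2 < 0 := by
  have hs : 0 ≤ s := by linarith
  have hu := (le_midPoly_add_errPoly (p := 4) (r := 2) (n := 20) (q := 7 / 11) (G := 11 / 4) hs hs1
    (by norm_num) (by norm_num) (by norm_num) (by norm_num) (by norm_num) (by norm_num)).trans
    (show _ ≤ cubic (0.0000117) (0.01688) (0.001) s by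
      norm_num [cubic, midPoly, errPoly, extraPoly, reInvFour, reInvEight]
      nlinarith [pow_nonneg hs 2, pow_nonneg hs 3, pow_le_pow_of_le_one hs hs1.le (show 3 ≤ 4 by norm_num)])
  have h0 := expPoly_mul_le (n₀ := 20) hs (by norm_num) (by norm_num) log_ten_mem.2 log_twenty_mem.1
    (kerAvg_three_one hs hs1).1 (kerAvg_three_one hs hs1).2
  have h1 := expPoly_mul_le (n₀ := 20) hs (by norm_num) (by norm_num) log_thirteen_mem.2 log_twenty_mem.1
    (kerAvg_three_two hs hs1).1 (kerAvg_three_two hs hs1).2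
  have h2 := expPoly_mul_le (n₀ := 20) hs (by norm_num) (by norm_num) log_eighteen_mem.2 log_twenty_mem.1
    (kerAvg_three_three hs hs1).1 (kerAvg_three_three hs hs1).2
  have h3 := expPoly_mul_le (n₀ := 20) hs (by norm_num) (by norm_num) log_seventeen_mem.2 log_twenty_mem.1
    (kerAvg_four_one hs hs1).1 (kerAvg_four_one hs hs1).2
  have h4 := expPoly_mul_le (n₀ := 20) hs (by norm_num) (by norm_num) log_twentyfive_mem.2 log_twenty_mem.1
    (kerAvg_four_three hs hs1).1 (kerAvg_four_three hs hs1).2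
  have h5 := expPoly_mul_le (n₀ := 20) hs (by norm_num) (by norm_num) log_twentysix_mem.2 log_twenty_mem.1
    (kerAvg_five_one hs hs1).1 (kerAvg_five_one hs hs1).2
  have h6 := expPoly_mul_le (n₀ := 20) hs (by norm_num) (by norm_num) log_twentynine_mem.2 log_twenty_mem.1
    (kerAvg_five_two hs hs1).1 (kerAvg_five_two hs hs1).2
  have h7 := expPoly_mul_le (n₀ := 20) hs (by norm_num) (by norm_num) log_thirtyfour_mem.2 log_twenty_mem.1
    (kerAvg_five_three hs hs1).1 (kerAvg_five_three hs hs1).2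
  have hn : (0 : ℝ) < 20 ^ s := by positivity
  refine neg_of_mul_neg_right ?_ hn.le
  rw [lapAvg]
  norm_num
  have key : 36 * cubic (0.0000117) (0.01688) (0.001) s -
      (2 * (expPoly (-(s * (2.302586 - 2.995731))) * cubic (-0.0000472) (0.03296) (-0.001) s) +
      7 * (expPoly (-(s * (2.56495 - 2.995731))) * cubic (0.0000694) (0.02568) (-0.001) s) +
      2 * (expPoly (-(s * (2.890373 - 2.995731))) * cubic (0.0000514) (0.01858) (-0.001) s) +
      7 * (expPoly (-(s * (2.833214 - 2.995731))) * cubic (-0.0000322) (0.01946) (-0.001) s) +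
      7 * (expPoly (-(s * (3.218877 - 2.995731))) * cubic (0.0000224) (0.01336) (-0.001) s) +
      2 * (expPoly (-(s * (3.258097 - 2.995731))) * cubic (-0.0000174) (0.01275) (-0.001) s) +
      7 * (expPoly (-(s * (3.367297 - 2.995731))) * cubic (-0.000001) (0.01147) (-0.001) s) +
      2 * (expPoly (-(s * (3.526361 - 2.995731))) * cubic (0.000008) (0.00981) (-0.001) s)) < 0 := by
    simp only [expPoly, cubic]
    linarith only [mul_nonneg hs (sub_nonneg.2 hs0), hs0, pow_nonneg hs 3, pow_nonneg hs 4,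
      pow_nonneg hs 5, pow_nonneg hs 6,
      pow_le_pow_of_le_one hs hs1.le (show 5 ≤ 6 by norm_num)]
  linarith

/-! ### Negativity of the weights far from the origin -/

/-- The nine points of the stencil. -/
def stOff : Fin 9 → ℝ × ℝ :=
  ![(0, 0), (1, 0), (-1, 0), (0, 1), (0, -1), (1, 1), (-1, 1), (1, -1), (-1, -1)]

theorem norm_stOff_le (i : Fin 9) : ‖stOff i‖ ≤ 1 := by
  fin_cases i <;> norm_num [stOff, Prod.norm_def]

/-- A combination of the nine hat functions centred at the points of the stencil. -/
def stWeight (c : Fin 9 → ℝ) (z : ℝ × ℝ) : ℝ := ∑ i, c i * hat 1 (z - stOff i)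

theorem continuous_stWeight (c : Fin 9 → ℝ) : Continuous (stWeight c) := by
  have := continuous_hat one_pos
  unfold stWeight; fun_prop

theorem stWeight_eq_zero (c : Fin 9 → ℝ) {z : ℝ × ℝ} (hz : z ∉ square 2) : stWeight c z = 0 := by
  refine Finset.sum_eq_zero fun i _ => ?_
  rw [hat_eq_zero, mul_zero]
  rw [mem_square, not_le] at hz ⊢
  have := norm_sub_norm_le z (stOff i)
  have := norm_stOff_le i
  linarith

theorem integral_mul_stWeight (c : Fin 9 → ℝ) {f : ℝ × ℝ → ℝ}
    (hf : ∀ i, Integrable fun z => f z * hat 1 (z - stOff i)) :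
    ∫ z, f z * stWeight c z = ∑ i, c i * ∫ z, f z * hat 1 (z - stOff i) := by
  have e : ∀ z, f z * stWeight c z = ∑ i, c i * (f z * hat 1 (z - stOff i)) := by
    intro z
    rw [stWeight, Finset.mul_sum]
    exact Finset.sum_congr rfl fun i _ => by ring
  simp only [e]
  rw [integral_finsetSum _ fun i _ => (hf i).const_mul _]
  exact Finset.sum_congr rfl fun i _ => integral_const_mul _ _

theorem integrable_mul_hat_sub {f : ℝ × ℝ → ℝ} (hf : Continuous f) (v : ℝ × ℝ) :
    Integrable fun z => f z * hat 1 (z - v) := by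
  have h := (isSymmWeight_hat.integrable (f := fun z => f (z + v)) (by fun_prop)).comp_sub_right v
  simpa using h

/-- Translation moves the stencil from the weight to the integrand; for a polynomial integrand only
the known moments of the hat remain. -/
theorem integral_mul_stWeight_of_continuous (c : Fin 9 → ℝ) {f : ℝ × ℝ → ℝ} (hf : Continuous f) :
    ∫ z, f z * stWeight c z = ∫ z, (∑ i, c i * f (z + stOff i)) * hat 1 z := by
  rw [integral_mul_stWeight c fun i => integrable_mul_hat_sub hf _]
  have e : ∀ z, (∑ i, c i * f (z + stOff i)) * hat 1 z =
      ∑ i, c i * (f (z + stOff i) * hat 1 z) := by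
    intro z
    rw [Finset.sum_mul]
    exact Finset.sum_congr rfl fun i _ => by ring
  simp only [e]
  rw [integral_finsetSum _ fun i _ =>
    (isSymmWeight_hat.integrable (f := fun z => f (z + stOff i)) (by fun_prop)).const_mul _]
  refine Finset.sum_congr rfl fun i _ => ?_
  rw [integral_const_mul]
  congr 1
  have h := integral_sub_right_eq_self (μ := volume)
    (fun z : ℝ × ℝ => f (z + stOff i) * hat 1 z) (stOff i)
  simp only [sub_add_cancel] at h
  exact h

/-- The coefficients of `11 A` for the discretization `A` of `-Δ` with `θ = 7 / 11`. -/
def lapCoef : Fin 9 → ℝ := ![36, -7, -7, -7, -7, -2, -2, -2, -2]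

theorem isSymmWeight_lap : IsSymmWeight (stWeight lapCoef) 2 where
  cont := continuous_stWeight _
  eq_zero := fun z hz => stWeight_eq_zero _ hz
  rot := fun z => by
    have t1 : tent (-z.2 + 1) = tent (z.2 - 1) := by rw [← tent_neg]; congr 1; ring
    have t2 : tent (-z.2 - 1) = tent (z.2 + 1) := by rw [← tent_neg]; congr 1; ring
    simp [stWeight, stOff, lapCoef, Fin.sum_univ_succ, hat_one, rot_apply, t1, t2, tent_neg]
    ring
  refl := fun z => by
    have t1 : tent (-z.2 + 1) = tent (z.2 - 1) := by rw [← tent_neg]; congr 1; ring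
    have t2 : tent (-z.2 - 1) = tent (z.2 + 1) := by rw [← tent_neg]; congr 1; ring
    simp [stWeight, stOff, lapCoef, Fin.sum_univ_succ, hat_one, refl2_apply, t1, t2, tent_neg]
    ring

theorem abs_stWeight_le (c : Fin 9 → ℝ) (z : ℝ × ℝ) :
    |stWeight c z| ≤ stWeight (fun i => |c i|) z := by
  refine (Finset.abs_sum_le_sum_abs _ _).trans (le_of_eq ?_)
  refine Finset.sum_congr rfl fun i _ => ?_
  rw [abs_mul, abs_of_nonneg (hat_nonneg one_pos _)]

/-- The stencil value is one integral of the kernel against a signed weight with square symmetry.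
Expanding it as a whole preserves the cancellation between the nine nodes. -/
theorem integral_ker_mul_stWeight {s : ℝ} (hs : 0 ≤ s) (hs1 : s < 1) (p q : ℝ) :
    ∫ z, ker s ((p, q) + z) * stWeight lapCoef z = lapAvg s p q := by
  rw [integral_mul_stWeight lapCoef fun i => integrable_ker_mul_hat hs hs1 _ _]
  simp only [← kerAvg_add]
  simp [Fin.sum_univ_succ, lapCoef, stOff, lapAvg, ← sub_eq_add_neg]
  ring

theorem integral_stWeight : ∫ z, stWeight lapCoef z = 0 := by
  have h := integral_mul_stWeight_of_continuous lapCoef (f := fun _ => (1 : ℝ)) continuous_const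
  simp only [one_mul] at h
  have h0 : ∑ i, lapCoef i * 1 = 0 := by
    simp [Fin.sum_univ_succ, lapCoef]; norm_num
  simp only [h, h0, zero_mul, integral_zero]

/-- The value is 11 times -Δ|z|² = -4, as the discretization is exact on quadratics. It yields the
decisive negative term. -/
theorem integral_sq_stWeight : ∫ z, euclidNorm z ^ 2 * stWeight lapCoef z = -44 := by
  rw [integral_mul_stWeight_of_continuous lapCoef (by fun_prop),
    integral_poly_hat (Finset.univ : Finset (Fin 1)) ![-44] ![0] ![0]]
  · norm_num [tentMoment]
  · intro z
    simp [Fin.sum_univ_succ, lapCoef, stOff, euclidNorm_sq]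
    ring

/-- For general θ this moment is 88 - 132θ. It vanishes for the isotropic choice θ = 2/3 and is
small at 7/11; it multiplies the unfavourable term of first order in s. -/
theorem integral_re_pow_four_stWeight :
    ∫ z, (toC z ^ 4).re * stWeight lapCoef z = 4 := by
  have e : ∀ z : ℝ × ℝ, (toC z ^ 4).re = z.1 ^ 4 - 6 * z.1 ^ 2 * z.2 ^ 2 + z.2 ^ 4 := by
    intro z
    simp only [pow_succ, pow_zero, one_mul, Complex.mul_re, Complex.mul_im, toC]
    ring
  rw [integral_mul_stWeight_of_continuous lapCoef (by fun_prop),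
    integral_poly_hat (Finset.univ : Finset (Fin 1)) ![4] ![0] ![0]]
  · norm_num [tentMoment]
  · intro z
    simp only [e]
    simp [Fin.sum_univ_succ, lapCoef, stOff]
    ring

theorem integral_pow_four_stWeight :
    ∫ z, euclidNorm z ^ 4 * stWeight (fun i => |lapCoef i|) z = 1984 / 15 := by
  have e : ∀ z, euclidNorm z ^ 4 = (z.1 ^ 2 + z.2 ^ 2) ^ 2 := fun z => by
    rw [← euclidNorm_sq]; ring
  rw [integral_mul_stWeight_of_continuous _ (by fun_prop),
    integral_poly_hat (Finset.univ : Finset (Fin 6)) ![60, 176, 72, 176, 144, 72]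
      ![0, 0, 0, 1, 1, 2] ![0, 1, 2, 0, 1, 0]]
  · norm_num [Fin.sum_univ_succ, tentMoment]
  · intro z
    simp [Fin.sum_univ_succ, lapCoef, stOff, e]
    ring

theorem integral_pow_six_stWeight :
    ∫ z, euclidNorm z ^ 6 * stWeight (fun i => |lapCoef i|) z = 12486 / 35 := by
  have e : ∀ z, euclidNorm z ^ 6 = (z.1 ^ 2 + z.2 ^ 2) ^ 3 := fun z => by
    rw [← euclidNorm_sq]; ring
  rw [integral_mul_stWeight_of_continuous _ (by fun_prop),
    integral_poly_hat (Finset.univ : Finset (Fin 10))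
      ![92, 540, 396, 72, 540, 792, 216, 396, 216, 72] ![0, 0, 0, 0, 1, 1, 1, 2, 2, 3]
      ![0, 1, 2, 3, 0, 1, 2, 0, 1, 0]]
  · norm_num [Fin.sum_univ_succ, tentMoment]
  · intro z
    simp [Fin.sum_univ_succ, lapCoef, stOff, e]
    ring

theorem integral_pow_eight_stWeight :
    ∫ z, euclidNorm z ^ 8 * stWeight (fun i => |lapCoef i|) z = 609368 / 525 := by
  have e : ∀ z, euclidNorm z ^ 8 = (z.1 ^ 2 + z.2 ^ 2) ^ 4 := fun z => by
    rw [← euclidNorm_sq]; ring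
  rw [integral_mul_stWeight_of_continuous _ (by fun_prop),
    integral_poly_hat (Finset.univ : Finset (Fin 15))
      ![156, 1472, 2152, 704, 72, 1472, 4368, 2112, 288, 2152, 2112, 432, 704, 288, 72]
      ![0, 0, 0, 0, 0, 1, 1, 1, 1, 2, 2, 2, 3, 3, 4]
      ![0, 1, 2, 3, 4, 0, 1, 2, 3, 0, 1, 2, 0, 1, 0]]
  · norm_num [Fin.sum_univ_succ, tentMoment]
  · intro z
    simp [Fin.sum_univ_succ, lapCoef, stOff, e]
    ring

theorem integral_head_stWeight (s : ℝ) (κ : ℂ) :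
    ∫ z, kernelHead s 8 (toC z * κ) * stWeight lapCoef z =
      8 * (binCoef s 4 * (κ ^ 4).re) - 44 * (s ^ 2 * ‖κ‖ ^ 2) := by
  have hz : ∀ m : ℕ, m % 4 ≠ 0 → ∫ z, (toC z ^ m).re * stWeight lapCoef z = 0 := by
    intro m hm
    have := isSymmWeight_lap.integral_eq_zero (k := 0) (m := m) (by simpa using hm) 1
    simpa using this
  rw [isSymmWeight_lap.integral_kernelHead, integral_stWeight, integral_sq_stWeight,
    Finset.sum_Ico_eq_sum_range]
  simp only [Finset.sum_range_succ, Finset.sum_range_zero, Nat.add_one_sub_one,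
    Nat.reduceAdd, zero_add, add_zero]
  rw [hz 1 (by norm_num), hz 2 (by norm_num), hz 3 (by norm_num), hz 5 (by norm_num),
    hz 6 (by norm_num), hz 7 (by norm_num), integral_re_pow_four_stWeight]
  ring

/-- The zeroth moment vanishes, so the head leaves only its terms of orders 4 and 2. Every remainder
is integrated against the stencil with absolute coefficients. -/
theorem rpow_mul_lapAvg_le {s : ℝ} (hs : 0 ≤ s) (hs1 : s < 1) {p r n : ℝ}
    (hn : p ^ 2 + r ^ 2 = n) (hn25 : 25 ≤ n) :
    n ^ s * lapAvg s p r ≤ 8 * (binCoef s 4 / n ^ 2) - 44 * (s ^ 2 / n) +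
      (2 * (7 / 3) * binCoef s 8 * (609368 / 525) / n ^ 4 +
        2 * s * binCoef s 5 * (7 / 3) * (12486 / 35) / n ^ 3 +
        binCoef s 2 ^ 2 * (7 / 3) ^ 2 * (1984 / 15) / n ^ 2) := by
  set w : ℝ × ℝ := (p, r) with hwd
  have hn' : euclidNorm w ^ 2 = n := by rw [euclidNorm_sq]; exact hn
  have hn0 : 0 < n := by linarith
  have hw : w ≠ 0 := by
    intro h
    rw [h, euclidNorm_eq_zero.2 rfl] at hn'
    norm_num at hn'
    linarith
  set κ := -(toC w)⁻¹ with hκ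
  set W := stWeight fun i => |lapCoef i| with hW
  have cW : Continuous W := continuous_stWeight _
  have zW : ∀ z, z ∉ square 2 → W z = 0 := fun z hz => stWeight_eq_zero _ hz
  have j4 : Integrable fun z => euclidNorm z ^ 4 * W z :=
    integrable_mul_of_eq_zero (by fun_prop) cW zW
  have j6 : Integrable fun z => euclidNorm z ^ 6 * W z :=
    integrable_mul_of_eq_zero (by fun_prop) cW zW
  have j8 : Integrable fun z => euclidNorm z ^ 8 * W z :=
    integrable_mul_of_eq_zero (by fun_prop) cW zW
  have ih := isSymmWeight_lap.integrable (continuous_kernelHead s 8 κ)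
  have e1 : n ^ s * lapAvg s p r =
      ∫ z, ‖1 - toC z * κ‖ ^ (-2 * s) * stWeight lapCoef z := by
    rw [← integral_ker_mul_stWeight hs hs1, ← integral_const_mul]
    congr 1
    ext z
    rw [ker_add_eq s hw, ker_eq_rpow, hn']
    have : n ^ s * n ^ (-s) = 1 := by
      rw [← Real.rpow_add (by positivity)]; simp
    linear_combination (‖1 - toC z * κ‖ ^ (-2 * s) * stWeight lapCoef z) * this
  have hb4 := binCoef_nonneg hs 4
  have hre : (κ ^ 4).re ≤ (n ^ 2)⁻¹ := by
    have := abs_re_neg_inv_pow_le w 2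
    norm_num only at this
    rw [hn'] at this
    exact (le_abs_self _).trans this
  have e2 : ∫ z, kernelHead s 8 (toC z * κ) * stWeight lapCoef z ≤
      8 * (binCoef s 4 / n ^ 2) - 44 * (s ^ 2 / n) := by
    rw [integral_head_stWeight, hκ, norm_neg_inv_toC_sq, hn', ← hκ, div_eq_mul_inv, div_eq_mul_inv]
    have := mul_le_mul_of_nonneg_left hre hb4
    linarith
  have e3 : ∫ z, (2 * (7 / 3) * binCoef s 8 / n ^ 4 * (euclidNorm z ^ 8 * W z) +
        2 * s * binCoef s 5 * (7 / 3) / n ^ 3 * (euclidNorm z ^ 6 * W z) +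
        binCoef s 2 ^ 2 * (7 / 3) ^ 2 / n ^ 2 * (euclidNorm z ^ 4 * W z)) =
      (2 * (7 / 3) * binCoef s 8 * (609368 / 525) / n ^ 4 +
        2 * s * binCoef s 5 * (7 / 3) * (12486 / 35) / n ^ 3 +
        binCoef s 2 ^ 2 * (7 / 3) ^ 2 * (1984 / 15) / n ^ 2) := by
    rw [integral_add (by fun_prop) (by fun_prop), integral_add (by fun_prop) (by fun_prop),
      integral_const_mul, integral_const_mul, integral_const_mul, integral_pow_four_stWeight,
      integral_pow_six_stWeight, integral_pow_eight_stWeight]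
    ring
  rw [e1, ← e3]
  refine le_trans ?_ (add_le_add_left e2 _)
  rw [← integral_add ih (by fun_prop)]
  refine integral_mono_ae (integrable_norm_rpow_mul hs hs1 hw (continuous_stWeight _)
      fun z hz => stWeight_eq_zero _ hz) (ih.add (by fun_prop)) (Eventually.of_forall fun z => ?_)
  simp only
  by_cases hz : z ∈ square 2
  -- The stencil weight lives on the square of half-side 2, and 2·2² = 8 ≤ (4/7)²·25. Hence the
  -- ratio 4/7, and the factor 7/3 = 1/(1 - 4/7).
  · have hζ : ‖toC z * κ‖ ≤ 4 / 7 :=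
      norm_toC_mul_le hw (by norm_num) (mem_square.1 hz) (by rw [hn']; linarith)
    obtain ⟨E, hE, he⟩ := kernel_sub_head hs hs1.le (M := 8) (by norm_num) hζ (by norm_num)
    have ht := sq_tail_le hs hs1.le hζ (by norm_num)
    have h2 := norm_toC_mul_sq w z
    rw [hn', ← hκ] at h2
    have h4 : (‖toC z * κ‖ ^ 2) ^ 2 = euclidNorm z ^ 4 / n ^ 2 := by
      rw [h2, div_pow, ← pow_mul]
    have h6 : ‖toC z * κ‖ * ‖toC z * κ‖ ^ 5 = euclidNorm z ^ 6 / n ^ 3 := by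
      rw [← pow_succ', show 5 + 1 = 2 * 3 by norm_num, pow_mul, h2, div_pow, ← pow_mul]
    have h8 : ‖toC z * κ‖ ^ 8 = euclidNorm z ^ 8 / n ^ 4 := by
      rw [show 8 = 2 * 4 by norm_num, pow_mul, h2, div_pow, ← pow_mul]
    set T := ‖(1 - toC z * κ) ^ (-(s : ℂ)) - binPart s 0 2 (toC z * κ)‖ ^ 2 with hT
    have hT0 : 0 ≤ T := by positivity
    have hET : |E + T| ≤ 2 * (7 / 3) * binCoef s 8 / n ^ 4 * euclidNorm z ^ 8 +
        2 * s * binCoef s 5 * (7 / 3) / n ^ 3 * euclidNorm z ^ 6 +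
        binCoef s 2 ^ 2 * (7 / 3) ^ 2 / n ^ 2 * euclidNorm z ^ 4 := by
      refine (abs_add_le _ _).trans ?_
      rw [abs_of_nonneg hT0]
      refine (add_le_add hE ht).trans (le_of_eq ?_)
      linear_combination (2 * (7 / 3) * binCoef s 8) * h8 + (2 * s * binCoef s 5 * (7 / 3)) * h6 +
        (binCoef s 2 ^ 2 * (7 / 3) ^ 2) * h4
    have hA := abs_stWeight_le lapCoef z
    have h5 : (E + T) * stWeight lapCoef z ≤ (2 * (7 / 3) * binCoef s 8 / n ^ 4 * euclidNorm z ^ 8 +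
        2 * s * binCoef s 5 * (7 / 3) / n ^ 3 * euclidNorm z ^ 6 +
        binCoef s 2 ^ 2 * (7 / 3) ^ 2 / n ^ 2 * euclidNorm z ^ 4) * W z := by
      refine (le_abs_self _).trans ?_
      rw [abs_mul]
      exact mul_le_mul hET hA (abs_nonneg _) ((abs_nonneg _).trans hET)
    rw [he]
    linarith
  · simp [stWeight_eq_zero _ hz, zW z hz]

/-- After a factor t = 1/n is removed, the positive terms grow with t, so t = 1/25 is the worst
case. What is left is a quartic in s in which the term -44s² beats the linear one because s ≥ 1/250.
-/
theorem lapAvg_neg_of_le {s : ℝ} (hs0 : 1 / 250 ≤ s) (hs1 : s < 1) {p r : ℝ}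
    (hn25 : 25 ≤ p ^ 2 + r ^ 2) : lapAvg s p r < 0 := by
  have hs : 0 ≤ s := by linarith
  obtain ⟨n, hn⟩ : ∃ n, p ^ 2 + r ^ 2 = n := ⟨_, rfl⟩
  rw [hn] at hn25
  have hn0 : 0 < n := by linarith
  have h := rpow_mul_lapAvg_le hs hs1 hn hn25
  refine neg_of_mul_neg_right (lt_of_le_of_lt h ?_) (by positivity : 0 ≤ n ^ s)
  have u2 := binCoef_le hs hs1.le (m := 2) (by norm_num)
  have u4 := binCoef_le hs hs1.le (m := 4) (by norm_num)
  have u5 := binCoef_le hs hs1.le (m := 5) (by norm_num)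
  have u8 := binCoef_le hs hs1.le (m := 8) (by norm_num)
  have p2 := binCoef_nonneg hs 2
  have p4 := binCoef_nonneg hs 4
  have p5 := binCoef_nonneg hs 5
  have p8 := binCoef_nonneg hs 8
  norm_num at u2 u4 u5 u8
  have q2 : binCoef s 2 ^ 2 ≤ (s * (1 / 2 + s * (1 / 2))) ^ 2 := by
    refine pow_le_pow_left₀ p2 (u2.trans (le_of_eq (by ring))) 2
  set t := 1 / n with ht
  have ht0 : 0 < t := by positivity
  have ht1 : t ≤ 1 / 25 := one_div_le_one_div_of_le (by norm_num) hn25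
  have ht2 : t ^ 2 ≤ 1 / 625 := by nlinarith
  have ht3 : t ^ 3 ≤ 1 / 15625 := by nlinarith
  have e : 8 * (binCoef s 4 / n ^ 2) - 44 * (s ^ 2 / n) +
      (2 * (7 / 3) * binCoef s 8 * (609368 / 525) / n ^ 4 +
        2 * s * binCoef s 5 * (7 / 3) * (12486 / 35) / n ^ 3 +
        binCoef s 2 ^ 2 * (7 / 3) ^ 2 * (1984 / 15) / n ^ 2) =
      t * (8 * (binCoef s 4 * t) - 44 * s ^ 2 +
        (2 * (7 / 3) * (609368 / 525) * (binCoef s 8 * t ^ 3) +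
        2 * (7 / 3) * (12486 / 35) * (s * (binCoef s 5 * t ^ 2)) +
        (7 / 3) ^ 2 * (1984 / 15) * (binCoef s 2 ^ 2 * t))) := by
    rw [ht]; field_simp
  rw [e]
  refine mul_neg_of_pos_of_neg ht0 ?_
  have m4 := mul_le_mul u4 ht1 ht0.le (by positivity)
  have m8 := mul_le_mul u8 ht3 (by positivity) (by positivity)
  have m5 := mul_le_mul_of_nonneg_left (mul_le_mul u5 ht2 (by positivity) (by positivity)) hs
  have m2 := mul_le_mul q2 ht1 ht0.le (by positivity)
  have key : 8 * (s * (1 / 4 + s * (3 / 4)) * (1 / 25)) - 44 * s ^ 2 +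
        (2 * (7 / 3) * (609368 / 525) * (s * (1 / 8 + s * (7 / 8)) * (1 / 15625)) +
        2 * (7 / 3) * (12486 / 35) * (s * (s * (1 / 5 + s * (4 / 5)) * (1 / 625))) +
        (7 / 3) ^ 2 * (1984 / 15) * ((s * (1 / 2 + s * (1 / 2))) ^ 2 * (1 / 25))) < 0 := by
    have h3 : s ^ 3 ≤ s ^ 2 := pow_le_pow_of_le_one hs hs1.le (by norm_num)
    have h4 : s ^ 4 ≤ s ^ 3 := pow_le_pow_of_le_one hs hs1.le (by norm_num)
    have h5 : s ^ 3 * (1 - s) ≥ 0 := mul_nonneg (by positivity) (by linarith)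
    have h6 : s * (s - 1 / 250) ≥ 0 := mul_nonneg hs (by linarith)
    have h7 : s ^ 2 * (s - 1 / 250) ≥ 0 := mul_nonneg (by positivity) (by linarith)
    have h8 : (s - 1 / 250) * (s * (1 - s)) ≥ 0 :=
      mul_nonneg (by linarith) (mul_nonneg hs (by linarith))
    have h9 : s ^ 2 * ((s - 1 / 250) * (1 - s)) ≥ 0 :=
      mul_nonneg (by positivity) (mul_nonneg (by linarith) (by linarith))
    nlinarith
  refine lt_of_le_of_lt ?_ key
  norm_num at m4 m8 m5 m2 ⊢
  linarith

/-! ### Symmetry of the stencil values and existence of a suitable pair -/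

theorem lapAvg_neg_right (s p q : ℝ) : lapAvg s p (-q) = lapAvg s p q := by
  have e1 : ∀ a, kerAvg s (a, -q + 1) = kerAvg s (a, q - 1) := fun a => by
    rw [← kerAvg_neg_right s a (q - 1)]; congr 2; ring
  have e2 : ∀ a, kerAvg s (a, -q - 1) = kerAvg s (a, q + 1) := fun a => by
    rw [← kerAvg_neg_right s a (q + 1)]; congr 2; ring
  rw [lapAvg, lapAvg]
  simp only [e1, e2, kerAvg_neg_right]
  ring

theorem lapAvg_swap (s p q : ℝ) : lapAvg s q p = lapAvg s p q := by
  rw [lapAvg, lapAvg, kerAvg_swap s p q, kerAvg_swap s (p + 1) q, kerAvg_swap s (p - 1) q,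
    kerAvg_swap s p (q + 1), kerAvg_swap s p (q - 1), kerAvg_swap s (p + 1) (q + 1),
    kerAvg_swap s (p - 1) (q + 1), kerAvg_swap s (p + 1) (q - 1), kerAvg_swap s (p - 1) (q - 1)]
  ring

theorem lapAvg_neg_left (s p q : ℝ) : lapAvg s (-p) q = lapAvg s p q := by
  rw [← lapAvg_swap, lapAvg_neg_right, lapAvg_swap]

theorem lapAvg_abs (s : ℝ) (p q : ℤ) : lapAvg s |(p : ℝ)| |(q : ℝ)| = lapAvg s p q := by
  rcases abs_choice (p : ℝ) with h | h <;> rcases abs_choice (q : ℝ) with h' | h' <;>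
    rw [h, h'] <;> simp only [lapAvg_neg_left, lapAvg_neg_right]

/-- Exactly ten pairs with p ≥ 2 and q ≤ p satisfy p² + q² < 25, and each has been treated
individually. -/
theorem lapAvg_neg_of_nat {s : ℝ} (hs0 : 1 / 250 ≤ s) (hs1 : s < 1) (p q : ℕ) (hp : 2 ≤ p)
    (hq : q ≤ p) : lapAvg s p q < 0 := by
  by_cases h : 25 ≤ p ^ 2 + q ^ 2
  · exact lapAvg_neg_of_le hs0 hs1 (by exact_mod_cast h)
  · have h4 : p ≤ 4 := by nlinarith
    have h5 : ¬ (p = 4 ∧ 3 ≤ q) := by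
      rintro ⟨rfl, h3⟩
      nlinarith
    interval_cases p
    · interval_cases q
      · exact_mod_cast lapAvg_two_zero hs0 hs1
      · exact_mod_cast lapAvg_two_one hs0 hs1
      · exact_mod_cast lapAvg_two_two hs0 hs1
    · interval_cases q
      · exact_mod_cast lapAvg_three_zero hs0 hs1
      · exact_mod_cast lapAvg_three_one hs0 hs1
      · exact_mod_cast lapAvg_three_two hs0 hs1
      · exact_mod_cast lapAvg_three_three hs0 hs1
    · have : q ≤ 2 := by omega
      interval_cases q
      · exact_mod_cast lapAvg_four_zero hs0 hs1
      · exact_mod_cast lapAvg_four_one hs0 hs1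
      · exact_mod_cast lapAvg_four_two hs0 hs1

theorem lapAvg_neg {s : ℝ} (hs0 : 1 / 250 ≤ s) (hs1 : s < 1) (p q : ℤ)
    (h : 2 ≤ |p| ∨ 2 ≤ |q|) : lapAvg s p q < 0 := by
  rw [← lapAvg_abs]
  have e : ∀ p : ℤ, |(p : ℝ)| = (p.natAbs : ℝ) := fun p => by
    rw [Nat.cast_natAbs]; push_cast; rfl
  rw [e, e]
  rw [Int.abs_eq_natAbs, Int.abs_eq_natAbs] at h
  rcases le_total q.natAbs p.natAbs with hle | hle
  · exact lapAvg_neg_of_nat hs0 hs1 _ _ (by omega) hle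
  · rw [← lapAvg_swap]
    exact lapAvg_neg_of_nat hs0 hs1 _ _ (by omega) hle

theorem fracConst_pos {s : ℝ} (h0 : 0 < 1 + s) (h1 : 0 < 1 - s) (hs : s ≠ 0) :
    0 < fracConst s := by
  have := Real.Gamma_pos_of_pos h0
  have := Real.Gamma_pos_of_pos h1
  have := abs_pos.2 hs
  have := Real.pi_pos
  rw [fracConst]; positivity

theorem fracConst_sub_one_pos {s : ℝ} (hs : 0 < s) (hs1 : s < 1) : 0 < fracConst (s - 1) :=
  fracConst_pos (by linarith) (by linarith) (by linarith)

/-- The correction scales like the weights themselves, so h enters only through a positive factor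
and signs do not depend on the mesh. -/
theorem weightM_eq (s κ : ℝ) {h : ℝ} (hh : 0 < h) (p q : ℤ) :
    weightM s (7 / 11) (corr s κ h) h p q = h ^ (2 - 2 * s) / (11 * h ^ 2) *
      (fracConst (s - 1) * lapAvg s p q + κ *
        (36 * (if p = 0 ∧ q = 0 then 1 else 0) -
          7 * ((if p + 1 = 0 ∧ q = 0 then 1 else 0) + (if p - 1 = 0 ∧ q = 0 then 1 else 0) +
            (if p = 0 ∧ q + 1 = 0 then 1 else 0) + (if p = 0 ∧ q - 1 = 0 then 1 else 0)) -
          2 * ((if p + 1 = 0 ∧ q + 1 = 0 then 1 else 0) +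
            (if p - 1 = 0 ∧ q + 1 = 0 then 1 else 0) + (if p + 1 = 0 ∧ q - 1 = 0 then 1 else 0) +
            (if p - 1 = 0 ∧ q - 1 = 0 then 1 else 0)))) := by
  have e : ∀ p q : ℤ, omegaBarM s (corr s κ h) h p q = h ^ (2 - 2 * s) *
      (fracConst (s - 1) * kerAvg s (p, q) + κ * (if p = 0 ∧ q = 0 then 1 else 0)) := by
    intro p q
    rw [omegaBarM, omegaBar_eq s hh, corr]
    split_ifs <;> ring
  rw [weightM, discLap, lapAvg]
  simp only [e]
  push_cast
  field_simp
  ring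

/-- The correction adds 36κ at the centre, -7κ or -2κ at the eight neighbours and nothing elsewhere.
A large κ therefore fixes the nine central signs, whatever the values of `lapAvg` there; all other
weights are covered by `lapAvg_neg`. -/
theorem exists_suitable {s : ℝ} (hs0 : 1 / 250 ≤ s) (hs1 : s < 1) :
    ∃ θ κ : ℝ, Suitable s θ κ := by
  have hC := fracConst_sub_one_pos (by linarith : 0 < s) hs1
  set C := fracConst (s - 1) with hCd
  have a0 := neg_abs_le (lapAvg s 0 0)
  have a1 := le_abs_self (lapAvg s 1 0)
  have a2 := le_abs_self (lapAvg s 1 1)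
  have n0 := abs_nonneg (lapAvg s 0 0)
  have n1 := abs_nonneg (lapAvg s 1 0)
  have n2 := abs_nonneg (lapAvg s 1 1)
  refine ⟨7 / 11, 1 + C * (|lapAvg s 0 0| + |lapAvg s 1 0| + |lapAvg s 1 1|),
    by norm_num, by positivity, fun h hh p q => ?_⟩
  have hf : 0 < h ^ (2 - 2 * s) / (11 * h ^ 2) := by positivity
  have m0 := mul_nonneg hC.le n0
  have m1 := mul_nonneg hC.le n1
  have m2 := mul_nonneg hC.le n2
  have k0 := mul_le_mul_of_nonneg_left a0 hC.le
  have k1 := mul_le_mul_of_nonneg_left a1 hC.le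
  have k2 := mul_le_mul_of_nonneg_left a2 hC.le
  rw [weightM_eq s _ hh, ← hCd]
  constructor
  · rintro ⟨rfl, rfl⟩
    refine mul_pos hf ?_
    norm_num
    nlinarith
  · intro hpq
    refine mul_neg_of_pos_of_neg hf ?_
    by_cases hbig : 2 ≤ |p| ∨ 2 ≤ |q|
    · have h1 := mul_neg_of_pos_of_neg hC (lapAvg_neg hs0 hs1 p q hbig)
      have h2 : ∀ a b : ℤ, |a| ≤ 1 → |b| ≤ 1 → ¬ (p + a = 0 ∧ q + b = 0) := by
        intro a b ha hb
        rw [abs_le] at ha hb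
        rcases hbig with hb' | hb' <;> rw [le_abs] at hb' <;> omega
      have c00 := h2 0 0
      have c10 := h2 1 0
      have c20 := h2 (-1) 0
      have c01 := h2 0 1
      have c02 := h2 0 (-1)
      have c11 := h2 1 1
      have c21 := h2 (-1) 1
      have c12 := h2 1 (-1)
      have c22 := h2 (-1) (-1)
      norm_num only [add_zero, ← sub_eq_add_neg, forall_true_left] at c00 c10 c20 c01 c02 c11 c21 c12 c22
      rw [if_neg c00, if_neg c10, if_neg c20, if_neg c01, if_neg c02, if_neg c11, if_neg c21,
        if_neg c12, if_neg c22]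
      linarith
    · push Not at hbig
      rw [abs_lt, abs_lt] at hbig
      obtain ⟨⟨h1, h2⟩, h3, h4⟩ := hbig
      rw [← lapAvg_abs]
      have s10 := lapAvg_swap s 1 0
      interval_cases p <;> interval_cases q <;>
        first
        | exact absurd ⟨rfl, rfl⟩ hpq
        | (norm_num; try rw [s10]
           nlinarith)

/-! ### Second differences of the kernel -/

/-- The cubic truncations at ζ and -ζ are a + b and a - b, with a the even and b the odd part. Odd
orders cancel in the sum, which leaves an error of order four; the constant 50 is generous. -/
theorem symm_sum_sub_le {s : ℝ} (hs : 0 ≤ s) (hs1 : s ≤ 1) {ζ : ℂ} (hζ : ‖ζ‖ ≤ 1 / 2) :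
    |‖1 - ζ‖ ^ (-2 * s) + ‖1 + ζ‖ ^ (-2 * s) - 2 - 4 * binCoef s 2 * (ζ ^ 2).re -
      2 * s ^ 2 * ‖ζ‖ ^ 2| ≤ 50 * ‖ζ‖ ^ 4 := by
  have b2 : binCoef s 2 ≤ 1 := (binCoef_antitone hs hs1 (Nat.zero_le 2)).trans_eq (by simp)
  have b3 : binCoef s 3 ≤ 1 := (binCoef_antitone hs hs1 (Nat.zero_le 3)).trans_eq (by simp)
  have b4 : binCoef s 4 ≤ 1 := (binCoef_antitone hs hs1 (Nat.zero_le 4)).trans_eq (by simp)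
  have p2 := binCoef_nonneg hs 2
  have p3 := binCoef_nonneg hs 3
  have p4 := binCoef_nonneg hs 4
  have r0 := norm_nonneg ζ
  set r := ‖ζ‖ with hr
  set a : ℂ := 1 + binCoef s 2 * ζ ^ 2 with ha
  set b : ℂ := s * ζ + binCoef s 3 * ζ ^ 3 with hb
  have part : ∀ ξ : ℂ, binPart s 0 4 ξ = 1 + s * ξ + binCoef s 2 * ξ ^ 2 + binCoef s 3 * ξ ^ 3 := by
    intro ξ
    simp [binPart, Finset.sum_range_succ]
  have r4 : r ^ 4 ≤ 1 := pow_le_one₀ r0 (by linarith)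
  have na : ‖a‖ ≤ 2 := by
    refine (norm_add_le _ _).trans ?_
    rw [norm_mul, Complex.norm_real, Real.norm_of_nonneg p2, norm_pow, ← hr, norm_one]
    have : r ^ 2 ≤ 1 := pow_le_one₀ r0 (by linarith)
    nlinarith
  have nb : ‖b‖ ≤ 2 := by
    refine (norm_add_le _ _).trans ?_
    rw [norm_mul, norm_mul, Complex.norm_real, Complex.norm_real, Real.norm_of_nonneg p3,
      Real.norm_of_nonneg hs, norm_pow, ← hr]
    have : r ^ 3 ≤ 1 := pow_le_one₀ r0 (by linarith)
    nlinarith [mul_nonneg hs r0, pow_nonneg r0 3]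
  have one : ∀ ξ : ℂ, ‖ξ‖ = r → ∀ P : ℂ, ‖P‖ ≤ 4 → binPart s 0 4 ξ = P →
      |‖1 - ξ‖ ^ (-2 * s) - ‖P‖ ^ 2| ≤ 20 * r ^ 4 := by
    intro ξ hξ P hP hPe
    have hξ2 : ‖ξ‖ ≤ 1 / 2 := by rw [hξ]; exact hζ
    have t := norm_sub_binPart_le hs hs1 4 hξ2 (by norm_num)
    rw [norm_rpow_eq_sq s (lt_of_le_of_lt hξ2 (by norm_num)), hPe] at *
    rw [hξ] at t
    set w := (1 - ξ) ^ (-(s : ℂ)) with hw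
    have t' : ‖w - P‖ ≤ 2 * r ^ 4 := by
      refine t.trans ?_
      rw [div_le_iff₀ (by norm_num)]
      have := mul_le_mul_of_nonneg_right b4 (pow_nonneg r0 4)
      linarith
    have e : w = P + (w - P) := by ring
    rw [e, norm_sq_add', add_assoc, add_sub_cancel_left]
    have h1 := abs_re_conj_mul_le P (w - P)
    have h2 : ‖P‖ * ‖w - P‖ ≤ 4 * (2 * r ^ 4) :=
      mul_le_mul hP t' (norm_nonneg _) (by norm_num)
    have h3 : ‖w - P‖ ^ 2 ≤ (2 * r ^ 4) ^ 2 := pow_le_pow_left₀ (norm_nonneg _) t' 2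
    have h4 : (2 * r ^ 4) ^ 2 ≤ 4 * r ^ 4 := by nlinarith [pow_nonneg r0 4]
    rw [abs_le] at h1 ⊢
    constructor <;> nlinarith [sq_nonneg ‖w - P‖, pow_nonneg r0 4]
  have h1 := one ζ rfl (a + b) ((norm_add_le _ _).trans (by linarith)) (by rw [part, ha, hb]; ring)
  have h2 := one (-ζ) (norm_neg ζ) (a - b) ((norm_sub_le _ _).trans (by linarith))
    (by rw [part, ha, hb]; ring)
  rw [sub_neg_eq_add] at h2
  -- The parallelogram law removes the products of the even with the odd part.
  have hpar : ‖a + b‖ ^ 2 + ‖a - b‖ ^ 2 = 2 * (‖a‖ ^ 2 + ‖b‖ ^ 2) := by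
    have := parallelogram_law_with_norm ℝ a b
    nlinarith
  have ea : ‖a‖ ^ 2 = 1 + 2 * (binCoef s 2 * (ζ ^ 2).re) + (binCoef s 2 * r ^ 2) ^ 2 := by
    rw [ha, norm_sq_one_add, Complex.re_ofReal_mul, norm_mul, Complex.norm_real,
      Real.norm_of_nonneg p2, norm_pow]
  have eb : ‖b‖ ^ 2 = s ^ 2 * r ^ 2 +
      2 * ((starRingEnd ℂ) (s * ζ) * (binCoef s 3 * ζ ^ 3)).re + (binCoef s 3 * r ^ 3) ^ 2 := by
    rw [hb, norm_sq_add', norm_mul, norm_mul, Complex.norm_real, Complex.norm_real,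
      Real.norm_of_nonneg p3, Real.norm_of_nonneg hs, norm_pow, mul_pow]
  have hc := abs_re_conj_mul_le (s * ζ) (binCoef s 3 * ζ ^ 3)
  have hc2 : ‖(s : ℂ) * ζ‖ * ‖(binCoef s 3 : ℂ) * ζ ^ 3‖ ≤ r ^ 4 := by
    rw [norm_mul, norm_mul, Complex.norm_real, Complex.norm_real,
      Real.norm_of_nonneg p3, Real.norm_of_nonneg hs, norm_pow]
    calc s * r * (binCoef s 3 * r ^ 3) = s * binCoef s 3 * r ^ 4 := by ring
      _ ≤ 1 * r ^ 4 := by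
        refine mul_le_mul_of_nonneg_right ?_ (pow_nonneg r0 4)
        nlinarith
      _ = r ^ 4 := one_mul _
  have hd : (binCoef s 2 * r ^ 2) ^ 2 ≤ r ^ 4 := by
    calc (binCoef s 2 * r ^ 2) ^ 2 = binCoef s 2 ^ 2 * r ^ 4 := by ring
      _ ≤ 1 * r ^ 4 := mul_le_mul_of_nonneg_right (pow_le_one₀ p2 b2) (pow_nonneg r0 4)
      _ = r ^ 4 := one_mul _
  have he : (binCoef s 3 * r ^ 3) ^ 2 ≤ r ^ 4 := by
    calc (binCoef s 3 * r ^ 3) ^ 2 = binCoef s 3 ^ 2 * r ^ 2 * r ^ 4 := by ring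
      _ ≤ 1 * r ^ 4 := by
        refine mul_le_mul_of_nonneg_right ?_ (pow_nonneg r0 4)
        exact mul_le_one₀ (pow_le_one₀ p3 b3) (by positivity) (pow_le_one₀ r0 (by linarith))
      _ = r ^ 4 := one_mul _
  rw [abs_le] at h1 h2 hc ⊢
  have hd0 : 0 ≤ (binCoef s 2 * r ^ 2) ^ 2 := by positivity
  have he0 : 0 ≤ (binCoef s 3 * r ^ 3) ^ 2 := by positivity
  constructor <;> linarith [hc.1, hc.2, h1.1, h1.2, h2.1, h2.2]

/-- The second difference of a function in the direction `v`. -/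
def secDiff (F : ℝ × ℝ → ℝ) (v x : ℝ × ℝ) : ℝ := F (x + v) + F (x - v) - 2 * F x

/-- The subtracted main term is the Hessian of |z|^(-2s) in the direction v, written in the complex
variable ζ = -v/z. -/
theorem secDiff_ker_sub_le {s : ℝ} (hs : 0 ≤ s) (hs1 : s ≤ 1) {v z : ℝ × ℝ} (hz : z ≠ 0)
    (hv : 2 * euclidNorm v ≤ euclidNorm z) :
    |secDiff (ker s) v z - ker s z * (4 * binCoef s 2 * ((toC v * (-(toC z)⁻¹)) ^ 2).re +
      2 * s ^ 2 * (euclidNorm v ^ 2 / euclidNorm z ^ 2))| ≤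
      50 * euclidNorm v ^ 4 * (ker s z / euclidNorm z ^ 4) := by
  have hz0 := euclidNorm_pos hz
  have hsq := norm_toC_mul_sq z v
  set ζ := toC v * (-(toC z)⁻¹) with hζ
  have hn : ‖ζ‖ ≤ 1 / 2 := by
    rw [hζ, norm_mul, norm_neg, norm_inv, ← euclidNorm_eq_norm, ← euclidNorm_eq_norm,
      ← div_eq_mul_inv, div_le_iff₀ hz0]
    linarith
  have h := symm_sum_sub_le hs hs1 hn
  have e1 : ker s (z + v) = ker s z * ‖1 - ζ‖ ^ (-2 * s) := ker_add_eq s hz v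
  have e2 : ker s (z - v) = ker s z * ‖1 + ζ‖ ^ (-2 * s) := by
    rw [sub_eq_add_neg, ker_add_eq s hz, toC_neg, neg_mul, ← hζ, sub_neg_eq_add]
  have e : secDiff (ker s) v z - ker s z * (4 * binCoef s 2 * (ζ ^ 2).re +
      2 * s ^ 2 * (euclidNorm v ^ 2 / euclidNorm z ^ 2)) = ker s z * (‖1 - ζ‖ ^ (-2 * s) +
      ‖1 + ζ‖ ^ (-2 * s) - 2 - 4 * binCoef s 2 * (ζ ^ 2).re - 2 * s ^ 2 * ‖ζ‖ ^ 2) := by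
    rw [secDiff, e1, e2, hsq]; ring
  rw [e, abs_mul, abs_of_nonneg (ker_nonneg s z)]
  refine (mul_le_mul_of_nonneg_left h (ker_nonneg s z)).trans (le_of_eq ?_)
  have : ‖ζ‖ ^ 4 = euclidNorm v ^ 4 / euclidNorm z ^ 4 := by
    rw [show 4 = 2 * 2 by norm_num, pow_mul, hsq, div_pow, ← pow_mul, ← pow_mul]
  rw [this]; ring

theorem ker_div_pow (s : ℝ) {z : ℝ × ℝ} (hz : z ≠ 0) (k : ℕ) :
    ker s z / euclidNorm z ^ k = euclidNorm z ^ (-(2 * s + k)) := by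
  have := euclidNorm_pos hz
  rw [ker, ← Real.rpow_natCast, ← Real.rpow_sub this]
  congr 1; ring

theorem abs_secDiff_ker_le {s : ℝ} (hs : 0 ≤ s) (hs1 : s ≤ 1) {v z : ℝ × ℝ} (hz : z ≠ 0)
    (hv : 2 * euclidNorm v ≤ euclidNorm z) :
    |secDiff (ker s) v z| ≤ 60 * euclidNorm v ^ 2 * euclidNorm z ^ (-(2 * s + 2)) := by
  have h := secDiff_ker_sub_le hs hs1 hz hv
  have hz0 := euclidNorm_pos hz
  have hv0 := euclidNorm_nonneg v
  have hk := ker_nonneg s z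
  have b2 : binCoef s 2 ≤ 1 := (binCoef_antitone hs hs1 (Nat.zero_le 2)).trans_eq (by simp)
  have p2 := binCoef_nonneg hs 2
  have e := ker_div_pow s hz 2
  push_cast at e
  rw [← e]
  set R := euclidNorm z
  set V := euclidNorm v
  set ζ := toC v * (-(toC z)⁻¹) with hζ
  have hre : |(ζ ^ 2).re| ≤ V ^ 2 / R ^ 2 := by
    refine (Complex.abs_re_le_norm _).trans (le_of_eq ?_)
    rw [norm_pow, norm_toC_mul_sq]
  have hq : V ^ 2 / R ^ 2 ≤ 1 / 4 := by
    rw [div_le_iff₀ (by positivity)]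
    nlinarith
  have hq0 : 0 ≤ V ^ 2 / R ^ 2 := by positivity
  have m1 : |4 * binCoef s 2 * (ζ ^ 2).re + 2 * s ^ 2 * (V ^ 2 / R ^ 2)| ≤ 6 * (V ^ 2 / R ^ 2) := by
    refine (abs_add_le _ _).trans ?_
    rw [abs_mul, abs_of_nonneg (by positivity : 0 ≤ 4 * binCoef s 2),
      abs_of_nonneg (by positivity : 0 ≤ 2 * s ^ 2 * (V ^ 2 / R ^ 2))]
    have : s ^ 2 ≤ 1 := pow_le_one₀ hs hs1
    nlinarith [abs_nonneg (ζ ^ 2).re]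
  have h2 := abs_sub_abs_le_abs_sub (secDiff (ker s) v z)
    (ker s z * (4 * binCoef s 2 * (ζ ^ 2).re + 2 * s ^ 2 * (V ^ 2 / R ^ 2)))
  rw [abs_mul, abs_of_nonneg hk] at h2
  have h3 := mul_le_mul_of_nonneg_left m1 hk
  have h4 : 50 * V ^ 4 * (ker s z / R ^ 4) = 50 * (V ^ 2 / R ^ 2) * (ker s z * (V ^ 2 / R ^ 2)) := by
    field_simp
  have h5 : 50 * (V ^ 2 / R ^ 2) * (ker s z * (V ^ 2 / R ^ 2)) ≤
      50 * (1 / 4) * (ker s z * (V ^ 2 / R ^ 2)) := by gcongr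
  have h6 : 60 * V ^ 2 * (ker s z / R ^ 2) = 60 * (ker s z * (V ^ 2 / R ^ 2)) := by ring
  have h7 : 0 ≤ ker s z * (V ^ 2 / R ^ 2) := by positivity
  rw [h6]
  linarith

theorem measurable_secDiff_ker (s : ℝ) (v : ℝ × ℝ) : Measurable (secDiff (ker s) v) := by
  have := measurable_ker s
  unfold secDiff; fun_prop

theorem integrableOn_secDiff_ker {s : ℝ} (hs : 0 ≤ s) (hs1 : s < 1) (v : ℝ × ℝ) (r : ℝ) :
    IntegrableOn (secDiff (ker s) v) (square r) := by
  have h1 := integrableOn_ker_add hs hs1 v r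
  have h2 := integrableOn_ker_add hs hs1 (-v) r
  have h3 := integrableOn_ker hs hs1 r
  refine ((h1.add h2).sub (h3.const_mul 2)).congr (Eventually.of_forall fun z => ?_)
  simp only [secDiff, Pi.add_apply, Pi.sub_apply]
  rw [add_comm v z, neg_add_eq_sub]

theorem integrable_secDiff_ker {s : ℝ} (hs : 0 < s) (hs1 : s < 1) (v : ℝ × ℝ) :
    Integrable (secDiff (ker s) v) := by
  set r := 1 + 2 * euclidNorm v with hr
  have hr0 : 0 < r := by have := euclidNorm_nonneg v; linarith
  rw [← integrableOn_univ, ← Set.union_compl_self (square r)]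
  refine (integrableOn_secDiff_ker hs.le hs1 v r).union ?_
  have h := (integrableOn_compl_euclidNorm_rpow (a := 2 * s + 2) (by linarith) hr0).const_mul
    (60 * euclidNorm v ^ 2)
  refine Integrable.mono' h (measurable_secDiff_ker s v).aestronglyMeasurable
    ((ae_restrict_iff' (measurableSet_square r).compl).2 (Eventually.of_forall fun z hz => ?_))
  rw [Set.mem_compl_iff, mem_square, not_le] at hz
  have := norm_le_euclidNorm z
  refine abs_secDiff_ker_le hs.le hs1.le ?_ (by linarith)
  rintro rfl
  rw [norm_zero] at hz
  linarith

/-- The kernel itself is not integrable, so translation invariance cannot be applied to it directly.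
Let I(v) be the integral. A second difference with step 2v is a combination of translates of the one
with step v, so I(2v) = 4I(v); homogeneity gives I(2v) = 4·2^(-2s)I(v). As s > 0, I(v) = 0. -/
theorem integral_secDiff_ker {s : ℝ} (hs : 0 < s) (hs1 : s < 1) (v : ℝ × ℝ) :
    ∫ z, secDiff (ker s) v z = 0 := by
  have hi := integrable_secDiff_ker hs hs1 v
  have h1 : ∫ z, secDiff (ker s) ((2 : ℝ) • v) z = 4 * ∫ z, secDiff (ker s) v z := by
    have e : ∀ z, secDiff (ker s) ((2 : ℝ) • v) z = secDiff (ker s) v (z + v) +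
        2 * secDiff (ker s) v z + secDiff (ker s) v (z - v) := by
      intro z
      simp only [secDiff, two_smul]
      rw [show z + (v + v) = z + v + v by abel, show z - (v + v) = z - v - v by abel,
        add_sub_cancel_right, sub_add_cancel]
      ring
    simp only [e]
    have i1 := hi.comp_add_right v
    have i2 := hi.comp_sub_right v
    rw [integral_add (by fun_prop) (by fun_prop), integral_add (by fun_prop) (by fun_prop),
      integral_const_mul,
      integral_add_right_eq_self, integral_sub_right_eq_self]
    ring
  have h2 : ∫ z, secDiff (ker s) ((2 : ℝ) • v) z = 4 * 2 ^ (-2 * s) * ∫ z, secDiff (ker s) v z := by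
    have h := Measure.integral_comp_smul (volume : Measure (ℝ × ℝ))
      (fun z => secDiff (ker s) ((2 : ℝ) • v) z) 2
    have e : ∀ z : ℝ × ℝ, secDiff (ker s) ((2 : ℝ) • v) ((2 : ℝ) • z) =
        2 ^ (-2 * s) * secDiff (ker s) v z := by
      intro z
      simp only [secDiff, ← smul_add, ← smul_sub, ker_smul s two_pos.le]
      ring
    simp only [e] at h
    rw [integral_const_mul] at h
    norm_num at h ⊢
    linarith
  have h3 : (2 : ℝ) ^ (-2 * s) < 1 :=
    Real.rpow_lt_one_of_one_lt_of_neg (by norm_num) (by linarith)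
  rw [h1] at h2
  have h4 : (1 - (2 : ℝ) ^ (-2 * s)) * ∫ z, secDiff (ker s) v z = 0 := by linarith
  rcases mul_eq_zero.1 h4 with h | h
  · linarith
  · exact h

/-! ### The discrete Laplacian of the kernel -/

/-- The discretization of `-Δ`, applied to a function on the plane. -/
def planeLap (θ h : ℝ) (F : ℝ × ℝ → ℝ) (x : ℝ × ℝ) : ℝ :=
  -(θ * (secDiff F (h, 0) x + secDiff F (0, h) x) / h ^ 2 +
    (1 - θ) * (secDiff F (h, h) x + secDiff F (h, -h) x) / (2 * h ^ 2))

theorem discLap_node (θ h L : ℝ) (F : ℝ × ℝ → ℝ) (i j : ℤ) :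
    discLap θ h (fun i j => F (node L h i j)) i j = planeLap θ h F (node L h i j) := by
  have e : ∀ a b : ℤ, node L h (i + a) (j + b) = node L h i j + ((a : ℝ) * h, (b : ℝ) * h) := by
    intro a b
    ext <;> simp [node] <;> ring
  have e10 := e 1 0
  have e20 := e (-1) 0
  have e01 := e 0 1
  have e02 := e 0 (-1)
  have e11 := e 1 1
  have e21 := e (-1) 1
  have e12 := e 1 (-1)
  have e22 := e (-1) (-1)
  simp only [add_zero, ← sub_eq_add_neg, Int.cast_one, Int.cast_neg, Int.cast_zero, one_mul,
    neg_mul, zero_mul] at e10 e20 e01 e02 e11 e21 e12 e22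
  rw [discLap, planeLap]
  simp only [e10, e20, e01, e02, e11, e21, e12, e22]
  simp only [secDiff, sub_eq_add_neg, Prod.neg_mk, neg_zero, neg_neg]
  ring

theorem planeLap_ker_smul (s θ : ℝ) {h : ℝ} (hh : 0 < h) (z : ℝ × ℝ) :
    planeLap θ h (ker s) (h • z) = h ^ (-(2 * s + 2)) * planeLap θ 1 (ker s) z := by
  have e : ∀ a b : ℝ, secDiff (ker s) (h * a, h * b) (h • z) =
      h ^ (-2 * s) * secDiff (ker s) (a, b) z := by
    intro a b
    have : ((h * a, h * b) : ℝ × ℝ) = h • (a, b) := rfl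
    rw [this]
    simp only [secDiff, ← smul_add, ← smul_sub, ker_smul s hh.le]
    ring
  have e1 := e 1 0
  have e2 := e 0 1
  have e3 := e 1 1
  have e4 := e 1 (-1)
  simp only [mul_one, mul_zero, mul_neg] at e1 e2 e3 e4
  have e5 : h ^ (-(2 * s + 2)) = h ^ (-2 * s) / h ^ 2 := by
    rw [← Real.rpow_natCast, ← Real.rpow_sub hh]
    congr 1; push_cast; ring
  rw [planeLap, planeLap, e1, e2, e3, e4, e5]
  field_simp

theorem planeLap_ker_neg (s θ h : ℝ) (z : ℝ × ℝ) :
    planeLap θ h (ker s) (-z) = planeLap θ h (ker s) z := by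
  have e : ∀ v, secDiff (ker s) v (-z) = secDiff (ker s) v z := by
    intro v
    rw [secDiff, secDiff, ker_neg, ← ker_neg s (z + v), ← ker_neg s (z - v),
      show -(z + v) = -z - v by abel, show -(z - v) = -z + v by abel]
    ring
  simp only [planeLap, e]

theorem integrable_planeLap_ker {s : ℝ} (hs : 0 < s) (hs1 : s < 1) (θ h : ℝ) :
    Integrable (planeLap θ h (ker s)) := by
  have i := fun v => integrable_secDiff_ker hs hs1 v
  have := (((i (h, 0)).add (i (0, h))).const_mul (θ / h ^ 2)).add
    (((i (h, h)).add (i (h, -h))).const_mul ((1 - θ) / (2 * h ^ 2)))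
  refine this.neg.congr (Eventually.of_forall fun z => ?_)
  simp only [planeLap, Pi.add_apply, Pi.neg_apply]
  ring

theorem integral_planeLap_ker {s : ℝ} (hs : 0 < s) (hs1 : s < 1) (θ h : ℝ) :
    ∫ z, planeLap θ h (ker s) z = 0 := by
  have i := fun v => integrable_secDiff_ker hs hs1 v
  have i1 := i (h, 0)
  have i2 := i (0, h)
  have i3 := i (h, h)
  have i4 := i (h, -h)
  have e : ∀ z, planeLap θ h (ker s) z =
      -(θ / h ^ 2) * secDiff (ker s) (h, 0) z + -(θ / h ^ 2) * secDiff (ker s) (0, h) z +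
      -((1 - θ) / (2 * h ^ 2)) * secDiff (ker s) (h, h) z +
      -((1 - θ) / (2 * h ^ 2)) * secDiff (ker s) (h, -h) z := by
    intro z; rw [planeLap]; ring
  simp only [e]
  rw [integral_add (by fun_prop) (by fun_prop), integral_add (by fun_prop) (by fun_prop),
    integral_add (by fun_prop) (by fun_prop)]
  simp only [integral_const_mul, integral_secDiff_ker hs hs1, mul_zero, add_zero]

/-- The difference of `-Δ` and its discretization on the unit mesh, applied to the kernel. -/
def lapDefect (s θ : ℝ) (z : ℝ × ℝ) : ℝ :=
  planeLap θ 1 (ker s) z + 4 * s ^ 2 * euclidNorm z ^ (-(2 * s + 2))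

/-- Each of the two five-point stencils sums second differences over an orthogonal pair of
directions. The anisotropic parts of the Hessians cancel and the isotropic parts add up to the exact
Laplacian; the error is of fourth order. The condition |z| ≥ 3 ensures |z| ≥ 2|v| for steps of
length at most √2. -/
theorem abs_lapDefect_le {s θ : ℝ} (hs : 0 ≤ s) (hs1 : s ≤ 1) (hθ : θ ∈ Set.Icc (0 : ℝ) 1)
    {z : ℝ × ℝ} (hz : 3 ≤ euclidNorm z) :
    |lapDefect s θ z| ≤ 400 * euclidNorm z ^ (-(2 * s + 4)) := by
  have hz0 : z ≠ 0 := by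
    rintro rfl
    rw [euclidNorm_eq_zero.2 rfl] at hz
    linarith
  have hR : 0 < euclidNorm z := euclidNorm_pos hz0
  have hk := ker_nonneg s z
  have e2 := ker_div_pow s hz0 2
  have e4 := ker_div_pow s hz0 4
  push_cast at e2 e4
  have n1 : euclidNorm (1, 0) ^ 2 = 1 := by rw [euclidNorm_sq]; norm_num
  have n2 : euclidNorm (0, 1) ^ 2 = 1 := by rw [euclidNorm_sq]; norm_num
  have n3 : euclidNorm (1, 1) ^ 2 = 2 := by rw [euclidNorm_sq]; norm_num
  have n4 : euclidNorm (1, -1) ^ 2 = 2 := by rw [euclidNorm_sq]; norm_num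
  have small : ∀ v, euclidNorm v ^ 2 ≤ 2 → 2 * euclidNorm v ≤ euclidNorm z := by
    intro v hv
    nlinarith [euclidNorm_nonneg v]
  have d1 := secDiff_ker_sub_le hs hs1 hz0 (small (1, 0) (by rw [n1]; norm_num))
  have d2 := secDiff_ker_sub_le hs hs1 hz0 (small (0, 1) (by rw [n2]; norm_num))
  have d3 := secDiff_ker_sub_le hs hs1 hz0 (small (1, 1) (by rw [n3]))
  have d4 := secDiff_ker_sub_le hs hs1 hz0 (small (1, -1) (by rw [n4]))
  have p4 : ∀ v, euclidNorm v ^ 4 = (euclidNorm v ^ 2) ^ 2 := fun v => by ring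
  have q : ∀ b c : ℝ, ker s z * (4 * binCoef s 2 * b + 2 * s ^ 2 * (c / euclidNorm z ^ 2)) =
      4 * (binCoef s 2 * b * ker s z) + c * (2 * (s ^ 2 * (ker s z / euclidNorm z ^ 2))) := by
    intro b c; ring
  have q' : 4 * s ^ 2 * (ker s z / euclidNorm z ^ 2) =
      4 * (s ^ 2 * (ker s z / euclidNorm z ^ 2)) := by ring
  rw [n1, p4, n1] at d1
  rw [n2, p4, n2] at d2
  rw [n3, p4, n3] at d3
  rw [n4, p4, n4] at d4
  set κ := -(toC z)⁻¹ with hκ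
  have c1 : toC (1, 0) = 1 := by apply Complex.ext <;> simp [toC]
  have c2 : toC (0, 1) = Complex.I := by apply Complex.ext <;> simp [toC]
  have c3 : toC (1, 1) = 1 + Complex.I := by apply Complex.ext <;> simp [toC]
  have c4 : toC (1, -1) = 1 - Complex.I := by apply Complex.ext <;> simp [toC]
  -- Turning v by a right angle multiplies its complex number by ±i, hence changes the sign of the
  -- square.
  have r1 : ((toC (0, 1) * κ) ^ 2).re = -((toC (1, 0) * κ) ^ 2).re := by
    rw [c1, c2, mul_pow, Complex.I_sq, one_mul, neg_one_mul, Complex.neg_re]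
  have r2 : ((toC (1, -1) * κ) ^ 2).re = -((toC (1, 1) * κ) ^ 2).re := by
    rw [c3, c4, mul_pow, mul_pow]
    have : (1 - Complex.I) ^ 2 = -(1 + Complex.I) ^ 2 := by
      linear_combination (2 : ℂ) * Complex.I_sq
    rw [this, neg_mul, Complex.neg_re]
  rw [q] at d1 d3
  rw [r1, q] at d2
  rw [r2, q] at d4
  set T := ker s z / euclidNorm z ^ 4 with hT
  set D1 := secDiff (ker s) (1, 0) z
  set D2 := secDiff (ker s) (0, 1) z
  set D3 := secDiff (ker s) (1, 1) z
  set D4 := secDiff (ker s) (1, -1) z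
  have hT0 : 0 ≤ T := by positivity
  have s1 : |D1 + D2 - 4 * s ^ 2 * (ker s z / euclidNorm z ^ 2)| ≤ 100 * T := by
    rw [q']
    rw [abs_le] at d1 d2 ⊢
    constructor <;> linarith [d1.1, d1.2, d2.1, d2.2]
  have s2 : |(D3 + D4) / 2 - 4 * s ^ 2 * (ker s z / euclidNorm z ^ 2)| ≤ 400 * T := by
    rw [q']
    rw [abs_le] at d3 d4 ⊢
    constructor <;> linarith [d3.1, d3.2, d4.1, d4.2]
  rw [lapDefect, planeLap, ← e2, ← e4]
  have e : -(θ * (D1 + D2) / 1 ^ 2 + (1 - θ) * (D3 + D4) / (2 * 1 ^ 2)) +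
      4 * s ^ 2 * (ker s z / euclidNorm z ^ 2) =
      -(θ * (D1 + D2 - 4 * s ^ 2 * (ker s z / euclidNorm z ^ 2)) +
        (1 - θ) * ((D3 + D4) / 2 - 4 * s ^ 2 * (ker s z / euclidNorm z ^ 2))) := by ring
  rw [e, abs_neg]
  refine (abs_add_le _ _).trans ?_
  rw [abs_mul, abs_mul, abs_of_nonneg hθ.1, abs_of_nonneg (by linarith [hθ.2] : 0 ≤ 1 - θ)]
  nlinarith [hθ.1, hθ.2, mul_le_mul_of_nonneg_left s1 hθ.1,
    mul_le_mul_of_nonneg_left s2 (by linarith [hθ.2] : 0 ≤ 1 - θ)]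

theorem measurable_lapDefect (s θ : ℝ) : Measurable (lapDefect s θ) := by
  have := measurable_secDiff_ker s
  have := measurable_euclidNorm
  unfold lapDefect planeLap; fun_prop

/-- Near the origin the singular part is |z|^(-(2s+1-α)), integrable as α > 2s-1; at infinity the
product decays like |z|^(-(2s+3-α)), integrable as α ≤ 1. This integral is the constant of the
consistency estimate. -/
theorem integrable_lapDefect_mul {s θ α : ℝ} (hs : 0 < s) (hs1 : s < 1)
    (hθ : θ ∈ Set.Icc (0 : ℝ) 1) (hα : 2 * s - 1 < α) (hα1 : α ≤ 1) :
    Integrable fun z => |lapDefect s θ z| * euclidNorm z ^ (1 + α) := by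
  have hm : AEStronglyMeasurable (fun z => |lapDefect s θ z| * euclidNorm z ^ (1 + α)) :=
    ((measurable_lapDefect s θ).abs.mul (measurable_euclidNorm.pow_const _)).aestronglyMeasurable
  rw [← integrableOn_univ, ← Set.union_compl_self (square 3)]
  refine IntegrableOn.union ?_ ?_
  · have h1 := ((integrable_planeLap_ker hs hs1 θ 1).integrableOn (s := square 3)).norm.const_mul
      (6 ^ (1 + α))
    have h2 := (integrableOn_euclidNorm_rpow (a := 2 * s + 1 - α) (by linarith) (by linarith)
      3).const_mul (4 * s ^ 2)
    refine Integrable.mono' (h1.add h2) hm.restrict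
      ((ae_restrict_iff' (measurableSet_square 3)).2 ?_)
    filter_upwards [ae_coord_ne_zero] with z hz0 hz
    have hne : z ≠ 0 := by
      rintro rfl
      exact hz0.1 rfl
    have hR := euclidNorm_pos hne
    rw [mem_square] at hz
    have hR6 : euclidNorm z ≤ 6 := by linarith [euclidNorm_le z]
    rw [Real.norm_of_nonneg (by positivity)]
    have e : euclidNorm z ^ (-(2 * s + 2)) * euclidNorm z ^ (1 + α) =
        euclidNorm z ^ (-(2 * s + 1 - α)) := by
      rw [← Real.rpow_add hR]; congr 1; ring
    have h3 : |lapDefect s θ z| ≤ ‖planeLap θ 1 (ker s) z‖ +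
        4 * s ^ 2 * euclidNorm z ^ (-(2 * s + 2)) := by
      refine (abs_add_le _ _).trans_eq ?_
      rw [abs_of_nonneg (by positivity : 0 ≤ 4 * s ^ 2 * euclidNorm z ^ (-(2 * s + 2)))]
      rfl
    refine (mul_le_mul_of_nonneg_right h3 (by positivity)).trans ?_
    rw [add_mul, mul_assoc (4 * s ^ 2), e]
    simp only [Pi.add_apply]
    refine add_le_add ?_ le_rfl
    rw [mul_comm]
    refine mul_le_mul_of_nonneg_right ?_ (norm_nonneg _)
    exact Real.rpow_le_rpow hR.le hR6 (by linarith)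
  · have h := (integrableOn_compl_euclidNorm_rpow (a := 2 * s + 3 - α) (r := 3) (by linarith)
      (by norm_num)).const_mul 400
    refine Integrable.mono' h hm.restrict
      ((ae_restrict_iff' (measurableSet_square 3).compl).2 (Eventually.of_forall fun z hz => ?_))
    rw [Set.mem_compl_iff, mem_square, not_le] at hz
    have hR3 : 3 ≤ euclidNorm z := by linarith [norm_le_euclidNorm z]
    have hR : 0 < euclidNorm z := by linarith
    rw [Real.norm_of_nonneg (by positivity)]
    refine (mul_le_mul_of_nonneg_right (abs_lapDefect_le hs.le hs1.le hθ hR3)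
      (by positivity)).trans (le_of_eq ?_)
    rw [mul_assoc, ← Real.rpow_add hR]
    congr 2; ring

/-! ### Partition of unity and linear exactness of the hats -/

/-- The piecewise linear function that is `0` for `x ≤ 0` and `1` for `1 ≤ x`. -/
def ramp (x : ℝ) : ℝ := max 0 x - max 0 (x - 1)

theorem ramp_of_le {x : ℝ} (h : x ≤ 0) : ramp x = 0 := by
  rw [ramp, max_eq_left h, max_eq_left (by linarith), sub_zero]

theorem ramp_of_ge {x : ℝ} (h : 1 ≤ x) : ramp x = 1 := by
  rw [ramp, max_eq_right (by linarith), max_eq_right (by linarith)]; ring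

theorem tent_eq_ramp (x : ℝ) : tent x = ramp (x + 1) - ramp x := by
  rw [tent, ramp, ramp, add_sub_cancel_right]
  rcases le_total x 0 with h | h
  · rw [abs_of_nonpos h, max_eq_left h, max_eq_left (by linarith : x - 1 ≤ 0)]
    rw [show 1 - -x = x + 1 by ring]; ring
  · rw [abs_of_nonneg h, max_eq_right h, max_eq_right (by linarith : 0 ≤ x + 1)]
    rcases le_total x 1 with h1 | h1
    · rw [max_eq_right (by linarith), max_eq_left (by linarith)]; ring
    · rw [max_eq_left (by linarith), max_eq_right (by linarith)]; ring

/-- A hat is the difference of two consecutive shifted ramps, so the sum telescopes. -/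
theorem sum_tent {a b : ℤ} (hab : a ≤ b) (x : ℝ) :
    ∑ p ∈ Finset.Icc a b, tent (x - p) = ramp (x - a + 1) - ramp (x - b) := by
  induction b, hab using Int.leInduction with
  | base => simp [tent_eq_ramp]
  | succ n hn ih =>
    rw [← Order.succ_eq_add_one, ← Finset.insert_Icc_right_eq_Icc_succ (by simpa using by omega),
      Finset.sum_insert (by simp), ih, tent_eq_ramp]
    simp only [Order.succ_eq_add_one]
    push_cast
    rw [show x - (n + 1 : ℝ) + 1 = x - n by ring]
    ring

theorem sum_tent_eq_one {a b : ℤ} {x : ℝ} (ha : a ≤ x) (hb : x ≤ b) :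
    ∑ p ∈ Finset.Icc a b, tent (x - p) = 1 := by
  rw [sum_tent (by exact_mod_cast ha.trans hb), ramp_of_ge (by linarith),
    ramp_of_le (by linarith), sub_zero]

theorem sum_tent_le_one (a b : ℤ) (x : ℝ) : ∑ p ∈ Finset.Icc a b, tent (x - p) ≤ 1 := by
  have h0 : ∀ p ∈ Finset.Icc (min a ⌊x⌋) (max b ⌈x⌉), p ∉ Finset.Icc a b → 0 ≤ tent (x - p) :=
    fun p _ _ => tent_nonneg _
  refine (Finset.sum_le_sum_of_subset_of_nonneg
    (Finset.Icc_subset_Icc (min_le_left a ⌊x⌋) (le_max_left b ⌈x⌉)) h0).trans_eq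
    (sum_tent_eq_one ?_ ?_)
  · exact (Int.cast_le.2 (min_le_right a ⌊x⌋)).trans (Int.floor_le x)
  · exact (Int.le_ceil x).trans (Int.cast_le.2 (le_max_right b ⌈x⌉))

theorem sum_int_mul_tent {a b : ℤ} {x : ℝ} (ha : a ≤ x) (hb : x ≤ b) :
    ∑ p ∈ Finset.Icc a b, tent (x - p) * (p - x) = 0 := by
  -- Summation by parts suggests this closed form for the partial sums; between the end points it
  -- collapses to x.
  have key : ∀ c : ℤ, a ≤ c → ∑ p ∈ Finset.Icc a c, tent (x - p) * p =
      (a - 1) * ramp (x - a + 1) + max 0 (x - a + 1) - max 0 (x - c) - c * ramp (x - c) := by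
    intro c hc
    induction c, hc using Int.leInduction with
    | base =>
      simp only [Finset.Icc_self, Finset.sum_singleton, tent_eq_ramp, ramp]
      rw [add_sub_cancel_right]; ring
    | succ n hn ih =>
      rw [← Order.succ_eq_add_one, ← Finset.insert_Icc_right_eq_Icc_succ (by simpa using by omega),
        Finset.sum_insert (by simp), ih, tent_eq_ramp]
      simp only [Order.succ_eq_add_one]
      push_cast
      rw [show x - (n + 1 : ℝ) + 1 = x - n by ring]
      rw [ramp, ramp, show x - n - 1 = x - (n + 1 : ℝ) by ring]; ring
  have h1 := sum_tent_eq_one ha hb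
  have h2 := key b (by exact_mod_cast ha.trans hb)
  rw [ramp_of_ge (by linarith), ramp_of_le (by linarith), max_eq_right (by linarith),
    max_eq_left (by linarith)] at h2
  simp only [mul_sub, Finset.sum_sub_distrib, ← Finset.sum_mul, h1, h2]
  ring

/-! ### Bounded densities of bounded support and their Riesz potentials -/

/-- `f` is measurable, essentially bounded and of bounded support. -/
structure IsDensity (f : ℝ × ℝ → ℝ) : Prop where
  meas : AEStronglyMeasurable f
  bdd : ∃ C : ℝ, ∀ᵐ z, |f z| ≤ C
  supp : ∃ r : ℝ, ∀ z, z ∉ square r → f z = 0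

theorem IsDensity.add {f g : ℝ × ℝ → ℝ} (hf : IsDensity f) (hg : IsDensity g) :
    IsDensity fun z => f z + g z := by
  obtain ⟨C, hC⟩ := hf.bdd
  obtain ⟨D, hD⟩ := hg.bdd
  obtain ⟨r, hr⟩ := hf.supp
  obtain ⟨q, hq⟩ := hg.supp
  refine ⟨hf.meas.add hg.meas, ⟨C + D, ?_⟩, ⟨max r q, fun z hz => ?_⟩⟩
  · filter_upwards [hC, hD] with z h1 h2
    exact (abs_add_le _ _).trans (add_le_add h1 h2)
  · rw [mem_square, not_le, max_lt_iff] at hz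
    rw [hr z (by rw [mem_square, not_le]; exact hz.1),
      hq z (by rw [mem_square, not_le]; exact hz.2), add_zero]

theorem IsDensity.const_mul {f : ℝ × ℝ → ℝ} (hf : IsDensity f) (c : ℝ) :
    IsDensity fun z => c * f z := by
  obtain ⟨C, hC⟩ := hf.bdd
  obtain ⟨r, hr⟩ := hf.supp
  refine ⟨hf.meas.const_mul c, ⟨|c| * C, ?_⟩, ⟨r, fun z hz => by rw [hr z hz, mul_zero]⟩⟩
  filter_upwards [hC] with z h1
  rw [abs_mul]
  exact mul_le_mul_of_nonneg_left h1 (abs_nonneg c)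

theorem IsDensity.sum {ι : Type*} (t : Finset ι) {f : ι → ℝ × ℝ → ℝ}
    (hf : ∀ i ∈ t, IsDensity (f i)) : IsDensity fun z => ∑ i ∈ t, f i z := by
  classical
  induction t using Finset.induction_on with
  | empty => exact ⟨by simpa using aestronglyMeasurable_const, ⟨0, by simp⟩, ⟨0, by simp⟩⟩
  | insert a t ha ih =>
    simp only [Finset.sum_insert ha]
    exact (hf a (by simp)).add (ih fun i hi => hf i (by simp [hi]))

theorem isDensity_hat {h : ℝ} (hh : 0 < h) (w : ℝ × ℝ) : IsDensity fun z => hat h (z - w) := by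
  refine ⟨((continuous_hat hh).comp (by fun_prop)).aestronglyMeasurable,
    ⟨1, Eventually.of_forall fun z => abs_hat_le_one hh _⟩, ⟨h + ‖w‖, fun z hz => hat_eq_zero ?_⟩⟩
  rw [mem_square, not_le] at hz ⊢
  linarith [norm_le_norm_sub_add z w]

theorem isDensity_basisFun (L : ℝ) {h : ℝ} (hh : 0 < h) (p q : ℤ) :
    IsDensity (basisFun L h p q) := by
  refine ⟨(isDensity_hat hh _).meas.indicator (measurableSet_square L),
    ⟨1, Eventually.of_forall fun z => ?_⟩, ⟨L, fun z hz => Set.indicator_of_notMem hz _⟩⟩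
  by_cases hz : z ∈ square L
  · rw [basisFun, Set.indicator_of_mem hz]
    exact abs_hat_le_one hh _
  · rw [basisFun, Set.indicator_of_notMem hz, abs_zero]
    exact zero_le_one

theorem IsDensity.integrable_ker_mul {f : ℝ × ℝ → ℝ} (hf : IsDensity f) {s : ℝ} (hs : 0 ≤ s)
    (hs1 : s < 1) (x : ℝ × ℝ) : Integrable fun y => ker s (x - y) * f y := by
  obtain ⟨C, hC⟩ := hf.bdd
  obtain ⟨r, hr⟩ := hf.supp
  refine (FracDirichlet.integrable_ker_mul hs hs1 (-x) hf.meas hC hr).congr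
    (Eventually.of_forall fun y => ?_)
  simp only
  rw [← ker_neg s (-x + y), neg_add, neg_neg, ← sub_eq_add_neg]

/-- The Riesz potential of `f`, without the normalizing constant. -/
def potential (s : ℝ) (f : ℝ × ℝ → ℝ) (x : ℝ × ℝ) : ℝ := ∫ y, ker s (x - y) * f y

theorem potential_add {s : ℝ} (hs : 0 ≤ s) (hs1 : s < 1) {f g : ℝ × ℝ → ℝ} (hf : IsDensity f)
    (hg : IsDensity g) (x : ℝ × ℝ) :
    potential s (fun z => f z + g z) x = potential s f x + potential s g x := by
  simp only [potential, mul_add]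
  exact integral_add (hf.integrable_ker_mul hs hs1 x) (hg.integrable_ker_mul hs hs1 x)

theorem potential_const_mul (s c : ℝ) (f : ℝ × ℝ → ℝ) (x : ℝ × ℝ) :
    potential s (fun z => c * f z) x = c * potential s f x := by
  simp only [potential, mul_left_comm _ c]
  exact integral_const_mul _ _

theorem potential_sum {s : ℝ} (hs : 0 ≤ s) (hs1 : s < 1) {ι : Type*} (t : Finset ι)
    {f : ι → ℝ × ℝ → ℝ} (hf : ∀ i ∈ t, IsDensity (f i)) (x : ℝ × ℝ) :
    potential s (fun z => ∑ i ∈ t, f i z) x = ∑ i ∈ t, potential s (f i) x := by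
  simp only [potential, Finset.mul_sum]
  exact integral_finsetSum _ fun i hi => (hf i hi).integrable_ker_mul hs hs1 x

theorem planeLap_potential {s : ℝ} (hs : 0 ≤ s) (hs1 : s < 1) {f : ℝ × ℝ → ℝ} (hf : IsDensity f)
    (θ h : ℝ) (x : ℝ × ℝ) :
    planeLap θ h (potential s f) x = ∫ y, planeLap θ h (ker s) (x - y) * f y := by
  have i := hf.integrable_ker_mul hs hs1
  have e : ∀ v, Integrable (fun y => secDiff (ker s) v (x - y) * f y) ∧
      secDiff (potential s f) v x = ∫ y, secDiff (ker s) v (x - y) * f y := by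
    intro v
    have i1 := i (x + v)
    have i2 := i (x - v)
    have i3 := i x
    have e0 : ∀ y, secDiff (ker s) v (x - y) * f y = ker s (x + v - y) * f y +
        ker s (x - v - y) * f y - 2 * (ker s (x - y) * f y) := by
      intro y
      rw [secDiff, sub_add_eq_add_sub, sub_right_comm x y v]; ring
    simp only [e0]
    refine ⟨by fun_prop, ?_⟩
    rw [integral_sub (by fun_prop) (by fun_prop), integral_add i1 i2, integral_const_mul]
    rfl
  have i1 := (e (h, 0)).1
  have i2 := (e (0, h)).1
  have i3 := (e (h, h)).1
  have i4 := (e (h, -h)).1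
  have e1 : ∀ y, planeLap θ h (ker s) (x - y) * f y =
      -(θ / h ^ 2) * (secDiff (ker s) (h, 0) (x - y) * f y) +
      -(θ / h ^ 2) * (secDiff (ker s) (0, h) (x - y) * f y) +
      -((1 - θ) / (2 * h ^ 2)) * (secDiff (ker s) (h, h) (x - y) * f y) +
      -((1 - θ) / (2 * h ^ 2)) * (secDiff (ker s) (h, -h) (x - y) * f y) := by
    intro y; rw [planeLap]; ring
  simp only [e1]
  rw [integral_add (by fun_prop) (by fun_prop), integral_add (by fun_prop) (by fun_prop),
    integral_add (by fun_prop) (by fun_prop)]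
  simp only [integral_const_mul, ← (e _).2]
  rw [planeLap]; ring

theorem IsDensity.integrable_mul {f k : ℝ × ℝ → ℝ} (hf : IsDensity f) (hk : Integrable k) :
    Integrable fun z => k z * f z := by
  obtain ⟨C, hC⟩ := hf.bdd
  exact hk.mul_bdd (c := C) hf.meas (by simpa using hC)

theorem IsDensity.comp_add_left {f : ℝ × ℝ → ℝ} (hf : IsDensity f) (x : ℝ × ℝ) :
    IsDensity fun z => f (x + z) := by
  obtain ⟨C, hC⟩ := hf.bdd
  obtain ⟨r, hr⟩ := hf.supp
  have hq := (measurePreserving_add_left (volume : Measure (ℝ × ℝ)) x).quasiMeasurePreserving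
  refine ⟨hf.meas.comp_quasiMeasurePreserving hq, ⟨C, hq.ae hC⟩, ⟨r + ‖x‖, fun z hz => hr _ ?_⟩⟩
  rw [mem_square, not_le] at hz ⊢
  have := norm_sub_le (x + z) x
  rw [add_sub_cancel_left] at this
  linarith

theorem IsDensity.comp_neg {f : ℝ × ℝ → ℝ} (hf : IsDensity f) : IsDensity fun z => f (-z) := by
  obtain ⟨C, hC⟩ := hf.bdd
  obtain ⟨r, hr⟩ := hf.supp
  have hq := (Measure.measurePreserving_neg (volume : Measure (ℝ × ℝ))).quasiMeasurePreserving
  refine ⟨hf.meas.comp_quasiMeasurePreserving hq, ⟨C, hq.ae hC⟩, ⟨r, fun z hz => hr _ ?_⟩⟩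
  rwa [mem_square, norm_neg, ← mem_square]

/-- The discrete Laplacian of a potential, in terms of second differences of the density. -/
theorem planeLap_potential_eq {s : ℝ} (hs : 0 < s) (hs1 : s < 1) {f : ℝ × ℝ → ℝ}
    (hf : IsDensity f) (θ h : ℝ) (x : ℝ × ℝ) :
    planeLap θ h (potential s f) x = 1 / 2 * ∫ z, planeLap θ h (ker s) z * secDiff f z x := by
  have hk := integrable_planeLap_ker hs hs1 θ h
  have d1 := hf.comp_add_left x
  have i1 := d1.integrable_mul hk
  have i2 := d1.comp_neg.integrable_mul hk
  simp only [← sub_eq_add_neg] at i2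
  have e1 : ∫ z, planeLap θ h (ker s) z * f (x - z) = planeLap θ h (potential s f) x := by
    rw [planeLap_potential hs.le hs1 hf,
      ← integral_sub_left_eq_self (fun y => planeLap θ h (ker s) (x - y) * f y) volume x]
    simp only [sub_sub_cancel]
  have e2 : ∫ z, planeLap θ h (ker s) z * f (x + z) = planeLap θ h (potential s f) x := by
    rw [← e1, ← integral_neg_eq_self]
    simp only [planeLap_ker_neg, ← sub_eq_add_neg]
  -- The discrete Laplacian of the kernel is even, so f(x+z) and f(x-z) contribute equally, and it
  -- has integral zero, so subtracting 2f(x) costs nothing.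
  have e3 : ∀ z, planeLap θ h (ker s) z * secDiff f z x = planeLap θ h (ker s) z * f (x + z) +
      planeLap θ h (ker s) z * f (x - z) - 2 * f x * planeLap θ h (ker s) z := by
    intro z; rw [secDiff]; ring
  simp only [e3]
  rw [integral_sub (by fun_prop) (by fun_prop), integral_add i1 i2, integral_const_mul, e1, e2,
    integral_planeLap_ker hs hs1]
  ring

/-- Rescaling of an integral over the plane. -/
theorem integral_smul_plane {h : ℝ} (hh : 0 < h) (F : ℝ × ℝ → ℝ) :
    ∫ z, F z = h ^ 2 * ∫ z, F (h • z) := by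
  have := Measure.integral_comp_smul (volume : Measure (ℝ × ℝ)) F h
  simp only [Module.finrank_prod, Module.finrank_self, Nat.reduceAdd, smul_eq_mul] at this
  rw [this, abs_of_pos (by positivity)]
  field_simp

/-- Homogeneity of degree -(2s+2) together with the area factor h². The power h^(-2s) is what an
error in the density loses when it passes through the scheme. -/
theorem integral_abs_planeLap_ker (s θ : ℝ) {h : ℝ} (hh : 0 < h) :
    ∫ z, |planeLap θ h (ker s) z| = h ^ (-2 * s) * ∫ z, |planeLap θ 1 (ker s) z| := by
  rw [integral_smul_plane hh]
  simp only [planeLap_ker_smul s θ hh, abs_mul, integral_const_mul]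
  rw [abs_of_pos (by positivity), ← mul_assoc, ← Real.rpow_natCast, ← Real.rpow_add hh]
  congr 2; push_cast; ring

/-- The error of the discrete Laplacian of a potential is small where the density is small. -/
theorem abs_planeLap_potential_le {s : ℝ} (hs : 0 < s) (hs1 : s < 1) {f : ℝ × ℝ → ℝ}
    (hf : IsDensity f) (θ : ℝ) {h : ℝ} (hh : 0 < h) {B : ℝ} (hB : ∀ z, |f z| ≤ B) (x : ℝ × ℝ) :
    |planeLap θ h (potential s f) x| ≤ B * (h ^ (-2 * s) * ∫ z, |planeLap θ 1 (ker s) z|) := by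
  rw [planeLap_potential hs.le hs1 hf, ← integral_abs_planeLap_ker s θ hh,
    ← integral_sub_left_eq_self (fun z => |planeLap θ h (ker s) z|) volume x, ← integral_const_mul]
  have hk := ((integrable_planeLap_ker hs hs1 θ h).comp_sub_left x).abs.const_mul B
  rw [← Real.norm_eq_abs]
  refine norm_integral_le_of_norm_le hk (Eventually.of_forall fun y => ?_)
  rw [norm_mul, mul_comm]
  exact mul_le_mul_of_nonneg_right (hB y) (norm_nonneg _)

/-! ### Regularity of the solution and bilinear interpolation -/

theorem convex_square (r : ℝ) : Convex ℝ (square r) := by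
  rw [square_eq]; exact convex_closedBall 0 r

theorem square_subset {r q : ℝ} (h : r ≤ q) : square r ⊆ square q := fun z hz => by
  rw [mem_square] at hz ⊢; exact hz.trans h

/-- The mean value inequality on the segment from x to y, after the derivative at x is subtracted:
along it the derivative deviates by at most |M||y-x|^α. -/
theorem IsC1Holder.taylor {α r : ℝ} {u : ℝ × ℝ → ℝ} (h : IsC1Holder α u (square r))
    (hα : 0 ≤ α) : ∃ M : ℝ, 0 ≤ M ∧ ∀ x ∈ square r, ∀ y ∈ square r,
      |u y - u x - fderivWithin ℝ u (square r) x (y - x)| ≤ M * euclidNorm (y - x) ^ (1 + α) := by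
  obtain ⟨hu, M, hM⟩ := h
  refine ⟨|M|, abs_nonneg M, fun x hx y hy => ?_⟩
  have hd := hu.differentiableOn one_ne_zero
  have hsub : segment ℝ x y ⊆ square r := (convex_square r).segment_subset hx hy
  have hb : ∀ ξ ∈ segment ℝ x y, ‖fderivWithin ℝ u (square r) ξ - fderivWithin ℝ u (square r) x‖ ≤
      |M| * euclidNorm (y - x) ^ α := by
    intro ξ hξ
    refine (hM ξ (hsub hξ) x hx).trans (mul_le_mul (le_abs_self M) ?_
      (Real.rpow_nonneg (euclidNorm_nonneg _) _) (abs_nonneg M))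
    rw [segment_eq_image'] at hξ
    obtain ⟨t, ht, rfl⟩ := hξ
    simp only [add_sub_cancel_left]
    rw [euclidNorm_smul, abs_of_nonneg ht.1]
    refine Real.rpow_le_rpow (mul_nonneg ht.1 (euclidNorm_nonneg _)) ?_ hα
    exact mul_le_of_le_one_left (euclidNorm_nonneg _) ht.2
  have := (convex_segment x y).norm_image_sub_le_of_norm_hasFDerivWithin_le'
    (fun ξ hξ => (hd ξ (hsub hξ)).hasFDerivWithinAt.mono hsub) hb
    (left_mem_segment ℝ x y) (right_mem_segment ℝ x y)
  rw [← Real.norm_eq_abs]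
  refine this.trans ?_
  rcases eq_or_ne (y - x) 0 with h0 | h0
  · rw [h0, norm_zero, mul_zero]
    have := euclidNorm_nonneg 0
    positivity
  · rw [add_comm 1 α, Real.rpow_add (euclidNorm_pos h0), Real.rpow_one, ← mul_assoc]
    have := euclidNorm_nonneg (y - x)
    exact mul_le_mul_of_nonneg_left (norm_le_euclidNorm _) (by positivity)

theorem IsDirichletSolution.isDensity_data {s L : ℝ} {f g u : ℝ × ℝ → ℝ}
    (hu : IsDirichletSolution s L f g u) : IsDensity g := by
  refine ⟨hu.g_memLp.1, ⟨(eLpNormEssSup g volume).toReal, ?_⟩, ?_⟩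
  · have h := hu.g_memLp.2
    rw [eLpNorm_exponent_top] at h
    filter_upwards [ae_le_eLpNormEssSup (f := g) (μ := volume)] with z hz
    rw [← Real.norm_eq_abs, ← toReal_enorm]
    exact ENNReal.toReal_mono h.ne hz
  · obtain ⟨r, hr⟩ := hu.g_support.subset_closedBall 0
    refine ⟨r, fun z hz => ?_⟩
    by_contra h
    exact hz (by rw [square_eq]; exact hr h)

theorem IsDirichletSolution.isDensity {s L : ℝ} {f g u : ℝ × ℝ → ℝ}
    (hu : IsDirichletSolution s L f g u) (hc : ContinuousOn u (square L)) : IsDensity u := by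
  have h1 : IsDensity ((square L).indicator u) := by
    obtain ⟨C, hC⟩ := (isCompact_square L).exists_bound_of_continuousOn hc
    refine ⟨(aestronglyMeasurable_indicator_iff (measurableSet_square L)).2
      (hc.aestronglyMeasurable (measurableSet_square L)),
      ⟨max C 0, Eventually.of_forall fun z => ?_⟩, ⟨L, fun z hz => Set.indicator_of_notMem hz _⟩⟩
    by_cases hz : z ∈ square L
    · rw [Set.indicator_of_mem hz]
      exact (hC z hz).trans (le_max_left _ _)
    · rw [Set.indicator_of_notMem hz, abs_zero]
      exact le_max_right _ _
  convert h1.add hu.isDensity_data using 2 with z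
  by_cases hz : z ∈ square L
  · rw [Set.indicator_of_mem hz, hu.g_eq_zero z hz, add_zero]
  · rw [Set.indicator_of_notMem hz, hu.exterior z hz, zero_add]

theorem abs_secDiff_le_of_taylor {α r M : ℝ} {u : ℝ × ℝ → ℝ} {D : ℝ × ℝ → ℝ × ℝ →L[ℝ] ℝ}
    (h : ∀ x ∈ square r, ∀ y ∈ square r,
      |u y - u x - D x (y - x)| ≤ M * euclidNorm (y - x) ^ (1 + α))
    {x z : ℝ × ℝ} (hx : ‖x‖ + ‖z‖ ≤ r) :
    |secDiff u z x| ≤ 2 * M * euclidNorm z ^ (1 + α) := by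
  have h0 : x ∈ square r := mem_square.2 (by linarith [norm_nonneg z])
  have h1 := h x h0 (x + z) (mem_square.2 ((norm_add_le _ _).trans hx))
  have h2 := h x h0 (x - z) (mem_square.2 ((norm_sub_le _ _).trans hx))
  rw [add_sub_cancel_left] at h1
  rw [sub_sub_cancel_left, map_neg, euclidNorm_neg] at h2
  rw [secDiff]
  rw [abs_le] at h1 h2 ⊢
  constructor <;> linarith [h1.1, h1.2, h2.1, h2.2]

/-- Second differences of `u` are of order `1 + α`, uniformly on `Ω`. -/
theorem IsDirichletSolution.abs_secDiff_le {s L δ α : ℝ} {f g u : ℝ × ℝ → ℝ}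
    (hu : IsDirichletSolution s L f g u) (hδ : 0 < δ) (hα : 0 ≤ α)
    (hr : IsC1Holder α u (square (L + δ))) : ∃ M : ℝ, 0 ≤ M ∧ ∀ x ∈ square L,
      (∀ z, ‖z‖ ≤ δ → |secDiff u z x| ≤ M * euclidNorm z ^ (1 + α)) ∧
        ∀ᵐ z, |secDiff u z x| ≤ M * euclidNorm z ^ (1 + α) := by
  obtain ⟨M, hM0, hM⟩ := hr.taylor hα
  have hc := hr.1.continuousOn.mono (square_subset (by linarith : L ≤ L + δ))
  obtain ⟨B, hB⟩ := (hu.isDensity hc).bdd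
  obtain ⟨B', hB'⟩ := (isCompact_square L).exists_bound_of_continuousOn hc
  -- Beyond distance δ a second difference is merely bounded by K almost everywhere. There |z|^(1+α)
  -- ≥ δ^(1+α), so the constant K/δ^(1+α) puts this crude bound into the same form as the Taylor
  -- bound.
  set K := 2 * |B| + 2 * |B'|
  have hK : 0 ≤ K := by positivity
  have hδα : 0 < δ ^ (1 + α) := by positivity
  refine ⟨2 * M + K / δ ^ (1 + α), by positivity, fun x hx => ?_⟩
  have hx' := mem_square.1 hx
  have h1 : ∀ z, ‖z‖ ≤ δ →
      |secDiff u z x| ≤ (2 * M + K / δ ^ (1 + α)) * euclidNorm z ^ (1 + α) := by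
    intro z hz
    refine (abs_secDiff_le_of_taylor hM (by linarith)).trans ?_
    have := euclidNorm_nonneg z
    refine mul_le_mul_of_nonneg_right ?_ (by positivity)
    have : 0 ≤ K / δ ^ (1 + α) := by positivity
    linarith
  refine ⟨h1, ?_⟩
  have hq1 := (measurePreserving_add_left (volume : Measure (ℝ × ℝ)) x).quasiMeasurePreserving
  have hq2 :=
    (Measure.measurePreserving_sub_left (volume : Measure (ℝ × ℝ)) x).quasiMeasurePreserving
  filter_upwards [hq1.ae hB, hq2.ae hB] with z hz1 hz2
  rcases le_or_gt ‖z‖ δ with hz | hz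
  · exact h1 z hz
  have hz3 : δ ^ (1 + α) ≤ euclidNorm z ^ (1 + α) :=
    Real.rpow_le_rpow hδ.le (hz.le.trans (norm_le_euclidNorm z)) (by linarith)
  have h4 : |secDiff u z x| ≤ K := by
    have hb1 := le_abs_self B
    have hb2 := le_abs_self B'
    have h5 := hB' x hx
    rw [Real.norm_eq_abs] at h5
    rw [secDiff]
    rw [abs_le] at hz1 hz2 h5 ⊢
    constructor <;> linarith [h5.1, h5.2, hz1.1, hz1.2, hz2.1, hz2.2]
  calc |secDiff u z x| ≤ K / δ ^ (1 + α) * δ ^ (1 + α) := by rwa [div_mul_cancel₀ _ hδα.ne']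
    _ ≤ K / δ ^ (1 + α) * euclidNorm z ^ (1 + α) :=
        mul_le_mul_of_nonneg_left hz3 (by positivity)
    _ ≤ _ := mul_le_mul_of_nonneg_right (by linarith) (by have := euclidNorm_nonneg z; positivity)

theorem sub_node (L : ℝ) {h : ℝ} (hh : h ≠ 0) (y : ℝ × ℝ) (p q : ℤ) :
    y - node L h p q = h • ((y.1 + L) / h - p, (y.2 + L) / h - q) := by
  ext <;> simp only [node, Prod.fst_sub, Prod.snd_sub, Prod.smul_mk, smul_eq_mul] <;>
    field_simp <;> ring

theorem hat_sub_node (L : ℝ) {h : ℝ} (hh : 0 < h) (y : ℝ × ℝ) (p q : ℤ) :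
    hat h (y - node L h p q) = tent ((y.1 + L) / h - p) * tent ((y.2 + L) / h - q) := by
  rw [sub_node L hh.ne', hat_smul hh, hat_one]

theorem sum_product_mul (A B : Finset ℤ) (f g : ℤ → ℝ) :
    ∑ r ∈ A ×ˢ B, f r.1 * g r.2 = (∑ p ∈ A, f p) * ∑ q ∈ B, g q := by
  rw [Finset.sum_product, Finset.sum_mul_sum]

/-- Bilinear interpolation is of order `1 + α` on `Ω`. -/
theorem abs_interpolation_sub_le {α L δ M : ℝ} {u : ℝ × ℝ → ℝ} {D : ℝ × ℝ → ℝ × ℝ →L[ℝ] ℝ}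
    (hδ : 0 ≤ δ) (hα : 0 ≤ α) (hM : 0 ≤ M) (ht : ∀ x ∈ square (L + δ), ∀ y ∈ square (L + δ),
      |u y - u x - D x (y - x)| ≤ M * euclidNorm (y - x) ^ (1 + α))
    (hL : 0 < L) {N : ℕ} (hN : 0 < N) {y : ℝ × ℝ} (hy : y ∈ square L) :
    |∑ r ∈ Finset.Icc (0 : ℤ) N ×ˢ Finset.Icc (0 : ℤ) N,
        u (node L (meshSize L N) r.1 r.2) * basisFun L (meshSize L N) r.1 r.2 y - u y| ≤
      M * (2 * meshSize L N) ^ (1 + α) := by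
  have hN' : (0 : ℝ) < N := by exact_mod_cast hN
  set h := meshSize L N with hdef
  have hh : 0 < h := by rw [hdef, meshSize]; positivity
  have hhN : h * N = 2 * L := by rw [hdef, meshSize]; field_simp
  set t₁ := (y.1 + L) / h with ht₁
  set t₂ := (y.2 + L) / h with ht₂
  have hy1 := hy.1
  have hy2 := hy.2
  have hb : ∀ a : ℝ, a ∈ Set.Icc (-L) L →
      ((0 : ℤ) : ℝ) ≤ (a + L) / h ∧ (a + L) / h ≤ ((N : ℤ) : ℝ) := by
    intro a ha
    refine ⟨by have := ha.1; push_cast; apply div_nonneg <;> linarith, ?_⟩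
    rw [div_le_iff₀ hh]
    push_cast
    linarith [ha.2]
  obtain ⟨a1, b1⟩ := hb _ hy1
  obtain ⟨a2, b2⟩ := hb _ hy2
  have p1 := sum_tent_eq_one a1 b1
  have p2 := sum_tent_eq_one a2 b2
  have m1 := sum_int_mul_tent a1 b1
  have m2 := sum_int_mul_tent a2 b2
  rw [← ht₁] at p1 m1
  rw [← ht₂] at p2 m2
  set T := Finset.Icc (0 : ℤ) N ×ˢ Finset.Icc (0 : ℤ) N
  set w : ℤ × ℤ → ℝ := fun r => hat h (y - node L h r.1 r.2) with hw
  have hw0 : ∀ r, 0 ≤ w r := fun r => hat_nonneg hh _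
  have hwe : ∀ r : ℤ × ℤ, w r = tent (t₁ - r.1) * tent (t₂ - r.2) :=
    fun r => hat_sub_node L hh y _ _
  have s0 : ∑ r ∈ T, w r = 1 := by
    simp only [hwe, T]
    rw [sum_product_mul _ _ (fun p : ℤ => tent (t₁ - p)) fun q : ℤ => tent (t₂ - q), p1, p2,
      one_mul]
  -- Hats reproduce affine functions. The linear Taylor term at y thus drops out of the
  -- interpolation error, and only the remainders at nodes within one mesh width survive.
  have s1 : ∑ r ∈ T, w r • (node L h r.1 r.2 - y) = 0 := by
    have e : ∀ r : ℤ × ℤ, w r • (node L h r.1 r.2 - y) =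
        (h * ((tent (t₁ - r.1) * (r.1 - t₁)) * tent (t₂ - r.2)),
          h * (tent (t₁ - r.1) * (tent (t₂ - r.2) * (r.2 - t₂)))) := by
      intro r
      rw [← neg_sub y, sub_node L hh.ne', hwe, ← ht₁, ← ht₂]
      ext <;> simp only [Prod.smul_mk, Prod.neg_mk, smul_eq_mul] <;> ring
    simp only [e, T]
    rw [Prod.ext_iff]
    constructor
    · rw [Prod.fst_sum, ← Finset.mul_sum]
      rw [sum_product_mul _ _ (fun p : ℤ => tent (t₁ - p) * (p - t₁)) fun q : ℤ => tent (t₂ - q),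
        m1, zero_mul, mul_zero]
      rfl
    · rw [Prod.snd_sum, ← Finset.mul_sum]
      rw [sum_product_mul _ _ (fun p : ℤ => tent (t₁ - p)) fun q : ℤ => tent (t₂ - q) * (q - t₂),
        m2, mul_zero, mul_zero]
      rfl
  have hyK : y ∈ square (L + δ) := square_subset (by linarith) hy
  have s2 : ∑ r ∈ T, u (node L h r.1 r.2) * basisFun L h r.1 r.2 y - u y =
      ∑ r ∈ T, w r * (u (node L h r.1 r.2) - u y - D y (node L h r.1 r.2 - y)) := by
    have e : ∀ r : ℤ × ℤ, w r * (u (node L h r.1 r.2) - u y - D y (node L h r.1 r.2 - y)) =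
        u (node L h r.1 r.2) * basisFun L h r.1 r.2 y - w r * u y -
          D y (w r • (node L h r.1 r.2 - y)) := by
      intro r
      rw [basisFun, Set.indicator_of_mem hy, map_smul, smul_eq_mul]
      simp only [hw]
      ring
    simp only [e, Finset.sum_sub_distrib, ← Finset.sum_mul, s0, ← map_sum, s1, map_zero]
    ring
  rw [s2]
  refine (Finset.abs_sum_le_sum_abs _ _).trans ?_
  calc ∑ r ∈ T, |w r * (u (node L h r.1 r.2) - u y - D y (node L h r.1 r.2 - y))| ≤
      ∑ r ∈ T, w r * (M * (2 * h) ^ (1 + α)) := by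
        refine Finset.sum_le_sum fun r hr => ?_
        rw [abs_mul, abs_of_nonneg (hw0 r)]
        by_cases hz : y - node L h r.1 r.2 ∈ square h
        · refine mul_le_mul_of_nonneg_left ?_ (hw0 r)
          have hn : node L h r.1 r.2 ∈ square L := by
            simp only [T, Finset.mem_product, Finset.mem_Icc] at hr
            have c : ∀ k : ℤ, 0 ≤ k → k ≤ N → -L + k * h ∈ Set.Icc (-L) L := by
              intro k hk1 hk2
              have hk1' : (0 : ℝ) ≤ k := by exact_mod_cast hk1
              have hk2' : (k : ℝ) ≤ N := by exact_mod_cast hk2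
              constructor
              · nlinarith
              · nlinarith
            exact ⟨c _ hr.1.1 hr.1.2, c _ hr.2.1 hr.2.2⟩
          refine (ht y hyK _ (square_subset (by linarith) hn)).trans
            (mul_le_mul_of_nonneg_left ?_ hM)
          refine Real.rpow_le_rpow (euclidNorm_nonneg _) ?_ (by linarith)
          rw [euclidNorm_sub_comm]
          rw [mem_square] at hz
          linarith [euclidNorm_le (y - node L h r.1 r.2)]
        · have : w r = 0 := hat_eq_zero hz
          rw [this, zero_mul, zero_mul]
    _ = M * (2 * h) ^ (1 + α) := by rw [← Finset.sum_mul, s0, one_mul]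

/-! ### The fractional Laplacian as an integral of second differences -/

/-- The factor 4s² matches -Δ|z|^(-2s) = -4s²|z|^(-2s-2), so the two normalisations agree and the
leading kernels cancel in the consistency error. -/
theorem fracConst_eq {s : ℝ} (hs : 0 < s) (hs1 : s < 1) :
    fracConst s = 4 * s ^ 2 * fracConst (s - 1) := by
  have h1 : Real.Gamma (1 + s) = s * Real.Gamma s := by
    rw [add_comm]; exact Real.Gamma_add_one hs.ne'
  have h2 : Real.Gamma (1 - (s - 1)) = (1 - s) * Real.Gamma (1 - s) := by
    rw [show 1 - (s - 1) = 1 - s + 1 by ring]; exact Real.Gamma_add_one (by linarith)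
  have h3 : (2 : ℝ) ^ (2 * s) = 4 * 2 ^ (2 * (s - 1)) := by
    rw [show 2 * s = 2 + 2 * (s - 1) by ring, Real.rpow_add two_pos]
    norm_num
  have h4 : Real.Gamma (1 - s) ≠ 0 := (Real.Gamma_pos_of_pos (by linarith)).ne'
  have h5 : 1 - s ≠ 0 := by linarith
  rw [fracConst, fracConst, h1, h2, h3, abs_of_pos hs, abs_of_neg (by linarith),
    show 1 + (s - 1) = s by ring]
  field_simp
  ring

/-- Symmetrisation under z ↦ -z turns first differences into second ones, which are small enough to
make the singular integral absolutely convergent. -/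
theorem integral_even_mul_sub {k f : ℝ × ℝ → ℝ} (hk : Integrable k) (he : ∀ z, k (-z) = k z)
    (hf : IsDensity f) (x : ℝ × ℝ) :
    ∫ y, k (x - y) * (f x - f y) = -(1 / 2) * ∫ z, k z * secDiff f z x := by
  have d1 := hf.comp_add_left x
  have i1 := d1.integrable_mul hk
  have i2 := d1.comp_neg.integrable_mul hk
  simp only [← sub_eq_add_neg] at i2
  have e1 : ∫ y, k (x - y) * (f x - f y) = ∫ z, (f x * k z - k z * f (x - z)) := by
    rw [← integral_sub_left_eq_self (fun y => k (x - y) * (f x - f y)) volume x]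
    simp only [sub_sub_cancel]
    congr 1; ext z; ring
  have e2 : ∫ z, k z * f (x + z) = ∫ z, k z * f (x - z) := by
    rw [← integral_neg_eq_self]
    simp only [he, ← sub_eq_add_neg]
  have e3 : ∀ z, k z * secDiff f z x = k z * f (x + z) + k z * f (x - z) - 2 * f x * k z := by
    intro z; rw [secDiff]; ring
  simp only [e1, e3]
  rw [integral_sub (by fun_prop) (by fun_prop), integral_sub (by fun_prop) (by fun_prop),
    integral_add i1 i2, integral_const_mul, integral_const_mul, e2]
  ring

theorem IsDensity.aestronglyMeasurable_secDiff {f : ℝ × ℝ → ℝ} (hf : IsDensity f) (x : ℝ × ℝ) :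
    AEStronglyMeasurable fun z => secDiff f z x := by
  have d1 := hf.comp_add_left x
  have h1 := d1.meas
  have h2 := d1.comp_neg.meas
  simp only [← sub_eq_add_neg] at h2
  exact (h1.add h2).sub aestronglyMeasurable_const

theorem IsDensity.exists_secDiff_le {f : ℝ × ℝ → ℝ} (hf : IsDensity f) (x : ℝ × ℝ) :
    ∃ B : ℝ, ∀ᵐ z, |secDiff f z x| ≤ B := by
  have d1 := hf.comp_add_left x
  obtain ⟨B, hB⟩ := d1.bdd
  obtain ⟨B', hB'⟩ := d1.comp_neg.bdd
  refine ⟨B + B' + 2 * |f x|, ?_⟩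
  filter_upwards [hB, hB'] with z h1 h2
  rw [← sub_eq_add_neg] at h2
  rw [secDiff]
  refine (abs_sub _ _).trans (add_le_add ((abs_add_le _ _).trans (add_le_add h1 h2)) ?_)
  rw [abs_mul, abs_two]

theorem integrable_rpow_mul_secDiff {s α M : ℝ} (hs : 0 < s) (hα : 2 * s - 1 < α)
    (hα1 : α ≤ 1) {f : ℝ × ℝ → ℝ} (hf : IsDensity f) {x : ℝ × ℝ}
    (hM : ∀ᵐ z, |secDiff f z x| ≤ M * euclidNorm z ^ (1 + α)) :
    Integrable fun z => euclidNorm z ^ (-(2 * s + 2)) * secDiff f z x := by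
  have hm : AEStronglyMeasurable fun z => euclidNorm z ^ (-(2 * s + 2)) * secDiff f z x :=
    ((measurable_euclidNorm.pow_const _).aestronglyMeasurable).mul
      (hf.aestronglyMeasurable_secDiff x)
  rw [← integrableOn_univ, ← Set.union_compl_self (square 1)]
  refine IntegrableOn.union ?_ ?_
  · have h := (integrableOn_euclidNorm_rpow (a := 2 * s + 1 - α) (by linarith) (by linarith)
      1).const_mul M
    refine Integrable.mono' h hm.restrict (ae_restrict_of_ae ?_)
    filter_upwards [hM, ae_coord_ne_zero] with z hz hz0
    have hR := euclidNorm_pos (show z ≠ 0 by rintro rfl; exact hz0.1 rfl)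
    rw [norm_mul, Real.norm_of_nonneg (by positivity), Real.norm_eq_abs]
    refine (mul_le_mul_of_nonneg_left hz (by positivity)).trans_eq ?_
    rw [mul_left_comm, ← Real.rpow_add hR]
    congr 2; ring
  · obtain ⟨B, hB⟩ := hf.exists_secDiff_le x
    have h := (integrableOn_compl_euclidNorm_rpow (a := 2 * s + 2) (by linarith)
      one_pos).const_mul B
    refine Integrable.mono' h hm.restrict (ae_restrict_of_ae ?_)
    filter_upwards [hB] with z hz
    have := euclidNorm_nonneg z
    rw [norm_mul, Real.norm_of_nonneg (by positivity), Real.norm_eq_abs, mul_comm]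
    exact mul_le_mul_of_nonneg_right hz (by positivity)

/-- The kernel of the fractional Laplacian, cut off near the origin. -/
def truncKer (s ε : ℝ) (z : ℝ × ℝ) : ℝ :=
  {z : ℝ × ℝ | ε < euclidNorm z}.indicator (fun z => euclidNorm z ^ (-(2 * s + 2))) z

theorem truncKer_neg (s ε : ℝ) (z : ℝ × ℝ) : truncKer s ε (-z) = truncKer s ε z := by
  simp only [truncKer, Set.indicator_apply, Set.mem_ofPred_eq, euclidNorm_neg]

theorem measurableSet_lt_euclidNorm (ε : ℝ) :
    MeasurableSet {z : ℝ × ℝ | ε < euclidNorm z} :=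
  measurableSet_lt measurable_const measurable_euclidNorm

theorem integrable_truncKer {s ε : ℝ} (hs : 0 < s) (hε : 0 < ε) : Integrable (truncKer s ε) := by
  refine IntegrableOn.integrable_indicator ?_ (measurableSet_lt_euclidNorm ε)
  refine (integrableOn_compl_euclidNorm_rpow (a := 2 * s + 2) (by linarith)
    (half_pos hε)).mono_set fun z hz => ?_
  rw [Set.mem_compl_iff, mem_square, not_le]
  have := euclidNorm_le z
  have : ε < euclidNorm z := hz
  linarith

/-- The fractional Laplacian in terms of second differences. -/
theorem HasFracLaplacianAt.eq_integral {s α M : ℝ} (hs : 0 < s)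
    (hα : 2 * s - 1 < α) (hα1 : α ≤ 1) {u : ℝ × ℝ → ℝ} (hu : IsDensity u) {x : ℝ × ℝ} {l : ℝ}
    (hl : HasFracLaplacianAt s u x l)
    (hM : ∀ᵐ z, |secDiff u z x| ≤ M * euclidNorm z ^ (1 + α)) :
    l = fracConst s * (-(1 / 2) * ∫ z, euclidNorm z ^ (-(2 * s + 2)) * secDiff u z x) := by
  have hi := integrable_rpow_mul_secDiff hs hα hα1 hu hM
  refine tendsto_nhds_unique hl (Tendsto.const_mul _ ?_)
  have h1 : ∀ ε : ℝ, 0 < ε → ∫ y in {y : ℝ × ℝ | ε < euclidNorm (x - y)},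
      (u x - u y) / euclidNorm (x - y) ^ (2 + 2 * s) =
      -(1 / 2) * ∫ z, truncKer s ε z * secDiff u z x := by
    intro ε hε
    have hms : MeasurableSet {y : ℝ × ℝ | ε < euclidNorm (x - y)} :=
      measurableSet_lt measurable_const
        (measurable_euclidNorm.comp (measurable_const.sub measurable_id))
    rw [← integral_even_mul_sub (integrable_truncKer hs hε) (truncKer_neg s ε) hu,
      ← integral_indicator hms]
    congr 1; ext y
    simp only [Set.indicator_apply, truncKer, Set.mem_ofPred_eq]
    split_ifs
    · rw [Real.rpow_neg (euclidNorm_nonneg _), add_comm (2 : ℝ), div_eq_inv_mul]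
    · rw [zero_mul]
  -- With second differences the full integrand is integrable and dominates its truncations, so the
  -- principal value is an ordinary integral.
  have h2 : Tendsto (fun ε : ℝ => -(1 / 2) * ∫ z, truncKer s ε z * secDiff u z x) (𝓝[>] 0)
      (𝓝 (-(1 / 2) * ∫ z, euclidNorm z ^ (-(2 * s + 2)) * secDiff u z x)) := by
    refine Tendsto.const_mul _ (tendsto_integral_filter_of_dominated_convergence
      (fun z => |euclidNorm z ^ (-(2 * s + 2)) * secDiff u z x|) ?_ ?_ hi.abs ?_)
    · refine eventually_mem_nhdsWithin.mono fun ε hε => ?_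
      exact (integrable_truncKer hs hε).1.mul (hu.aestronglyMeasurable_secDiff x)
    · refine Eventually.of_forall fun ε => Eventually.of_forall fun z => ?_
      rw [Real.norm_eq_abs, truncKer, Set.indicator_apply]
      split_ifs
      · exact le_rfl
      · rw [zero_mul, abs_zero]; positivity
    · filter_upwards [ae_coord_ne_zero] with z hz
      have hR := euclidNorm_pos (show z ≠ 0 by rintro rfl; exact hz.1 rfl)
      refine tendsto_const_nhds.congr' ?_
      filter_upwards [nhdsWithin_le_nhds (Iio_mem_nhds hR)] with ε hε
      rw [truncKer, Set.indicator_of_mem (show z ∈ {z | ε < euclidNorm z} from hε)]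
  refine h2.congr' (eventually_mem_nhdsWithin.mono fun ε hε => (h1 ε hε).symm)

theorem planeLap_add_smul (s θ : ℝ) {h : ℝ} (hh : 0 < h) (z : ℝ × ℝ) :
    planeLap θ h (ker s) (h • z) + 4 * s ^ 2 * euclidNorm (h • z) ^ (-(2 * s + 2)) =
      h ^ (-(2 * s + 2)) * lapDefect s θ z := by
  rw [planeLap_ker_smul s θ hh, euclidNorm_smul, abs_of_pos hh,
    Real.mul_rpow hh.le (euclidNorm_nonneg z), lapDefect]
  ring

/-- The discrete Laplacian of the potential of a solution is close to its fractional Laplacian. -/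
theorem abs_planeLap_potential_sub_le {s θ α M : ℝ} (hs : 0 < s) (hs1 : s < 1)
    (hθ : θ ∈ Set.Icc (0 : ℝ) 1) (hα : 2 * s - 1 < α) (hα1 : α ≤ 1) {u : ℝ × ℝ → ℝ}
    (hu : IsDensity u) {x : ℝ × ℝ} {l : ℝ} (hl : HasFracLaplacianAt s u x l)
    (hM : ∀ᵐ z, |secDiff u z x| ≤ M * euclidNorm z ^ (1 + α)) {h : ℝ} (hh : 0 < h) :
    |fracConst (s - 1) * planeLap θ h (potential s u) x - l| ≤
      fracConst (s - 1) * (M * (∫ z, |lapDefect s θ z| * euclidNorm z ^ (1 + α))) *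
        h ^ (1 + α - 2 * s) := by
  have hc := fracConst_sub_one_pos hs hs1
  have hi := integrable_rpow_mul_secDiff hs hα hα1 hu hM
  obtain ⟨B, hB⟩ := hu.exists_secDiff_le x
  have hi2 : Integrable fun z => planeLap θ h (ker s) z * secDiff u z x :=
    (integrable_planeLap_ker hs hs1 θ h).mul_bdd (c := B) (hu.aestronglyMeasurable_secDiff x)
      (by simpa using hB)
  set D : ℝ × ℝ → ℝ := fun z =>
    planeLap θ h (ker s) z + 4 * s ^ 2 * euclidNorm z ^ (-(2 * s + 2)) with hD
  -- Both quantities integrate the same second differences; subtracting leaves the kernel D, the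
  -- difference between discrete and exact Laplacian of |z|^(-2s).
  have e1 : fracConst (s - 1) * planeLap θ h (potential s u) x - l =
      fracConst (s - 1) * (1 / 2) * ∫ z, D z * secDiff u z x := by
    have : ∀ z, D z * secDiff u z x = planeLap θ h (ker s) z * secDiff u z x +
        4 * s ^ 2 * (euclidNorm z ^ (-(2 * s + 2)) * secDiff u z x) := by
      intro z; simp only [hD]; ring
    simp only [this]
    rw [integral_add hi2 (hi.const_mul _), integral_const_mul, planeLap_potential_eq hs hs1 hu,
      hl.eq_integral hs hα hα1 hu hM, fracConst_eq hs hs1]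
    ring
  -- Rescaling to the unit mesh yields h^(-(2s+2)) h^(1+α); with the area factor h² this becomes
  -- h^(1+α-2s), the order of convergence.
  have e2 : ∀ z, |D (h • z)| * euclidNorm (h • z) ^ (1 + α) =
      h ^ (α - 2 * s - 1) * (|lapDefect s θ z| * euclidNorm z ^ (1 + α)) := by
    intro z
    simp only [hD]
    rw [planeLap_add_smul s θ hh, euclidNorm_smul, abs_of_pos hh,
      Real.mul_rpow hh.le (euclidNorm_nonneg z), abs_mul, abs_of_pos (by positivity),
      show α - 2 * s - 1 = -(2 * s + 2) + (1 + α) by ring,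
      Real.rpow_add hh (-(2 * s + 2))]
    ring
  have hi3 : Integrable fun z => |D z| * euclidNorm z ^ (1 + α) := by
    rw [← integrable_comp_smul_iff _ _ hh.ne']
    simp only [e2]
    exact (integrable_lapDefect_mul hs hs1 hθ hα hα1).const_mul _
  have e3 : ∫ z, |D z| * euclidNorm z ^ (1 + α) =
      h ^ (1 + α - 2 * s) * ∫ z, |lapDefect s θ z| * euclidNorm z ^ (1 + α) := by
    rw [integral_smul_plane hh]
    simp only [e2, integral_const_mul]
    rw [← mul_assoc, ← Real.rpow_natCast, ← Real.rpow_add hh]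
    congr 2; push_cast; ring
  have e4 : |∫ z, D z * secDiff u z x| ≤ M * ∫ z, |D z| * euclidNorm z ^ (1 + α) := by
    rw [← integral_const_mul, ← Real.norm_eq_abs]
    refine norm_integral_le_of_norm_le (hi3.const_mul M) ?_
    filter_upwards [hM] with z hz
    rw [norm_mul, Real.norm_eq_abs, Real.norm_eq_abs, mul_left_comm]
    exact mul_le_mul_of_nonneg_left hz (abs_nonneg _)
  rw [e1, abs_mul, abs_of_pos (by positivity)]
  rw [e3] at e4
  have h0 := abs_nonneg (∫ z, D z * secDiff u z x)
  calc fracConst (s - 1) * (1 / 2) * |∫ z, D z * secDiff u z x| ≤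
      fracConst (s - 1) * |∫ z, D z * secDiff u z x| := by nlinarith
    _ ≤ _ := mul_le_mul_of_nonneg_left e4 hc.le
    _ = _ := by ring

/-! ### The scheme as a discrete Laplacian of a potential -/

theorem discLap_congr {θ h : ℝ} {v w : ℤ → ℤ → ℝ} {i j : ℤ}
    (H : ∀ a b : ℤ, |a - i| ≤ 1 → |b - j| ≤ 1 → v a b = w a b) :
    discLap θ h v i j = discLap θ h w i j := by
  simp only [discLap]
  rw [H (i - 1) j, H (i + 1) j, H i (j + 1), H i (j - 1), H i j, H (i - 1) (j - 1),
    H (i + 1) (j - 1), H (i - 1) (j + 1), H (i + 1) (j + 1)] <;> simp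

theorem discLap_add (θ h : ℝ) (v w : ℤ → ℤ → ℝ) (i j : ℤ) :
    discLap θ h (fun a b => v a b + w a b) i j = discLap θ h v i j + discLap θ h w i j := by
  simp only [discLap]; ring

theorem discLap_const_mul (θ h c : ℝ) (v : ℤ → ℤ → ℝ) (i j : ℤ) :
    discLap θ h (fun a b => c * v a b) i j = c * discLap θ h v i j := by
  simp only [discLap]; ring

theorem discLap_sum {ι : Type*} (t : Finset ι) (θ h : ℝ) (v : ι → ℤ → ℤ → ℝ) (i j : ℤ) :
    discLap θ h (fun a b => ∑ k ∈ t, v k a b) i j = ∑ k ∈ t, discLap θ h (v k) i j := by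
  classical
  induction t using Finset.induction_on with
  | empty => simp [discLap]
  | insert k t hk ih => simp only [Finset.sum_insert hk, discLap_add, ih]

theorem discLap_reflect (θ h : ℝ) (v : ℤ → ℤ → ℝ) (p q i j : ℤ) :
    discLap θ h (fun a b => v (p - a) (q - b)) i j = discLap θ h v (p - i) (q - j) := by
  have e1 : ∀ a b : ℤ, a - (b - 1) = a - b + 1 := fun a b => by ring
  have e2 : ∀ a b : ℤ, a - (b + 1) = a - b - 1 := fun a b => by ring
  simp only [discLap, e1, e2]
  ring

theorem node_sub_node (L h : ℝ) (p q i j : ℤ) :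
    node L h p q - node L h i j = (((p - i : ℤ) : ℝ) * h, ((q - j : ℤ) : ℝ) * h) := by
  ext <;> simp [node] <;> ring

/-- The weights are values at nodes of potentials of hats. This is why the matrix, applied to nodal
values, is the discrete Laplacian of one potential. -/
theorem omegaBar_eq_potential (s L h : ℝ) (p q i j : ℤ) :
    omegaBar s h (p - i) (q - j) =
      fracConst (s - 1) * potential s (fun z => hat h (z - node L h p q)) (node L h i j) := by
  rw [omegaBar, potential, setIntegral_eq_integral_of_forall_compl_eq_zero fun z hz => by
      rw [hat_eq_zero hz, mul_zero],
    ← integral_add_right_eq_self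
      (fun y => ker s (node L h i j - y) * hat h (y - node L h p q)) (node L h p q)]
  congr 2; ext z
  rw [add_sub_cancel_right, ← ker_neg, ← node_sub_node L, ker]
  congr 3
  abel

theorem basisFun_eq_hat {L h : ℝ} {N : ℕ} (hh : 0 ≤ h) (hN : h * N = 2 * L) {p q : ℤ}
    (hp : 1 ≤ p) (hp' : p + 1 ≤ N) (hq : 1 ≤ q) (hq' : q + 1 ≤ N) :
    basisFun L h p q = fun z => hat h (z - node L h p q) := by
  ext z
  rw [basisFun, Set.indicator_apply_eq_self]
  intro hz
  refine hat_eq_zero fun hz' => hz ?_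
  have c : ∀ (k : ℤ) (t : ℝ), 1 ≤ k → k + 1 ≤ N → t - (-L + k * h) ∈ Set.Icc (-h) h →
      t ∈ Set.Icc (-L) L := by
    intro k t hk1 hk2 ht
    have hk1' : (1 : ℝ) ≤ k := by exact_mod_cast hk1
    have hk2' : (k : ℝ) + 1 ≤ N := by exact_mod_cast hk2
    constructor
    · nlinarith [ht.1]
    · nlinarith [ht.2]
  exact ⟨c p z.1 hp hp' hz'.1, c q z.2 hq hq' hz'.2⟩

theorem one_le_num {N : ℕ} (a : Fin (N - 1)) : 1 ≤ num a := by
  simp only [num]; omega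

theorem num_add_one_le {N : ℕ} (a : Fin (N - 1)) : num a + 1 ≤ N := by
  have := a.2
  simp only [num]; omega

theorem num_injective {N : ℕ} : Function.Injective (num : Fin (N - 1) → ℤ) := fun a b h => by
  simp only [num] at h
  ext
  omega

theorem exists_num_eq {N : ℕ} {p : ℤ} (h1 : 1 ≤ p) (h2 : p + 1 ≤ N) :
    ∃ a : Fin (N - 1), num a = p :=
  ⟨⟨(p - 1).toNat, by omega⟩, by simp only [num]; omega⟩

theorem sum_nodes (N : ℕ) (F : ℤ × ℤ → ℝ) :
    ∑ r ∈ Finset.Icc (0 : ℤ) N ×ˢ Finset.Icc (0 : ℤ) N, F r =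
      ∑ r ∈ boundaryIdx N, F r + ∑ b : InnerIdx N, F (num b.1, num b.2) := by
  rw [boundaryIdx, ← Finset.sum_filter_add_sum_filter_not _
    (fun r : ℤ × ℤ => r.1 * r.2 * (r.1 - N) * (r.2 - N) = 0)]
  congr 1
  symm
  refine Finset.sum_bij (fun b _ => (num b.1, num b.2)) ?_ ?_ ?_ fun _ _ => rfl
  · intro b _
    have h1 := one_le_num b.1
    have h2 := num_add_one_le b.1
    have h3 := one_le_num b.2
    have h4 := num_add_one_le b.2
    simp only [Finset.mem_filter, Finset.mem_product, Finset.mem_Icc, mul_eq_zero, not_or]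
    omega
  · intro a _ b _ h
    rw [Prod.mk.injEq] at h
    exact Prod.ext (num_injective h.1) (num_injective h.2)
  · intro r hr
    simp only [Finset.mem_filter, Finset.mem_product, Finset.mem_Icc, mul_eq_zero, not_or] at hr
    obtain ⟨a, ha⟩ := exists_num_eq (N := N) (p := r.1) (by omega) (by omega)
    obtain ⟨b, hb⟩ := exists_num_eq (N := N) (p := r.2) (by omega) (by omega)
    exact ⟨(a, b), Finset.mem_univ _, by rw [ha, hb]⟩

/-- The exterior data plus the bilinear interpolant of `u`. -/
def interpolant (L : ℝ) (N : ℕ) (g u : ℝ × ℝ → ℝ) (y : ℝ × ℝ) : ℝ :=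
  g y + ∑ r ∈ Finset.Icc (0 : ℤ) N ×ˢ Finset.Icc (0 : ℤ) N,
    u (node L (meshSize L N) r.1 r.2) * basisFun L (meshSize L N) r.1 r.2 y

theorem isDensity_interpolant {L : ℝ} {N : ℕ} (hh : 0 < meshSize L N) {g : ℝ × ℝ → ℝ}
    (hg : IsDensity g) (u : ℝ × ℝ → ℝ) : IsDensity (interpolant L N g u) :=
  hg.add (IsDensity.sum _ fun r _ => (isDensity_basisFun L hh r.1 r.2).const_mul _)

/-- The sum supplies the interior hats, the data term the boundary hats and g; together they are the
whole interpolant. The term c u(x_i,y_j) comes from the sum if the node is interior and from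
`dataTermM` if it lies on the boundary, so the identity holds uniformly for 0 ≤ i, j ≤ N. -/
theorem sum_omegaBarM_add {s L c : ℝ} {N : ℕ} (hs : 0 ≤ s) (hs1 : s < 1) (hL : 0 < L)
    (hN : 0 < N) {g : ℝ × ℝ → ℝ} (hg : IsDensity g) (u : ℝ × ℝ → ℝ) {i j : ℤ}
    (hi : i ∈ Finset.Icc (0 : ℤ) N) (hj : j ∈ Finset.Icc (0 : ℤ) N) :
    ∑ b : InnerIdx N, nodalValues L N u b *
        omegaBarM s c (meshSize L N) (num b.1 - i) (num b.2 - j) +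
      dataTermM s c L N g u i j =
    fracConst (s - 1) * potential s (interpolant L N g u) (node L (meshSize L N) i j) +
      c * u (node L (meshSize L N) i j) := by
  have hN' : (0 : ℝ) < N := by exact_mod_cast hN
  have hh : 0 < meshSize L N := by rw [meshSize]; positivity
  have hhN : meshSize L N * N = 2 * L := by rw [meshSize]; field_simp
  have hb := fun r : ℤ × ℤ => isDensity_basisFun L hh r.1 r.2
  have hc := sum_nodes N fun r => if r = (i, j) then c * u (node L (meshSize L N) r.1 r.2) else 0
  rw [Finset.sum_ite_eq', Finset.sum_ite_eq', if_pos (Finset.mk_mem_product hi hj)] at hc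
  have hp := sum_nodes N fun r => u (node L (meshSize L N) r.1 r.2) *
    (fracConst (s - 1) * potential s (basisFun L (meshSize L N) r.1 r.2)
      (node L (meshSize L N) i j))
  have e0 : potential s (interpolant L N g u) (node L (meshSize L N) i j) =
      potential s g (node L (meshSize L N) i j) +
      ∑ r ∈ Finset.Icc (0 : ℤ) N ×ˢ Finset.Icc (0 : ℤ) N, u (node L (meshSize L N) r.1 r.2) *
        potential s (basisFun L (meshSize L N) r.1 r.2) (node L (meshSize L N) i j) := by
    rw [show interpolant L N g u = fun y => g y + ∑ r ∈ Finset.Icc (0 : ℤ) N ×ˢ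
        Finset.Icc (0 : ℤ) N, u (node L (meshSize L N) r.1 r.2) *
        basisFun L (meshSize L N) r.1 r.2 y from rfl,
      potential_add hs hs1 hg (IsDensity.sum _ fun r _ => (hb r).const_mul _),
      potential_sum hs hs1 _ fun r _ => (hb r).const_mul _]
    simp only [potential_const_mul]
  have e1 : dataTerm s L N g u i j = fracConst (s - 1) *
      potential s g (node L (meshSize L N) i j) +
      ∑ r ∈ boundaryIdx N, u (node L (meshSize L N) r.1 r.2) *
        (fracConst (s - 1) * potential s (basisFun L (meshSize L N) r.1 r.2)
          (node L (meshSize L N) i j)) := by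
    have : ∀ r : ℤ × ℤ, ∫ y, euclidNorm (node L (meshSize L N) i j - y) ^ (-2 * s) *
        (u (node L (meshSize L N) r.1 r.2) * basisFun L (meshSize L N) r.1 r.2 y) =
        u (node L (meshSize L N) r.1 r.2) * potential s (basisFun L (meshSize L N) r.1 r.2)
          (node L (meshSize L N) i j) := fun r => potential_const_mul s _ _ _
    rw [dataTerm]
    simp only [this, Finset.mul_sum, mul_left_comm (fracConst (s - 1))]
    rfl
  have e2 : ∀ b : InnerIdx N, nodalValues L N u b *
        omegaBarM s c (meshSize L N) (num b.1 - i) (num b.2 - j) =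
      u (node L (meshSize L N) (num b.1) (num b.2)) *
        (fracConst (s - 1) * potential s (basisFun L (meshSize L N) (num b.1) (num b.2))
          (node L (meshSize L N) i j)) +
      if (num b.1, num b.2) = (i, j) then c * u (node L (meshSize L N) (num b.1) (num b.2))
        else 0 := by
    intro b
    rw [omegaBarM, omegaBar_eq_potential s L, basisFun_eq_hat hh.le hhN (one_le_num _)
      (num_add_one_le _) (one_le_num _) (num_add_one_le _), nodalValues, mul_add, mul_ite, mul_zero,
      mul_comm _ c]
    simp only [sub_eq_zero, Prod.mk.injEq]
  rw [dataTermM, e0, e1]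
  simp only [e2, Finset.sum_add_distrib]
  simp only [mul_left_comm _ (fracConst (s - 1)), ← Finset.mul_sum] at hp ⊢
  have : (if (i, j) ∈ boundaryIdx N then c * u (node L (meshSize L N) (i, j).1 (i, j).2) else 0) =
    if (i, j) ∈ boundaryIdx N then c * u (node L (meshSize L N) i j) else 0 := rfl
  linarith

theorem schemeMatrix_mulVec (s θ c h : ℝ) (N : ℕ) (U : InnerIdx N → ℝ) (a : InnerIdx N) :
    (schemeMatrix s θ c h N).mulVec U a = discLap θ h (fun i j => ∑ b : InnerIdx N,
      U b * omegaBarM s c h (num b.1 - i) (num b.2 - j)) (num a.1) (num a.2) := by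
  rw [discLap_sum]
  simp only [discLap_const_mul, discLap_reflect]
  simp only [Matrix.mulVec, dotProduct, schemeMatrix, weightM, mul_comm]

/-- The scheme applied to the exact solution. -/
theorem scheme_apply {s θ L c : ℝ} {N : ℕ} (hs : 0 ≤ s) (hs1 : s < 1) (hL : 0 < L) (hN : 0 < N)
    {g : ℝ × ℝ → ℝ} (hg : IsDensity g) (u : ℝ × ℝ → ℝ) (a : InnerIdx N) :
    (schemeMatrix s θ c (meshSize L N) N).mulVec (nodalValues L N u) a +
        schemeData s θ c L N g u a =
      fracConst (s - 1) * planeLap θ (meshSize L N) (potential s (interpolant L N g u))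
        (node L (meshSize L N) (num a.1) (num a.2)) +
      c * planeLap θ (meshSize L N) u (node L (meshSize L N) (num a.1) (num a.2)) := by
  rw [schemeMatrix_mulVec, schemeData, ← discLap_add, ← discLap_node, ← discLap_node,
    ← discLap_const_mul, ← discLap_const_mul, ← discLap_add]
  -- The neighbours of an interior node have indices in 0, …, N, which is the range where the
  -- identity is available.
  refine discLap_congr fun i j hi hj => sum_omegaBarM_add hs hs1 hL hN hg u ?_ ?_
  · have h1 := one_le_num a.1
    have h2 := num_add_one_le a.1
    rw [abs_le] at hi
    rw [Finset.mem_Icc]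
    omega
  · have h1 := one_le_num a.2
    have h2 := num_add_one_le a.2
    rw [abs_le] at hj
    rw [Finset.mem_Icc]
    omega

/-! ### The weights sum to zero, and row sums stay away from zero -/

/-- The integral of the discrete Laplacian of the kernel against the hat function of a node. -/
theorem discLap_omegaBar {s : ℝ} (hs : 0 ≤ s) (hs1 : s < 1) (θ : ℝ) {h : ℝ} (hh : 0 < h)
    (p q : ℤ) : discLap θ h (omegaBar s h) p q =
      fracConst (s - 1) * ∫ z, planeLap θ h (ker s) z * hat h (z - node 0 h p q) := by
  have h1 := discLap_reflect θ h (omegaBar s h) 0 0 (-p) (-q)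
  simp only [omegaBar_eq_potential s 0, discLap_const_mul] at h1
  rw [discLap_node, planeLap_potential hs hs1 (isDensity_hat hh _),
    ← integral_add_left_eq_self
      (fun y => planeLap θ h (ker s) (node 0 h (-p) (-q) - y) * hat h (y - node 0 h 0 0))
      (node 0 h (-p) (-q))] at h1
  have e : ∀ y : ℝ × ℝ, node 0 h (-p) (-q) + y - node 0 h 0 0 = y - node 0 h p q := by
    intro y
    ext <;> simp [node] <;> ring
  simp only [sub_add_cancel_left, planeLap_ker_neg, e, zero_sub, neg_neg] at h1
  exact h1.symm

/-- The mass of a single node. -/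
def pointMass (c : ℝ) (p q : ℤ) : ℝ := if p = 0 ∧ q = 0 then c else 0

theorem weightM_eq_add (s θ c h : ℝ) (p q : ℤ) :
    weightM s θ c h p q = discLap θ h (omegaBar s h) p q + discLap θ h (pointMass c) p q :=
  discLap_add θ h (omegaBar s h) (pointMass c) p q

/-- The indices `(p, q)` with `|p|, |q| ≤ R`. -/
def box (R : ℕ) : Finset (ℤ × ℤ) :=
  Finset.Icc (-(R : ℤ)) R ×ˢ Finset.Icc (-(R : ℤ)) R

theorem mem_box {R : ℕ} {r : ℤ × ℤ} : r ∈ box R ↔ |r.1| ≤ R ∧ |r.2| ≤ R := by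
  simp only [box, Finset.mem_product, Finset.mem_Icc, abs_le]

/-- A box with R ≥ 1 contains all nine shifts of the point mass, and the coefficients of the stencil
sum to zero. -/
theorem sum_discLap_pointMass (θ h c : ℝ) {R : ℕ} (hR : 1 ≤ R) :
    ∑ r ∈ box R, discLap θ h (pointMass c) r.1 r.2 = 0 := by
  have e : ∀ a b : ℤ, |a| ≤ 1 → |b| ≤ 1 →
      ∑ r ∈ box R, pointMass c (r.1 + a) (r.2 + b) = c := by
    intro a b ha hb
    have h1 : ∀ r : ℤ × ℤ, pointMass c (r.1 + a) (r.2 + b) = if r = (-a, -b) then c else 0 := by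
      intro r
      simp only [pointMass, Prod.ext_iff, add_eq_zero_iff_eq_neg]
    simp only [h1]
    rw [Finset.sum_ite_eq', if_pos]
    rw [mem_box, abs_neg, abs_neg]
    omega
  have e00 := e 0 0 (by simp) (by simp)
  have e10 := e 1 0 (by simp) (by simp)
  have e20 := e (-1) 0 (by simp) (by simp)
  have e01 := e 0 1 (by simp) (by simp)
  have e02 := e 0 (-1) (by simp) (by simp)
  have e11 := e 1 1 (by simp) (by simp)
  have e12 := e 1 (-1) (by simp) (by simp)
  have e21 := e (-1) 1 (by simp) (by simp)
  have e22 := e (-1) (-1) (by simp) (by simp)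
  simp only [add_zero, ← sub_eq_add_neg] at e00 e10 e20 e01 e02 e11 e12 e21 e22
  simp only [discLap, Finset.sum_add_distrib, ← Finset.mul_sum, ← Finset.sum_div,
    Finset.sum_neg_distrib, Finset.sum_sub_distrib]
  simp only [e00, e10, e20, e01, e02, e11, e12, e21, e22]
  ring

theorem sum_hat_box {h : ℝ} (hh : 0 < h) (R : ℕ) (z : ℝ × ℝ) :
    ∑ r ∈ box R, hat h (z - node 0 h r.1 r.2) =
      (∑ p ∈ Finset.Icc (-(R : ℤ)) R, tent (z.1 / h - p)) *
        ∑ q ∈ Finset.Icc (-(R : ℤ)) R, tent (z.2 / h - q) := by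
  simp only [hat_sub_node 0 hh, add_zero]
  exact sum_product_mul _ _ (fun p : ℤ => tent (z.1 / h - p)) fun q : ℤ => tent (z.2 / h - q)

theorem eventually_sum_tent_eq_one (x : ℝ) :
    ∀ᶠ R : ℕ in atTop, ∑ p ∈ Finset.Icc (-(R : ℤ)) R, tent (x - p) = 1 := by
  filter_upwards [eventually_ge_atTop ⌈|x|⌉₊] with R hR
  have h1 : |x| ≤ R := (Nat.le_ceil _).trans (by exact_mod_cast hR)
  rw [abs_le] at h1
  refine sum_tent_eq_one ?_ ?_ <;> push_cast <;> linarith [h1.1, h1.2]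

/-- The weights of the scheme sum up to zero. -/
theorem tendsto_sum_weightM {s : ℝ} (hs : 0 < s) (hs1 : s < 1) (θ c : ℝ) {h : ℝ} (hh : 0 < h) :
    Tendsto (fun R : ℕ => ∑ r ∈ box R, weightM s θ c h r.1 r.2) atTop (𝓝 0) := by
  have hk := integrable_planeLap_ker hs hs1 θ h
  have h1 : ∀ᶠ R : ℕ in atTop, fracConst (s - 1) * ∫ z, planeLap θ h (ker s) z *
      ∑ r ∈ box R, hat h (z - node 0 h r.1 r.2) = ∑ r ∈ box R, weightM s θ c h r.1 r.2 := by
    filter_upwards [eventually_ge_atTop 1] with R hR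
    simp only [weightM_eq_add, Finset.sum_add_distrib, sum_discLap_pointMass θ h c hR, add_zero,
      discLap_omegaBar hs.le hs1 θ hh, ← Finset.mul_sum]
    rw [← integral_finsetSum _ fun r _ => (isDensity_hat hh _).integrable_mul hk]
    simp only [Finset.mul_sum]
  refine Tendsto.congr' h1 ?_
  -- The partial sums of hats lie between 0 and 1 and converge to 1, so dominated convergence leaves
  -- the integral of the discrete Laplacian of the kernel, which is zero.
  have h2 : Tendsto (fun R : ℕ => ∫ z, planeLap θ h (ker s) z *
      ∑ r ∈ box R, hat h (z - node 0 h r.1 r.2)) atTop (𝓝 (∫ z, planeLap θ h (ker s) z)) := by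
    refine tendsto_integral_of_dominated_convergence (fun z => |planeLap θ h (ker s) z|) ?_
      hk.abs ?_ ?_
    · intro R
      exact hk.1.mul (IsDensity.sum _ fun r _ => isDensity_hat hh _).meas
    · refine fun R => Eventually.of_forall fun z => ?_
      rw [norm_mul, Real.norm_eq_abs, sum_hat_box hh]
      refine mul_le_of_le_one_right (abs_nonneg _) ?_
      have n : ∀ x : ℝ, 0 ≤ ∑ p ∈ Finset.Icc (-(R : ℤ)) R, tent (x - p) :=
        fun x => Finset.sum_nonneg fun p _ => tent_nonneg _
      rw [Real.norm_of_nonneg (mul_nonneg (n _) (n _))]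
      exact mul_le_one₀ (sum_tent_le_one _ _ _) (n _) (sum_tent_le_one _ _ _)
    · refine Eventually.of_forall fun z => tendsto_const_nhds.congr' ?_
      filter_upwards [eventually_sum_tent_eq_one (z.1 / h),
        eventually_sum_tent_eq_one (z.2 / h)] with R h1 h2
      rw [sum_hat_box hh, h1, h2, mul_one, mul_one]
  rw [integral_planeLap_ker hs hs1] at h2
  simpa using h2.const_mul (fracConst (s - 1))

/-- The total is zero and everything outside `S ∪ F` is negative, so the sum over this union is
nonnegative. With F the omitted distant indices this bounds a row sum from below. -/
theorem neg_sum_le_sum_of_tendsto {w : ℤ × ℤ → ℝ} (hw : ∀ r, r ≠ 0 → w r < 0)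
    (ht : Tendsto (fun R : ℕ => ∑ r ∈ box R, w r) atTop (𝓝 0)) {S F : Finset (ℤ × ℤ)}
    (hS : 0 ∈ S) (hd : Disjoint S F) : -∑ r ∈ F, w r ≤ ∑ r ∈ S, w r := by
  classical
  suffices 0 ≤ ∑ r ∈ S ∪ F, w r by
    rw [Finset.sum_union hd] at this
    linarith
  refine le_of_tendsto ht ?_
  filter_upwards [eventually_ge_atTop ((S ∪ F).sup fun r => r.1.natAbs + r.2.natAbs)] with R hR
  have hsub : S ∪ F ⊆ box R := by
    intro r hr
    have h1 := (Finset.le_sup (f := fun r : ℤ × ℤ => r.1.natAbs + r.2.natAbs) hr).trans hR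
    rw [mem_box, Int.abs_eq_natAbs, Int.abs_eq_natAbs]
    omega
  rw [← Finset.sum_sdiff hsub]
  refine add_le_of_nonpos_left (Finset.sum_nonpos fun r hr => (hw r ?_).le)
  rintro rfl
  exact (Finset.mem_sdiff.1 hr).2 (Finset.mem_union_left _ hS)

/-- The discrete Laplacian of the kernel is negative far from the origin. -/
theorem planeLap_ker_le {s θ : ℝ} (hs : 0 < s) (hs1 : s < 1) (hθ : θ ∈ Set.Icc (0 : ℝ) 1)
    {z : ℝ × ℝ} (hz : 3 + 200 / s ^ 2 ≤ euclidNorm z) :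
    planeLap θ 1 (ker s) z ≤ -(2 * s ^ 2 * euclidNorm z ^ (-(2 * s + 2))) := by
  have hq : 0 < 200 / s ^ 2 := by positivity
  have hR : 0 < euclidNorm z := by linarith
  have h1 := (le_abs_self _).trans
    (abs_lapDefect_le hs.le hs1.le hθ (by linarith : 3 ≤ euclidNorm z))
  have h2 : euclidNorm z ^ (-(2 * s + 2)) =
      euclidNorm z ^ (-(2 * s + 4)) * euclidNorm z ^ 2 := by
    rw [← Real.rpow_natCast, ← Real.rpow_add hR]
    congr 1; push_cast; ring
  -- This is the condition under which the defect 400R^(-2s-4) is at most half of the main term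
  -- 4s²R^(-2s-2).
  have h3 : 200 ≤ s ^ 2 * euclidNorm z ^ 2 := by
    rw [← div_le_iff₀' (by positivity)]
    nlinarith
  have h4 : 0 < euclidNorm z ^ (-(2 * s + 4)) := by positivity
  rw [lapDefect] at h1
  nlinarith [mul_le_mul_of_nonneg_left h3 h4.le]

/-- The pointwise estimate `planeLap_ker_le` is averaged over a hat. Its support has half-width 1,
hence 4 = 3 + 1 in the hypothesis, and K bounds the Euclidean norm there as twice the sup norm. -/
theorem discLap_omegaBar_le {s θ : ℝ} (hs : 0 < s) (hs1 : s < 1) (hθ : θ ∈ Set.Icc (0 : ℝ) 1)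
    {h K : ℝ} (hh : 0 < h) {p q : ℤ} (hp : 4 + 200 / s ^ 2 ≤ p)
    (hpK : 2 * (p + 1) ≤ K) (hqK : 2 * (q + 1) ≤ K) (hq : 0 ≤ q) :
    discLap θ h (omegaBar s h) p q ≤
      -(fracConst (s - 1) * (2 * s ^ 2) * (K ^ (-(2 * s + 2)) * h ^ (-2 * s))) := by
  have hc := fracConst_sub_one_pos hs hs1
  have hs2 : 0 < 200 / s ^ 2 := by positivity
  set v : ℝ × ℝ := ((p : ℝ), (q : ℝ)) with hv
  have e1 : ∫ z, planeLap θ h (ker s) z * hat h (z - node 0 h p q) =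
      h ^ (-2 * s) * ∫ z, planeLap θ 1 (ker s) (z + v) * hat 1 z := by
    have e : ∀ z : ℝ × ℝ, h • z - node 0 h p q = h • (z - v) := by
      intro z
      ext <;> simp [node, hv] <;> ring
    rw [integral_smul_plane hh]
    simp only [planeLap_ker_smul s θ hh, e, hat_smul hh, mul_assoc, integral_const_mul]
    rw [← integral_sub_right_eq_self (fun z => planeLap θ 1 (ker s) (z + v) * hat 1 z)
      v, ← mul_assoc, ← Real.rpow_natCast, ← Real.rpow_add hh]
    simp only [sub_add_cancel]
    congr 2; push_cast; ring
  have e2 : ∫ z, planeLap θ 1 (ker s) (z + v) * hat 1 z ≤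
      ∫ z, -(2 * s ^ 2 * K ^ (-(2 * s + 2))) * hat 1 z := by
    have hd := isDensity_hat one_pos 0
    simp only [sub_zero] at hd
    have i1 := hd.integrable_mul ((integrable_planeLap_ker hs hs1 θ 1).comp_add_right
      v)
    have i2 : Integrable (hat 1) := (continuous_hat one_pos).integrable_of_hasCompactSupport
      (HasCompactSupport.intro (isCompact_square 1) fun z hz => hat_eq_zero hz)
    refine integral_mono i1 (i2.const_mul _) fun z => ?_
    by_cases hz : z ∈ square 1
    · refine mul_le_mul_of_nonneg_right ?_ (hat_nonneg one_pos z)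
      have hz1 := hz.1
      have hz2 := hz.2
      rw [Set.mem_Icc] at hz1 hz2
      have hq' : (0 : ℝ) ≤ q := by exact_mod_cast hq
      have n1 : 3 + 200 / s ^ 2 ≤ euclidNorm (z + v) := by
        refine le_trans ?_ (norm_le_euclidNorm _)
        refine le_trans ?_ (norm_fst_le _)
        refine le_trans ?_ (le_abs_self _)
        rw [Prod.fst_add, hv]
        simp only
        linarith
      have n2 : euclidNorm (z + v) ≤ K := by
        refine (euclidNorm_le _).trans ?_
        have : ‖z + v‖ ≤ K / 2 := by
          rw [Prod.norm_def]
          refine max_le ?_ ?_ <;> simp only [hv, Prod.fst_add, Prod.snd_add] <;>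
            rw [Real.norm_eq_abs, abs_le] <;> constructor <;> linarith
        linarith
      refine (planeLap_ker_le hs hs1 hθ n1).trans (neg_le_neg ?_)
      refine mul_le_mul_of_nonneg_left ?_ (by positivity)
      exact Real.rpow_le_rpow_of_nonpos (by linarith) n2 (by linarith)
    · rw [hat_eq_zero hz, mul_zero, mul_zero]
  rw [integral_const_mul, integral_hat] at e2
  rw [discLap_omegaBar hs.le hs1 θ hh, e1]
  have h3 := mul_le_mul_of_nonneg_left e2
    (by positivity : 0 ≤ fracConst (s - 1) * h ^ (-2 * s))
  linarith

theorem discLap_pointMass_eq_zero (θ h c : ℝ) {p : ℤ} (q : ℤ) (hp : 2 ≤ p) :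
    discLap θ h (pointMass c) p q = 0 := by
  have : ∀ a b : ℤ, a ≠ 0 → pointMass c a b = 0 := fun a b ha => if_neg fun h => ha h.1
  simp only [discLap]
  rw [this (p - 1) q (by omega), this (p + 1) q (by omega), this p (q + 1) (by omega),
    this p (q - 1) (by omega), this p q (by omega), this (p - 1) (q - 1) (by omega),
    this (p + 1) (q - 1) (by omega), this (p - 1) (q + 1) (by omega),
    this (p + 1) (q + 1) (by omega)]
  ring

/-- The row sums of the matrix are bounded below, uniformly in the mesh. -/
theorem exists_le_sum_schemeMatrix {s θ κ L : ℝ} (hs : 0 < s) (hs1 : s < 1)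
    (hsu : Suitable s θ κ) (hL : 0 < L) : ∃ c₀ : ℝ, 0 < c₀ ∧ ∀ N : ℕ, 0 < N → ∀ a : InnerIdx N,
      c₀ ≤ ∑ b, schemeMatrix s θ (corr s κ (meshSize L N)) (meshSize L N) N a b := by
  obtain ⟨hθ, -, hw⟩ := hsu
  have hc := fracConst_sub_one_pos hs hs1
  obtain ⟨m, hm⟩ := exists_nat_ge (4 + 200 / s ^ 2)
  have hs2 : 0 < 200 / s ^ 2 := by positivity
  have hm4 : 4 ≤ m := by
    have : (4 : ℝ) ≤ m := by linarith
    exact_mod_cast this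
  have hm0 : (0 : ℝ) < m := by linarith
  refine ⟨fracConst (s - 1) * (2 * s ^ 2) * (m ^ 2 * (4 * m) ^ (-(2 * s + 2)) *
    (2 * L) ^ (-2 * s)), by positivity, fun N hN a => ?_⟩
  have hN' : (0 : ℝ) < N := by exact_mod_cast hN
  set h := meshSize L N with hdef
  have hh : 0 < h := by rw [hdef, meshSize]; positivity
  have hhN : 2 * L = N * h := by rw [hdef, meshSize]; field_simp
  set w : ℤ × ℤ → ℝ := fun r => weightM s θ (corr s κ h) h r.1 r.2 with hwdef
  -- Differences of row indices are smaller than N in absolute value, so a block starting at mN is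
  -- never met by a row. It has (mN)² indices with weights at least of size (4mN)^(-2s-2) h^(-2s),
  -- up to a constant, and the product depends on N and h only through Nh = 2L.
  set F := Finset.Ico ((m * N : ℕ) : ℤ) ((m * N + m * N : ℕ) : ℤ) ×ˢ
    Finset.Ico ((m * N : ℕ) : ℤ) ((m * N + m * N : ℕ) : ℤ) with hF
  set e : InnerIdx N → ℤ × ℤ := fun b => (num b.1 - num a.1, num b.2 - num a.2) with he
  have hinj : Function.Injective e := by
    intro b c hbc
    simp only [he, Prod.mk.injEq, sub_left_inj] at hbc
    exact Prod.ext (num_injective hbc.1) (num_injective hbc.2)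
  have hS : ∑ b, schemeMatrix s θ (corr s κ h) h N a b = ∑ r ∈ Finset.univ.image e, w r := by
    rw [Finset.sum_image fun b _ c _ hbc => hinj hbc]
    rfl
  have hNm : N ≤ m * N := Nat.le_mul_of_pos_left N (by omega)
  have hmN : m ≤ m * N := Nat.le_mul_of_pos_right m hN
  have hd : Disjoint (Finset.univ.image e) F := by
    rw [Finset.disjoint_left]
    intro r hr hrF
    obtain ⟨b, -, rfl⟩ := Finset.mem_image.1 hr
    simp only [hF, Finset.mem_product, Finset.mem_Ico, he] at hrF
    have h1 := num_add_one_le b.1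
    have h2 := one_le_num a.1
    have : ((m * N : ℕ) : ℤ) ≥ N := by exact_mod_cast hNm
    omega
  have h0 : (0 : ℤ × ℤ) ∈ Finset.univ.image e :=
    Finset.mem_image.2 ⟨a, Finset.mem_univ _, by simp [he]⟩
  have key := neg_sum_le_sum_of_tendsto (w := w) (fun r hr => (hw h hh r.1 r.2).2 fun h =>
    hr (Prod.ext h.1 h.2)) (tendsto_sum_weightM hs hs1 θ _ hh) h0 hd
  rw [hS]
  refine le_trans ?_ key
  set K : ℝ := 4 * m * N with hK
  have hFw : ∀ r ∈ F, w r ≤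
      -(fracConst (s - 1) * (2 * s ^ 2) * (K ^ (-(2 * s + 2)) * h ^ (-2 * s))) := by
    intro r hr
    simp only [hF, Finset.mem_product, Finset.mem_Ico] at hr
    have b1 : ((m * N : ℕ) : ℝ) ≤ r.1 := by exact_mod_cast hr.1.1
    have b2 : (r.1 : ℝ) + 1 ≤ ((m * N + m * N : ℕ) : ℝ) := by exact_mod_cast hr.1.2
    have b3 : (r.2 : ℝ) + 1 ≤ ((m * N + m * N : ℕ) : ℝ) := by exact_mod_cast hr.2.2
    have b4 : (m : ℝ) ≤ ((m * N : ℕ) : ℝ) := by exact_mod_cast hmN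
    push_cast at b1 b2 b3 b4
    simp only [hwdef]
    rw [weightM_eq_add, discLap_pointMass_eq_zero _ _ _ _ (by omega), add_zero]
    refine discLap_omegaBar_le hs hs1 hθ hh (by linarith) ?_ ?_ (by omega)
    · rw [hK]; linarith
    · rw [hK]; linarith
  have hcard : (F.card : ℝ) = (m * N) ^ 2 := by
    rw [hF, Finset.card_product, Int.card_Ico]
    have : (((m * N + m * N : ℕ) : ℤ) - ((m * N : ℕ) : ℤ)).toNat = m * N := by omega
    rw [this]
    push_cast
    ring
  have hsum := Finset.sum_le_card_nsmul F w _ hFw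
  rw [nsmul_eq_mul, hcard] at hsum
  refine le_trans (le_of_eq ?_) (neg_le_neg hsum)
  have e1 : (N : ℝ) ^ (-2 * s) = N ^ 2 * (N : ℝ) ^ (-(2 * s + 2)) := by
    rw [← Real.rpow_natCast, ← Real.rpow_add hN']
    congr 1; push_cast; ring
  rw [hhN, hK, Real.mul_rpow hN'.le hh.le, Real.mul_rpow (by positivity) hN'.le, e1]
  ring

/-! ### The discrete maximum principle and discrete norms -/

/-- At a nonnegative maximum of v, replacing each v b by v a can only lower the terms with
nonpositive coefficients; what remains is the row sum times v a. -/
theorem mul_le_mulVec_of_forall_le {ι : Type*} [Fintype ι] {A : Matrix ι ι ℝ} {c₀ : ℝ}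
    (hA : ∀ a b, a ≠ b → A a b ≤ 0) (hr : ∀ a, c₀ ≤ ∑ b, A a b) {v : ι → ℝ} {a : ι}
    (h0 : 0 ≤ v a) (hv : ∀ b, v b ≤ v a) : c₀ * v a ≤ A.mulVec v a := by
  refine (mul_le_mul_of_nonneg_right (hr a) h0).trans ?_
  rw [Finset.sum_mul]
  refine Finset.sum_le_sum fun b _ => ?_
  rcases eq_or_ne a b with rfl | hab
  · exact le_rfl
  · exact mul_le_mul_of_nonpos_left (hv b) (hA a b hab)

/-- The discrete maximum principle. -/
theorem abs_le_div_of_abs_mulVec_le {ι : Type*} [Fintype ι] {A : Matrix ι ι ℝ} {c₀ T : ℝ}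
    (hA : ∀ a b, a ≠ b → A a b ≤ 0) (hc : 0 < c₀) (hr : ∀ a, c₀ ≤ ∑ b, A a b) {v : ι → ℝ}
    (hT : ∀ a, |A.mulVec v a| ≤ T) (b : ι) : |v b| ≤ T / c₀ := by
  obtain ⟨a, -, ha⟩ := Finset.exists_max_image Finset.univ (fun a => |v a|) ⟨b, Finset.mem_univ b⟩
  refine (ha b (Finset.mem_univ b)).trans ?_
  rw [le_div_iff₀' hc]
  rcases le_total 0 (v a) with h | h
  · rw [abs_of_nonneg h]
    exact (mul_le_mulVec_of_forall_le hA hr h fun c => (le_abs_self _).trans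
      ((ha c (Finset.mem_univ c)).trans_eq (abs_of_nonneg h))).trans ((le_abs_self _).trans (hT a))
  · have h1 := mul_le_mulVec_of_forall_le (v := -v) hA hr (a := a)
      (by simpa using h) fun c => (neg_le_abs _).trans
        ((ha c (Finset.mem_univ c)).trans_eq (abs_of_nonpos h))
    rw [Matrix.mulVec_neg, Pi.neg_apply, Pi.neg_apply] at h1
    rw [abs_of_nonpos h]
    exact h1.trans ((neg_le_abs _).trans (hT a))

theorem mulVec_bijective {ι : Type*} [Fintype ι] [DecidableEq ι] {A : Matrix ι ι ℝ} {c₀ : ℝ}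
    (hA : ∀ a b, a ≠ b → A a b ≤ 0) (hc : 0 < c₀) (hr : ∀ a, c₀ ≤ ∑ b, A a b) :
    Function.Bijective A.mulVec := by
  have hi : Function.Injective A.mulVec := by
    intro v w hvw
    have h0 : A.mulVec (v - w) = 0 := by rw [Matrix.mulVec_sub, hvw, sub_self]
    ext b
    have := abs_le_div_of_abs_mulVec_le hA hc hr (v := v - w) (T := 0) (by simp [h0]) b
    rw [zero_div, abs_nonpos_iff, Pi.sub_apply, sub_eq_zero] at this
    exact this
  exact ⟨hi, Matrix.mulVec_surjective_iff_isUnit.2 (Matrix.mulVec_injective_iff_isUnit.1 hi)⟩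

theorem schemeMatrix_nonpos {s θ κ h : ℝ} (hsu : Suitable s θ κ) (hh : 0 < h) (N : ℕ)
    (a b : InnerIdx N) (hab : a ≠ b) : schemeMatrix s θ (corr s κ h) h N a b ≤ 0 := by
  refine ((hsu.2.2 h hh _ _).2 fun H => hab ?_).le
  exact Prod.ext (num_injective (by omega)) (num_injective (by omega))

theorem normInf_le {N : ℕ} {v : InnerIdx N → ℝ} {T : ℝ} (hT : 0 ≤ T) (hv : ∀ a, |v a| ≤ T) :
    normInf v ≤ T :=
  Real.iSup_le hv hT

theorem normTwo_le {L h : ℝ} {N : ℕ} (hh : 0 ≤ h) (hhN : h * N = 2 * L) {v : InnerIdx N → ℝ}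
    {T : ℝ} (hT : 0 ≤ T) (hv : ∀ a, |v a| ≤ T) : normTwo h v ≤ 2 * L * T := by
  rw [normTwo, ← hhN]
  refine Real.sqrt_le_iff.2 ⟨by positivity, ?_⟩
  have h1 : ∑ a, v a ^ 2 ≤ (N : ℝ) ^ 2 * T ^ 2 := by
    have h2 := Finset.sum_le_card_nsmul (Finset.univ : Finset (InnerIdx N)) (fun a => v a ^ 2)
      (T ^ 2) fun a _ => by
        rw [← sq_abs]
        exact pow_le_pow_left₀ (abs_nonneg _) (hv a) 2
    rw [nsmul_eq_mul, Finset.card_univ, Fintype.card_prod, Fintype.card_fin] at h2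
    refine h2.trans (mul_le_mul_of_nonneg_right ?_ (sq_nonneg T))
    have : (N - 1) * (N - 1) ≤ N ^ 2 := by
      rw [sq]; exact Nat.mul_le_mul (Nat.sub_le _ _) (Nat.sub_le _ _)
    exact_mod_cast this
  calc h ^ 2 * ∑ a, v a ^ 2 ≤ h ^ 2 * ((N : ℝ) ^ 2 * T ^ 2) :=
        mul_le_mul_of_nonneg_left h1 (sq_nonneg h)
    _ = (h * N * T) ^ 2 := by ring

/-! ### Consistency and convergence -/

theorem abs_planeLap_le {θ h α M : ℝ} (hθ : θ ∈ Set.Icc (0 : ℝ) 1) (hh : 0 < h) (hα : 0 ≤ α)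
    (hM : 0 ≤ M) {u : ℝ × ℝ → ℝ} {x : ℝ × ℝ}
    (hu : ∀ z, ‖z‖ ≤ h → |secDiff u z x| ≤ M * euclidNorm z ^ (1 + α)) :
    |planeLap θ h u x| ≤ 2 * M * (2 * h) ^ (1 + α) / h ^ 2 := by
  have b : ∀ z : ℝ × ℝ, ‖z‖ ≤ h → |secDiff u z x| ≤ M * (2 * h) ^ (1 + α) := fun z hz =>
    (hu z hz).trans (mul_le_mul_of_nonneg_left (Real.rpow_le_rpow (euclidNorm_nonneg z)
      (by linarith [euclidNorm_le z]) (by linarith)) hM)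
  have b1 := b (h, 0) (by simp [Prod.norm_def, abs_of_pos hh, hh.le])
  have b2 := b (0, h) (by simp [Prod.norm_def, abs_of_pos hh, hh.le])
  have b3 := b (h, h) (by simp [Prod.norm_def, abs_of_pos hh])
  have b4 := b (h, -h) (by simp [Prod.norm_def, abs_of_pos hh])
  set E := M * (2 * h) ^ (1 + α)
  have c1 : |secDiff u (h, 0) x + secDiff u (0, h) x| ≤ 2 * E :=
    (abs_add_le _ _).trans (by linarith)
  have c2 : |secDiff u (h, h) x + secDiff u (h, -h) x| ≤ 2 * E :=
    (abs_add_le _ _).trans (by linarith)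
  have hE : 0 ≤ E := (abs_nonneg _).trans b1
  have h2 : 0 ≤ 1 - θ := by linarith [hθ.2]
  have e : planeLap θ h u x = -(θ * (secDiff u (h, 0) x + secDiff u (0, h) x) +
      (1 - θ) * ((secDiff u (h, h) x + secDiff u (h, -h) x) / 2)) / h ^ 2 := by
    rw [planeLap]; field_simp
  rw [e, abs_div, abs_neg, abs_of_pos (by positivity : 0 < h ^ 2)]
  refine div_le_div_of_nonneg_right ((abs_add_le _ _).trans ?_) (by positivity)
  rw [abs_mul, abs_mul, abs_of_nonneg hθ.1, abs_of_nonneg h2, abs_div, abs_two]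
  have c3 := mul_le_mul_of_nonneg_left c1 hθ.1
  have c4 := mul_le_mul_of_nonneg_left (div_le_div_of_nonneg_right c2 zero_le_two) h2
  nlinarith [mul_nonneg h2 hE]

/-- The consistency of the scheme. -/
theorem exists_consistency {s θ κ L δ α : ℝ} (hs : 0 < s) (hs1 : s < 1)
    (hθ : θ ∈ Set.Icc (0 : ℝ) 1) (hκ : 0 ≤ κ) (hL : 0 < L) (hδ : 0 < δ) (hα0 : 0 ≤ α)
    (hα : 2 * s - 1 < α) (hα1 : α ≤ 1) {f g u : ℝ × ℝ → ℝ} (hu : IsDirichletSolution s L f g u)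
    (hr : IsC1Holder α u (square (L + δ))) : ∃ T : ℝ, 0 ≤ T ∧ ∀ N : ℕ, 0 < N →
      4 * meshSize L N < δ → ∀ a : InnerIdx N,
        |(schemeMatrix s θ (corr s κ (meshSize L N)) (meshSize L N) N).mulVec
            (nodalValues L N u) a + schemeData s θ (corr s κ (meshSize L N)) L N g u a -
          nodalValues L N f a| ≤ T * meshSize L N ^ (1 + α - 2 * s) := by
  obtain ⟨M, hM0, hM⟩ := hu.abs_secDiff_le hδ hα0 hr
  obtain ⟨M', hM0', hM'⟩ := hr.taylor hα0
  have hdu := hu.isDensity (hr.1.continuousOn.mono (square_subset (by linarith : L ≤ L + δ)))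
  have hc := fracConst_sub_one_pos hs hs1
  set c := fracConst (s - 1)
  set I₁ := ∫ z, |lapDefect s θ z| * euclidNorm z ^ (1 + α)
  set I₂ := ∫ z, |planeLap θ 1 (ker s) z|
  have hI₁ : 0 ≤ I₁ := integral_nonneg fun z => by
    have := euclidNorm_nonneg z
    positivity
  have hI₂ : 0 ≤ I₂ := integral_nonneg fun z => abs_nonneg _
  -- The three summands come from the defect of the discrete Laplacian, from the interpolation error
  -- and from the correction κh^(2-2s).
  refine ⟨c * (M * I₁) + c * (M' * 2 ^ (1 + α) * I₂) + κ * (2 * M * 2 ^ (1 + α)), by positivity,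
    fun N hN hNδ a => ?_⟩
  have hN' : (0 : ℝ) < N := by exact_mod_cast hN
  set h := meshSize L N with hdef
  have hh : 0 < h := by rw [hdef, meshSize]; positivity
  have hhN : h * N = 2 * L := by rw [hdef, meshSize]; field_simp
  set x := node L h (num a.1) (num a.2) with hx
  have hxL : x ∈ square L := by
    have k : ∀ b : Fin (N - 1), -L + num b * h ∈ Set.Icc (-L) L := by
      intro b
      have h1 : (1 : ℝ) ≤ num b := by exact_mod_cast one_le_num b
      have h2 : (num b : ℝ) + 1 ≤ N := by exact_mod_cast num_add_one_le b
      constructor <;> nlinarith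
    exact ⟨k a.1, k a.2⟩
  obtain ⟨hx1, hx2⟩ := hM x hxL
  have hdI := isDensity_interpolant (L := L) (N := N) hh hu.isDensity_data u
  have hdE : IsDensity fun y => interpolant L N g u y + -1 * u y := hdI.add (hdu.const_mul (-1))
  -- The interpolant is u plus an error that vanishes outside Ω and is O(h^(1+α)) inside; the
  -- potential is linear in the density.
  have hsplit : planeLap θ h (potential s (interpolant L N g u)) x =
      planeLap θ h (potential s u) x +
        planeLap θ h (potential s fun y => interpolant L N g u y + -1 * u y) x := by
    have e : ∀ y, potential s (fun y => interpolant L N g u y + -1 * u y) y =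
        potential s (interpolant L N g u) y - potential s u y := by
      intro y
      rw [potential_add hs.le hs1 hdI (hdu.const_mul (-1)), potential_const_mul]
      ring
    simp only [planeLap, secDiff, e]
    ring
  have hE : ∀ y, |interpolant L N g u y + -1 * u y| ≤ M' * (2 * h) ^ (1 + α) := by
    intro y
    by_cases hy : y ∈ square L
    · have := abs_interpolation_sub_le hδ.le hα0 hM0' hM' hL hN hy
      rw [interpolant, hu.g_eq_zero y hy, zero_add, neg_one_mul, ← sub_eq_add_neg]
      exact this
    · rw [interpolant, hu.exterior y hy, Finset.sum_eq_zero fun r _ => by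
        rw [basisFun, Set.indicator_of_notMem hy, mul_zero]]
      rw [add_zero, neg_one_mul, add_neg_cancel, abs_zero]
      positivity
  have t1 := abs_planeLap_potential_sub_le hs hs1 hθ hα hα1 hdu (hu.equation x hxL) hx2 hh
  have t2 := abs_planeLap_potential_le hs hs1 hdE θ hh hE x
  have t3 := abs_planeLap_le hθ hh hα0 hM0 (u := u) (x := x) fun z hz =>
    hx1 z (by linarith)
  rw [scheme_apply hs.le hs1 hL hN hu.isDensity_data, ← hx, hsplit,
    show nodalValues L N f a = f x from rfl]
  have e1 : c * (planeLap θ h (potential s u) x +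
      planeLap θ h (potential s fun y => interpolant L N g u y + -1 * u y) x) +
      corr s κ h * planeLap θ h u x - f x =
      (c * planeLap θ h (potential s u) x - f x) +
      c * planeLap θ h (potential s fun y => interpolant L N g u y + -1 * u y) x +
      corr s κ h * planeLap θ h u x := by ring
  rw [e1]
  refine (abs_add_three _ _ _).trans ?_
  rw [abs_mul c, abs_of_pos hc, abs_mul (corr s κ h), corr,
    abs_of_nonneg (by positivity : 0 ≤ κ * h ^ (2 - 2 * s))]
  have p1 : (2 * h) ^ (1 + α) * h ^ (-2 * s) = 2 ^ (1 + α) * h ^ (1 + α - 2 * s) := by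
    rw [Real.mul_rpow zero_le_two hh.le, mul_assoc, ← Real.rpow_add hh]
    congr 2; ring
  have p2 : h ^ (2 - 2 * s) * ((2 * h) ^ (1 + α) / h ^ 2) =
      2 ^ (1 + α) * h ^ (1 + α - 2 * s) := by
    rw [← p1, show 2 - 2 * s = 2 + -2 * s by ring, Real.rpow_add hh, Real.rpow_two]
    field_simp
  have q2 := mul_le_mul_of_nonneg_left t2 hc.le
  have q3 := mul_le_mul_of_nonneg_left t3 (by positivity : 0 ≤ κ * h ^ (2 - 2 * s))
  refine (add_le_add (add_le_add t1 q2) q3).trans (le_of_eq ?_)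
  have r2 : c * (M' * (2 * h) ^ (1 + α) * (h ^ (-2 * s) * I₂)) =
      c * (M' * ((2 * h) ^ (1 + α) * h ^ (-2 * s)) * I₂) := by ring
  have r3 : κ * h ^ (2 - 2 * s) * (2 * M * (2 * h) ^ (1 + α) / h ^ 2) =
      κ * (2 * M * (h ^ (2 - 2 * s) * ((2 * h) ^ (1 + α) / h ^ 2))) := by ring
  rw [r2, r3, p1, p2]
  ring

/-- The convergence of the scheme. -/
theorem exists_error_bound {s θ κ L δ α : ℝ} (hs : 0 < s) (hs1 : s < 1)
    (hsu : Suitable s θ κ) (hL : 0 < L) (hδ : 0 < δ) (hα0 : 0 ≤ α)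
    (hα : 2 * s - 1 < α) (hα1 : α ≤ 1) {f g u : ℝ × ℝ → ℝ} (hu : IsDirichletSolution s L f g u)
    (hr : IsC1Holder α u (square (L + δ))) : ∃ C : ℝ, 0 < C ∧
      ∀ N : ℕ, 0 < N → 4 * meshSize L N < δ →
        ∃ Uh : InnerIdx N → ℝ, IsSchemeSolution s θ κ L N f g u Uh ∧
          (∀ V : InnerIdx N → ℝ, IsSchemeSolution s θ κ L N f g u V → V = Uh) ∧
          normInf (nodalValues L N u - Uh) < C * meshSize L N ^ (1 + α - 2 * s) ∧
          normTwo (meshSize L N) (nodalValues L N u - Uh) <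
            C * meshSize L N ^ (1 + α - 2 * s) := by
  obtain ⟨T, hT0, hT⟩ := exists_consistency hs hs1 hsu.1 hsu.2.1 hL hδ hα0 hα hα1 hu hr
  obtain ⟨c₀, hc₀, hrow⟩ := exists_le_sum_schemeMatrix hs hs1 hsu hL
  -- T/c₀ serves the sup norm and 2L T/c₀ the l² norm; the extra 1 makes both inequalities strict.
  refine ⟨(1 + 2 * L) * (T / c₀) + 1, by positivity, fun N hN hNδ => ?_⟩
  have hN' : (0 : ℝ) < N := by exact_mod_cast hN
  set h := meshSize L N with hdef
  have hh : 0 < h := by rw [hdef, meshSize]; positivity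
  have hhN : h * N = 2 * L := by rw [hdef, meshSize]; field_simp
  set A := schemeMatrix s θ (corr s κ h) h N with hA
  set G := schemeData s θ (corr s κ h) L N g u with hG
  have hoff := schemeMatrix_nonpos hsu hh N
  obtain ⟨hinj, hsurj⟩ := mulVec_bijective hoff hc₀ (hrow N hN)
  obtain ⟨Uh, hUh⟩ := hsurj (nodalValues L N f - G)
  have hUh' : A.mulVec Uh + G = nodalValues L N f := by
    rw [hA, hUh, sub_add_cancel]
  have hpos : 0 < h ^ (1 + α - 2 * s) := by positivity
  have hq : 0 ≤ T / c₀ := by positivity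
  have herr : ∀ b, |(nodalValues L N u - Uh) b| ≤ T / c₀ * h ^ (1 + α - 2 * s) := by
    intro b
    rw [div_mul_eq_mul_div]
    refine abs_le_div_of_abs_mulVec_le hoff hc₀ (hrow N hN) (fun a => ?_) b
    rw [Matrix.mulVec_sub, hUh]
    refine le_of_eq_of_le ?_ (hT N hN hNδ a)
    congr 1
    simp only [Pi.sub_apply, ← hG, ← hdef]
    ring
  refine ⟨Uh, hUh', fun V hV => hinj ?_, ?_, ?_⟩
  · rw [hUh]
    exact eq_sub_of_add_eq hV
  · refine (normInf_le (by positivity) herr).trans_lt ?_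
    nlinarith [mul_nonneg (mul_nonneg hL.le hq) hpos.le]
  · refine (normTwo_le hh.le hhN (by positivity) herr).trans_lt ?_
    nlinarith [mul_nonneg hq hpos.le]

end FracDirichlet

end

theorem mainTheorem3 (s : ℝ)
    (hs : s ∈ Set.Ioo (1 / 250 : ℝ) (1 / 2) ∪ Set.Ioo (1 / 2 : ℝ) 1) :
    (∃ θ κ : ℝ, Suitable s θ κ) ∧
    ∀ θ κ : ℝ, Suitable s θ κ →
      ∀ (L δ α : ℝ), 0 < L → 0 < δ → max 0 (2 * s - 1) < α → α ≤ 1 →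
      ∀ f g u : ℝ × ℝ → ℝ, IsDirichletSolution s L f g u →
        IsC1Holder α u (square (L + δ)) →
        ∃ C : ℝ, 0 < C ∧
          ∀ N : ℕ, 0 < N → 4 * meshSize L N < δ →
            ∃ Uh : InnerIdx N → ℝ, IsSchemeSolution s θ κ L N f g u Uh ∧
              (∀ V : InnerIdx N → ℝ, IsSchemeSolution s θ κ L N f g u V → V = Uh) ∧
              normInf (nodalValues L N u - Uh) <
                C * meshSize L N ^ (1 + α - 2 * s) ∧
              normTwo (meshSize L N) (nodalValues L N u - Uh) <
                C * meshSize L N ^ (1 + α - 2 * s) := by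
  have hs0 : 1 / 250 ≤ s := by
    rcases hs with h | h
    · exact h.1.le
    · linarith [h.1]
  have hs1 : s < 1 := by
    rcases hs with h | h
    · linarith [h.2]
    · exact h.2
  refine ⟨exists_suitable hs0 hs1, fun θ κ hsu L δ α hL hδ hα hα1 f g u hu hr => ?_⟩
  rw [max_lt_iff] at hα
  exact exists_error_bound (by linarith) hs1 hsu hL hδ hα.1.le hα.2 hα1 hu hr
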